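/- Let $K=\mathbb{Q}(\sqrt{-1})$, let $X\subset\mathbb{A}^2_{\mathbb{Z}}$ be the affine curve $y^2=x(x-1)(x+1)$, let $E$ be the elliptic curve over $K$ (with $j=1728$) that compactifies $X_K$, with origin $O$ the point at infinity, and let $x_0=(0,0)$. Let $f:E\to E$ be any self-isogeny of degree two defined over $K$, and let $P$ be the non-zero point of $\ker f$. Then $f$ restricts to a finite étale morphism $X_K\setminus\{P\}\to X_K$, and the vector bundle with connection $(M,\nabla)=f_*(\mathcal{O}_{X_K\setminus\{P\}},d)$ on $X_K$ has the following properties. 1. The $p$-curvatures of $(M,\nabla)$ vanish for all $p$ in the following sense. (a) $(M,\nabla)$ extends to a vector bundle with connection over $X_{\mathcal{O}_K[1/N]}$ for some integer $N\ge 1$, such that the $p$-curvature of its restriction to $X_{\mathcal{O}_K[1/N]}\otimes\mathbb{Z}/p\mathbb{Z}$ is zero for all but finitely many primes $p$. (b) For every finite place $v$ of $K$, of residue characteristic $p$, the formal horizontal sections of $(M,\nabla)$ around $x_0$, written as vectors of power series in the local parameter $y$ by means of a trivialization of $M$ near $x_0$, are germs of meromorphic functions on the open $v$-adic disc $|y|<p^{-1/(p(p-1))}$,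 where $|p|=p^{-1}$. 2. They vanish also in the strict sense, including at the prime above $2$. $(M,\nabla)$ extends to a vector bundle with connection over $X_{\mathcal{O}_K[1/2]}$ whose $p$-curvature on $X_{\mathcal{O}_K[1/2]}\otimes\mathbb{Z}/p\mathbb{Z}$ is zero for every prime $p\neq 2$. Moreover, let $U=X\setminus\{(1,0),(-1,0)\}$ (the closed subscheme $x^2=1$ is removed), which is smooth over $\mathbb{Z}$. The restriction of $(M,\nabla)$ to $U_K$ extends to a vector bundle with connection over $U_{\mathcal{O}_K}$ whose $p$-curvature on $U_{\mathcal{O}_K}\otimes\mathbb{Z}/p\mathbb{Z}$ is zero for every prime $p$, including $p=2$. 3. The differential Galois group $G_{\mathrm{gal}}=\mathrm{Aut}^{\otimes}(\omega)$ of $(M,\nabla)$, where $\omega$ is the fibre functor on the tensor category $\langle M\rangle^{\otimes}$ given by restriction to the generic point of $X_K$, is isomorphic to the constant group scheme $\mathbb{Z}/2\mathbb{Z}$ over the function field $K(X)$. -/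

import Mathlib

open scoped TensorProduct PowerSeries Polynomial NumberField

noncomputable section

/-! ### Modules with connection -/

/-- A connection on an `A`-module `M`, relative to `R`: an additive map `∇ : M → Ω[A⁄R] ⊗ M` with
`∇ (a m) = a ∇ m + da ⊗ m` (so that `∇` is automatically `R`-linear). -/
structure Connection (R A M : Type) [CommRing R] [CommRing A] [Algebra R A]
    [AddCommGroup M] [Module A M] where
  toFun : M →+ Ω[A⁄R] ⊗[A] M
  leibniz : ∀ (a : A) (m : M), toFun (a • m) = a • toFun m + KaehlerDifferential.D R A a ⊗ₜ[A] m

namespace Connection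

section Basic

variable {R A M M' : Type} [CommRing R] [CommRing A] [Algebra R A]
  [AddCommGroup M] [Module A M] [AddCommGroup M'] [Module A M']

/-- `∇(∂) = (∂ ⊗ id) ∘ ∇` for an `R`-linear derivation `∂` of `A`. -/
def along (c : Connection R A M) (δ : Derivation R A A) : M →+ M :=
  ((TensorProduct.lid A M).toLinearMap ∘ₗ
    LinearMap.rTensor M δ.liftKaehlerDifferential).toAddMonoidHom.comp c.toFun

/-- An `A`-linear map that commutes with the connections. -/
def IsHorizontal (c : Connection R A M) (c' : Connection R A M') (h : M →ₗ[A] M') : Prop :=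
  ∀ m, c'.toFun (h m) = LinearMap.lTensor (Ω[A⁄R]) h (c.toFun m)

/-- Horizontal isomorphism of modules with connection. -/
def Isomorphic (c : Connection R A M) (c' : Connection R A M') : Prop :=
  ∃ e : M ≃ₗ[A] M', c.IsHorizontal c' e.toLinearMap

end Basic

/-! ### Pullback -/

section Pullback

variable {R A M : Type} [CommRing R] [CommRing A] [Algebra R A] [AddCommGroup M] [Module A M]
variable {R' A' N : Type} [CommRing R'] [CommRing A'] [Algebra R' A'] [Algebra R R']
  [Algebra R A'] [Algebra A A'] [IsScalarTower R R' A'] [IsScalarTower R A A']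
  [AddCommGroup N] [Module A' N] [Module R' N] [Module A N] [Module R N]
  [IsScalarTower A A' N] [IsScalarTower R R' N] [IsScalarTower R A N]

/-- The `A`-linear map `Ω[A⁄R] → N` induced by an `R'`-derivation `d : A' → N`. -/
def diffMap (d : Derivation R' A' N) : Ω[A⁄R] →ₗ[A] N :=
  ((d.restrictScalars R).compAlgebraMap A).liftKaehlerDifferential

/-- `ω ⊗ m ↦ ω' ⊗ (1 ⊗ m)`, where `ω'` is the image of `ω` in `N`. -/
def pullbackAux (d : Derivation R' A' N) :
    Ω[A⁄R] ⊗[A] M →ₗ[A] N ⊗[A'] (A' ⊗[A] M) :=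
  TensorProduct.lift (LinearMap.mk₂ A
    (fun ω m => (diffMap (R := R) (A := A) d ω) ⊗ₜ[A'] ((1 : A') ⊗ₜ[A] m))
    (by intros; simp [TensorProduct.add_tmul])
    (by intros; simp [TensorProduct.smul_tmul'])
    (by intros; simp [TensorProduct.tmul_add])
    (by
      intro a ω m
      rw [TensorProduct.tmul_smul, ← algebraMap_smul A' a ((1 : A') ⊗ₜ[A] m),
        TensorProduct.tmul_smul, algebraMap_smul]))

theorem pullbackAux_D_tmul (d : Derivation R' A' N) (a : A) (m : M) :
    pullbackAux d (KaehlerDifferential.D R A a ⊗ₜ[A] m)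
      = d (algebraMap A A' a) ⊗ₜ[A'] ((1 : A') ⊗ₜ[A] m) := by
  simp [pullbackAux, diffMap]

/-- The pullback of a connection along `A → A'`, with values in differentials of `A'` given by a
derivation `d : A' → N`:  `a' ⊗ m ↦ a' ∇ m + d a' ⊗ (1 ⊗ m)`. -/
def pullback (c : Connection R A M) (d : Derivation R' A' N) :
    A' ⊗[A] M →+ N ⊗[A'] (A' ⊗[A] M) :=
  TensorProduct.liftAddHom
    (AddMonoidHom.mk' (fun a' => AddMonoidHom.mk'
        (fun m => a' • pullbackAux d (c.toFun m) + d a' ⊗ₜ[A'] ((1 : A') ⊗ₜ[A] m))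
        (by intro m n; simp only [map_add, smul_add, TensorProduct.tmul_add]; abel))
      (by
        intro a b; ext m
        simp only [map_add, add_smul, TensorProduct.add_tmul, AddMonoidHom.mk'_apply,
          AddMonoidHom.add_apply]
        abel))
    (by
      intro a a' m
      have h1 : (1 : A') ⊗ₜ[A] (a • m) = (algebraMap A A' a) • ((1 : A') ⊗ₜ[A] m) := by
        rw [algebraMap_smul, TensorProduct.tmul_smul]
      simp only [AddMonoidHom.mk'_apply, c.leibniz, map_add, map_smul, pullbackAux_D_tmul, h1]
      rw [Algebra.smul_def, d.leibniz, TensorProduct.add_tmul, smul_add,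
        ← TensorProduct.smul_tmul', ← TensorProduct.smul_tmul', TensorProduct.tmul_smul,
        mul_smul, ← algebraMap_smul A' a (pullbackAux d (c.toFun m)),
        smul_comm (algebraMap A A' a) a']
      abel)

theorem pullback_tmul (c : Connection R A M) (d : Derivation R' A' N) (a' : A') (m : M) :
    c.pullback d (a' ⊗ₜ[A] m)
      = a' • pullbackAux d (c.toFun m) + d a' ⊗ₜ[A'] ((1 : A') ⊗ₜ[A] m) := rfl

end Pullback

section BaseChange

variable {R A M : Type} [CommRing R] [CommRing A] [Algebra R A] [AddCommGroup M] [Module A M]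
variable (R' A' : Type) [CommRing R'] [CommRing A'] [Algebra R' A'] [Algebra R R']
  [Algebra R A'] [Algebra A A'] [IsScalarTower R R' A'] [IsScalarTower R A A']

/-- The base change of a connection along a commutative square `R → R'`, `A → A'`. -/
def baseChange (c : Connection R A M) : Connection R' A' (A' ⊗[A] M) where
  toFun := c.pullback (KaehlerDifferential.D R' A')
  leibniz := by
    intro a x
    induction x using TensorProduct.induction_on with
    | zero => simp
    | add x y hx hy => rw [smul_add, map_add, hx, hy, map_add, smul_add, TensorProduct.tmul_add]
                       abel
    | tmul b m =>
      have h1 : b ⊗ₜ[A] m = b • ((1 : A') ⊗ₜ[A] m) := by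
        rw [TensorProduct.smul_tmul', smul_eq_mul, mul_one]
      rw [TensorProduct.smul_tmul', smul_eq_mul, pullback_tmul, pullback_tmul, Derivation.leibniz,
        TensorProduct.add_tmul, smul_add, mul_smul, h1, TensorProduct.tmul_smul,
        ← TensorProduct.smul_tmul', ← TensorProduct.smul_tmul']
      abel

end BaseChange

section Tensor

variable {R A V W : Type} [CommRing R] [CommRing A] [Algebra R A] [AddCommGroup V] [Module A V]
  [AddCommGroup W] [Module A W]

/-- The `A`-bilinear map `(ω ⊗ v, w) ↦ ω ⊗ (v ⊗ w)`. -/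
def tensorLeft : (Ω[A⁄R] ⊗[A] V) →ₗ[A] W →ₗ[A] Ω[A⁄R] ⊗[A] (V ⊗[A] W) :=
  TensorProduct.curry (TensorProduct.assoc A (Ω[A⁄R]) V W).toLinearMap

/-- The `A`-bilinear map `(v, ω ⊗ w) ↦ ω ⊗ (v ⊗ w)`. -/
def tensorRight : V →ₗ[A] (Ω[A⁄R] ⊗[A] W) →ₗ[A] Ω[A⁄R] ⊗[A] (V ⊗[A] W) :=
  LinearMap.lTensorHom (Ω[A⁄R]) ∘ₗ TensorProduct.mk A V W

/-- The map underlying the tensor product connection. -/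
def tensorFun (c : Connection R A V) (c' : Connection R A W) :
    V ⊗[A] W →+ Ω[A⁄R] ⊗[A] (V ⊗[A] W) :=
  TensorProduct.liftAddHom
    (AddMonoidHom.mk' (fun v => AddMonoidHom.mk'
      (fun w => tensorLeft (c.toFun v) w + tensorRight v (c'.toFun w))
      (by intro w w'; simp only [map_add]; abel))
      (by
        intro v v'; ext w
        simp only [map_add, LinearMap.add_apply, AddMonoidHom.mk'_apply, AddMonoidHom.add_apply]
        abel))
    (by
      intro a v w
      have h1 : tensorLeft (KaehlerDifferential.D R A a ⊗ₜ[A] v) w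
          = KaehlerDifferential.D R A a ⊗ₜ[A] (v ⊗ₜ[A] w) := rfl
      have h2 : tensorRight v (KaehlerDifferential.D R A a ⊗ₜ[A] w)
          = KaehlerDifferential.D R A a ⊗ₜ[A] (v ⊗ₜ[A] w) := rfl
      simp only [AddMonoidHom.mk'_apply, Connection.leibniz, map_add, map_smul,
        LinearMap.add_apply, LinearMap.smul_apply, h1, h2]
      rw [add_right_comm, add_assoc])

theorem tensorFun_tmul (c : Connection R A V) (c' : Connection R A W) (v : V) (w : W) :
    tensorFun c c' (v ⊗ₜ[A] w) = tensorLeft (c.toFun v) w + tensorRight v (c'.toFun w) := rfl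

/-- The tensor product connection `∇ (v ⊗ w) = ∇ v ⊗ w + v ⊗ ∇ w`. -/
def tensor (c : Connection R A V) (c' : Connection R A W) : Connection R A (V ⊗[A] W) where
  toFun := tensorFun c c'
  leibniz := by
    intro a x
    induction x using TensorProduct.induction_on with
    | zero => simp
    | add x y hx hy =>
      rw [smul_add, map_add, hx, hy, map_add, smul_add, TensorProduct.tmul_add, add_add_add_comm]
    | tmul v w =>
      have h : tensorLeft (KaehlerDifferential.D R A a ⊗ₜ[A] v) w
          = KaehlerDifferential.D R A a ⊗ₜ[A] (v ⊗ₜ[A] w) := rfl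
      rw [TensorProduct.smul_tmul', tensorFun_tmul, tensorFun_tmul, c.leibniz, map_add, map_smul,
        LinearMap.add_apply, LinearMap.smul_apply, map_smul, LinearMap.smul_apply, h, smul_add,
        add_right_comm]

end Tensor

/-! ### The push-forward of the trivial connection along an étale map -/

section PushForward

variable (R A B : Type) [CommRing R] [CommRing A] [CommRing B] [Algebra R A] [Algebra A B]
  [Algebra R B] [IsScalarTower R A B]

/-- The push-forward of `(𝒪, d)` along the étale morphism `Spec B → Spec A`: the `A`-module `B`
with `∇ : B → Ω[B⁄R] ≅ Ω[A⁄R] ⊗ B` given by the exterior derivative of `B`. -/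
def pushforwardTrivial [Algebra.Etale A B] : Connection R A B where
  toFun := ((TensorProduct.comm A B (Ω[A⁄R])).toLinearMap.toAddMonoidHom.comp
    (KaehlerDifferential.tensorKaehlerEquivOfFormallyEtale R A B).symm.toLinearMap.toAddMonoidHom
      ).comp (KaehlerDifferential.D R B).toLinearMap.toAddMonoidHom
  leibniz := by
    intro a b
    have h := KaehlerDifferential.tensorKaehlerEquivOfFormallyEtale_symm_D_algebraMap R A B a
    simp only [AddMonoidHom.comp_apply, LinearMap.toAddMonoidHom_coe, LinearEquiv.coe_coe,
      Derivation.coeFn_coe]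
    rw [Algebra.smul_def, Derivation.leibniz, map_add, map_smul, map_smul, h, map_add,
      TensorProduct.smul_tmul', smul_eq_mul, mul_one, TensorProduct.comm_tmul, algebraMap_smul,
      map_smul, add_comm]

end PushForward

end Connection

/-! ### `p`-curvature -/

section PCurvature

variable {R A M : Type} [CommRing R] [CommRing A] [Algebra R A] [AddCommGroup M] [Module A M]

theorem derivation_iterate_mul (δ : Derivation R A A) (n : ℕ) (a b : A) :
    δ^[n] (a * b) = ∑ ij ∈ Finset.HasAntidiagonal.antidiagonal n,
      n.choose ij.1 • (δ^[ij.1] a * δ^[ij.2] b) := by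
  induction n with
  | zero => simp
  | succ n ih =>
    rw [Finset.sum_antidiagonal_choose_succ_nsmul (M := A) (fun i j => δ^[i] a * δ^[j] b) n]
    simp only [Function.iterate_succ_apply', ih, map_sum, map_nsmul, Derivation.leibniz,
      smul_eq_mul, smul_add, Finset.sum_add_distrib, add_right_inj]
    refine Finset.sum_congr rfl fun ⟨i, j⟩ hij ↦ ?_
    rw [n.choose_symm_of_eq_add (Finset.HasAntidiagonal.mem_antidiagonal.1 hij).symm, mul_comm]

/-- The `p`-th iterate of a derivation of a ring in which `p = 0`. -/
def derivationPow (p : ℕ) [hp : Fact p.Prime] (hA : (p : A) = 0) (δ : Derivation R A A) :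
    Derivation R A A :=
  Derivation.mk' (δ.toLinearMap ^ p) (by
    intro a b
    have h : ∀ x, (δ.toLinearMap ^ p) x = δ^[p] x := fun x => by
      rw [Module.End.pow_apply]; rfl
    rw [h, h, h, derivation_iterate_mul, Finset.Nat.sum_antidiagonal_eq_sum_range_succ_mk,
      Finset.sum_range_succ, ← Nat.succ_pred_eq_of_pos hp.out.pos, Finset.sum_range_succ',
      Nat.succ_pred_eq_of_pos hp.out.pos, Finset.sum_eq_zero]
    · simp [mul_comm, add_comm]
    · intro i hi
      have hi' : i + 1 < p := by
        have := Finset.mem_range.1 hi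
        have := hp.out.pos
        rw [Nat.pred_eq_sub_one] at *
        omega
      obtain ⟨k, hk⟩ := hp.out.dvd_choose_self (Nat.succ_ne_zero i) hi'
      rw [hk, nsmul_eq_mul, Nat.cast_mul, hA, zero_mul, zero_mul])

/-- The `p`-curvature `ψ_p(∂) = ∇(∂^p) - ∇(∂)^p`, over a ring `A` in which `p = 0`. -/
def Connection.pCurvature (c : Connection R A M) (p : ℕ) [Fact p.Prime] (hA : (p : A) = 0)
    (δ : Derivation R A A) (m : M) : M :=
  c.along (derivationPow p hA δ) m - (c.along δ)^[p] m

/-- The `p`-curvature of the reduction modulo `p` of a module with connection over `A`,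
that is of its restriction to `Spec A ⊗ ℤ/pℤ`, is zero. -/
def Connection.PCurvatureVanishesMod (c : Connection R A M) (p : ℕ) [Fact p.Prime] : Prop :=
  ∀ (δ : Derivation R (A ⧸ Ideal.span {(p : A)}) (A ⧸ Ideal.span {(p : A)}))
    (m : (A ⧸ Ideal.span {(p : A)}) ⊗[A] M),
    (c.baseChange R (A ⧸ Ideal.span {(p : A)})).pCurvature p
      (by
        rw [← map_natCast (Ideal.Quotient.mk (Ideal.span {(p : A)}))]
        exact Ideal.Quotient.eq_zero_iff_mem.2 (Ideal.mem_span_singleton_self _)) δ m = 0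

end PCurvature

/-- Let `(M, ∇)` be a module with connection over `A` (relative to `K`), let `S` be an `R`-algebra
and `A'` a common algebra over `A` and over `S`. This says that there is a vector bundle with
connection on `Spec S` (relative to `R`) which becomes isomorphic to `(M, ∇)` over `A'`, and whose
`p`-curvature vanishes for every prime `p` in the set `T`. -/
def Connection.HasModelWithVanishingPCurvature {K A M : Type} [CommRing K] [CommRing A]
    [Algebra K A] [AddCommGroup M] [Module A M] (c : Connection K A M)
    (R S A' : Type) [CommRing R] [CommRing S] [CommRing A'] [Algebra R S] [Algebra R K]
    [Algebra K A'] [Algebra R A'] [Algebra S A'] [Algebra A A'] [IsScalarTower R K A']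
    [IsScalarTower R S A'] [IsScalarTower K A A'] (T : Set ℕ) : Prop :=
  ∃ (N : Type) (_ : AddCommGroup N) (_ : Module S N) (c₀ : Connection R S N),
    Module.Finite S N ∧ Module.Projective S N ∧
    (c₀.baseChange K A').Isomorphic (c.baseChange K A') ∧
    ∀ (p : ℕ) [Fact p.Prime], p ∈ T → c₀.PCurvatureVanishesMod p

/-! ### The differential Galois group -/

/-- An `A`-module with connection, bundled. -/
structure ConnModule (R A : Type) [CommRing R] [CommRing A] [Algebra R A] where
  carrier : Type
  [addCommGroup : AddCommGroup carrier]
  [module : Module A carrier]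
  conn : Connection R A carrier

attribute [instance] ConnModule.addCommGroup ConnModule.module

namespace ConnModule

variable {R A : Type} [CommRing R] [CommRing A] [Algebra R A]

variable (R A) in
/-- The unit object `(𝒪, d)`. -/
def unit : ConnModule R A where
  carrier := A
  conn :=
    { toFun := (TensorProduct.rid A (Ω[A⁄R])).symm.toLinearMap.toAddMonoidHom.comp
        (KaehlerDifferential.D R A).toLinearMap.toAddMonoidHom
      leibniz := by
        intro a b
        have h : ∀ ω : Ω[A⁄R], (TensorProduct.rid A (Ω[A⁄R])).symm ω = ω ⊗ₜ[A] (1 : A) :=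
          fun ω => rfl
        simp only [AddMonoidHom.comp_apply, LinearMap.toAddMonoidHom_coe, LinearEquiv.coe_coe,
          Derivation.coeFn_coe, smul_eq_mul, Derivation.leibniz, map_add, map_smul, h]
        rw [← TensorProduct.tmul_smul b, smul_eq_mul, mul_one] }

/-- Direct sum. -/
def prod (V W : ConnModule R A) : ConnModule R A where
  carrier := V.carrier × W.carrier
  conn :=
    { toFun := AddMonoidHom.coprod
        ((LinearMap.lTensor (Ω[A⁄R])
          (LinearMap.inl A V.carrier W.carrier)).toAddMonoidHom.comp V.conn.toFun)
        ((LinearMap.lTensor (Ω[A⁄R])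
          (LinearMap.inr A V.carrier W.carrier)).toAddMonoidHom.comp W.conn.toFun)
      leibniz := by
        rintro a ⟨v, w⟩
        have h : ((v, w) : V.carrier × W.carrier)
          = LinearMap.inl A V.carrier W.carrier v + LinearMap.inr A V.carrier W.carrier w := by
            simp
        simp only [AddMonoidHom.coprod_apply, Prod.smul_mk, AddMonoidHom.comp_apply,
          LinearMap.toAddMonoidHom_coe, Connection.leibniz, map_add, map_smul,
          LinearMap.lTensor_tmul, smul_add]
        rw [h, TensorProduct.tmul_add]
        abel }

/-- Tensor product, with `∇ (v ⊗ w) = ∇ v ⊗ w + v ⊗ ∇ w`. -/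
def tensor (V W : ConnModule R A) : ConnModule R A where
  carrier := V.carrier ⊗[A] W.carrier
  conn := V.conn.tensor W.conn

/-- The pairing `B : V' ≅ V^∨` identifies the connection of `V'` with the dual connection:
`d⟨l, v⟩ = ⟨∇ l, v⟩ + ⟨l, ∇ v⟩`. -/
def IsDualPairing (V V' : ConnModule R A) (B : V'.carrier ≃ₗ[A] Module.Dual A V.carrier) : Prop :=
  ∀ (l : V'.carrier) (v : V.carrier),
    KaehlerDifferential.D R A (B l v) =
      TensorProduct.rid A (Ω[A⁄R])
        (LinearMap.lTensor (Ω[A⁄R]) (Module.Dual.eval A V.carrier v ∘ₗ B.toLinearMap)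
          (V'.conn.toFun l))
      + TensorProduct.rid A (Ω[A⁄R]) (LinearMap.lTensor (Ω[A⁄R]) (B l) (V.conn.toFun v))

/-- The objects of the tensor category `⟨V₀⟩^⊗` generated by `V₀`: the modules with connection
that are obtained from `V₀` by tensor products, duals, direct sums and horizontal subobjects and
quotients. -/
inductive InTensorCategory (V₀ : ConnModule R A) : ConnModule R A → Prop
  | base : InTensorCategory V₀ V₀
  | unit : InTensorCategory V₀ (unit R A)
  | tensor {V W} : InTensorCategory V₀ V → InTensorCategory V₀ W →
      InTensorCategory V₀ (V.tensor W)
  | prod {V W} : InTensorCategory V₀ V → InTensorCategory V₀ W → InTensorCategory V₀ (V.prod W)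
  | dual {V V'} (B : V'.carrier ≃ₗ[A] Module.Dual A V.carrier) :
      InTensorCategory V₀ V → IsDualPairing V V' B → InTensorCategory V₀ V'
  | sub {V W} (i : W.carrier →ₗ[A] V.carrier) : InTensorCategory V₀ V →
      Function.Injective i → W.conn.IsHorizontal V.conn i → InTensorCategory V₀ W
  | quotient {V W} (q : V.carrier →ₗ[A] W.carrier) : InTensorCategory V₀ V →
      Function.Surjective q → V.conn.IsHorizontal W.conn q → InTensorCategory V₀ W

/-- A tensor automorphism, over the `A`-algebra `T`, of the fibre functor `V ↦ T ⊗ V` on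
`⟨V₀⟩^⊗`. For an algebra `T` over the fraction field `L` of `A` these are the `T`-points of
`Aut^⊗ ω`, where `ω` is the restriction to the generic point `Spec L`. -/
structure FibreAut (V₀ : ConnModule R A) (T : Type) [CommRing T] [Algebra A T] where
  app : ∀ V : ConnModule R A, InTensorCategory V₀ V → (T ⊗[A] V.carrier ≃ₗ[T] T ⊗[A] V.carrier)
  naturality : ∀ (V W : ConnModule R A) (hV : InTensorCategory V₀ V) (hW : InTensorCategory V₀ W)
    (h : V.carrier →ₗ[A] W.carrier), V.conn.IsHorizontal W.conn h → ∀ x,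
      app W hW (h.baseChange T x) = h.baseChange T (app V hV x)
  map_tensor : ∀ (V W : ConnModule R A) (hV : InTensorCategory V₀ V) (hW : InTensorCategory V₀ W)
    (hVW : InTensorCategory V₀ (V.tensor W)) (x : T ⊗[A] (V.carrier ⊗[A] W.carrier)),
      TensorProduct.AlgebraTensorModule.distribBaseChange A T V.carrier W.carrier
        (app (V.tensor W) hVW x) =
      TensorProduct.map (app V hV).toLinearMap (app W hW).toLinearMap
        (TensorProduct.AlgebraTensorModule.distribBaseChange A T V.carrier W.carrier x)
  map_unit : ∀ (h : InTensorCategory V₀ (unit R A)) (x : T ⊗[A] (unit R A).carrier),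
    app (unit R A) h x = x

/-- The differential Galois group of `V₀`, an affine group scheme over the function field `L`, is
(isomorphic to) the constant group scheme attached to the finite group `G`: there is a homomorphism
`ρ` from `G` to the group of `L`-points such that for each `L`-algebra `T` the `T`-points are
the automorphisms `∑ γ, e γ • ρ γ`, for a unique family `e` of complete orthogonal idempotents of
`T` indexed by `G`, which is the same as a `T`-point of the constant group scheme. -/
def HasConstantGaloisGroup (V₀ : ConnModule R A) (L : Type) [Field L] [Algebra A L]
    (G : Type) [Group G] [Fintype G] : Prop :=
  ∃ ρ : G → FibreAut V₀ L,
    (∀ a b V hV x, (ρ (a * b)).app V hV x = (ρ a).app V hV ((ρ b).app V hV x)) ∧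
    ∀ (T : Type) [CommRing T] [Algebra A T] [Algebra L T] [IsScalarTower A L T],
      let Represents (e : G → T) (g : FibreAut V₀ T) : Prop := ∀ V hV (v : V.carrier),
        g.app V hV ((1 : T) ⊗ₜ[A] v) = ∑ γ, e γ •
          LinearMap.rTensor V.carrier (IsScalarTower.toAlgHom A L T).toLinearMap
            ((ρ γ).app V hV ((1 : L) ⊗ₜ[A] v))
      (∀ e, CompleteOrthogonalIdempotents e → ∃ g, Represents e g) ∧
      (∀ g, ∃! e, CompleteOrthogonalIdempotents e ∧ Represents e g)

end ConnModule

/-! ### The curve `y² = x (x - 1) (x + 1)` -/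

/-- The Weierstrass curve `y² = x³ - x` over `R`. -/
def curve (R : Type) [CommRing R] : WeierstrassCurve R := ⟨0, 0, 0, -1, 0⟩

/-- The coordinate ring `R[x, y] / (y² - x³ + x)` of the affine curve `X` over `R`. -/
abbrev XRing (R : Type) [CommRing R] : Type := (curve R).toAffine.CoordinateRing

/-- The function field of `X` over a field `K`. -/
abbrev XField (K : Type) [Field K] : Type := (curve K).toAffine.FunctionField

/-- The coordinate function `x`. -/
def xX (R : Type) [CommRing R] : XRing R :=
  WeierstrassCurve.Affine.CoordinateRing.mk (curve R).toAffine (Polynomial.C Polynomial.X)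

/-- The coordinate function `y`. -/
def yX (R : Type) [CommRing R] : XRing R :=
  WeierstrassCurve.Affine.CoordinateRing.mk (curve R).toAffine Polynomial.X

theorem curve_polynomial (R : Type) [CommRing R] : (curve R).toAffine.polynomial =
    Polynomial.X ^ 2 - Polynomial.C (Polynomial.X ^ 3 - Polynomial.X) := by
  simp [WeierstrassCurve.Affine.polynomial, curve, sub_eq_add_neg]

theorem yX_sq (R : Type) [CommRing R] : yX R ^ 2 = xX R ^ 3 - xX R := by
  have h : WeierstrassCurve.Affine.CoordinateRing.mk (curve R).toAffine
      (Polynomial.X ^ 2 - Polynomial.C (Polynomial.X ^ 3 - Polynomial.X)) = 0 := by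
    rw [← curve_polynomial]
    exact AdjoinRoot.mk_self
  simp only [map_sub, map_pow] at h
  exact sub_eq_zero.1 h

/-- Base change of coordinate rings, `x ↦ x` and `y ↦ y`. -/
def XRing.map (R R' : Type) [CommRing R] [CommRing R'] [Algebra R R'] : XRing R →+* XRing R' :=
  AdjoinRoot.lift (Polynomial.eval₂RingHom (algebraMap R (XRing R')) (xX R')) (yX R') (by
    refine (congrArg (Polynomial.eval₂ _ _) (curve_polynomial R)).trans ?_
    simp only [map_sub, map_pow, Polynomial.eval₂_sub, Polynomial.eval₂_pow, Polynomial.eval₂_X,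
      Polynomial.eval₂_C, Polynomial.coe_eval₂RingHom, yX_sq R', sub_self])

theorem XRing.map_algebraMap (R R' : Type) [CommRing R] [CommRing R'] [Algebra R R'] (r : R) :
    XRing.map R R' (algebraMap R (XRing R) r) = algebraMap R (XRing R') r := by
  have h : algebraMap R (XRing R) r = AdjoinRoot.of _ (Polynomial.C r) := rfl
  rw [h, XRing.map, AdjoinRoot.lift_of]
  simp

theorem XRing.map_xX (R R' : Type) [CommRing R] [CommRing R'] [Algebra R R'] :
    XRing.map R R' (xX R) = xX R' := by
  simp [XRing.map, xX]

/-- The ring `R[x, y, (x² - 1)⁻¹] / (y² - x³ + x)` of the open subscheme `U = X - {(1, 0), (-1, 0)}`,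
which is smooth over `R`. -/
abbrev URing (R : Type) [CommRing R] : Type := Localization.Away (xX R ^ 2 - 1)


/-- Base change of the rings of `U`. -/
def URing.map (R R' : Type) [CommRing R] [CommRing R'] [Algebra R R'] : URing R →+* URing R' :=
  IsLocalization.Away.lift (xX R ^ 2 - 1)
    (g := (algebraMap (XRing R') (URing R')).comp (XRing.map R R')) (by
      rw [RingHom.comp_apply, map_sub, map_pow, map_one, XRing.map_xX]
      exact IsLocalization.Away.algebraMap_isUnit _)

theorem URing.map_algebraMap (R R' : Type) [CommRing R] [CommRing R'] [Algebra R R'] (r : R) :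
    URing.map R R' (algebraMap R (URing R) r) = algebraMap R (URing R') r := by
  rw [IsScalarTower.algebraMap_apply R (XRing R) (URing R), URing.map,
    IsLocalization.Away.lift_eq, RingHom.comp_apply, XRing.map_algebraMap,
    ← IsScalarTower.algebraMap_apply R (XRing R') (URing R')]

/-- `(M, ∇)` on `X_K` is the generic fibre of a vector bundle with connection on `X_R` whose
`p`-curvature vanishes for all primes `p` in `T`. -/
def HasVanishingModelOnX {K M : Type} [Field K] [AddCommGroup M] [Module (XRing K) M]
    (c : Connection K (XRing K) M) (R : Type) [CommRing R] [Algebra R K] (T : Set ℕ) : Prop :=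
  letI : Algebra (XRing R) (XRing K) := (XRing.map R K).toAlgebra
  haveI : IsScalarTower R (XRing R) (XRing K) :=
    .of_algebraMap_eq fun r => (XRing.map_algebraMap R K r).symm
  c.HasModelWithVanishingPCurvature R (XRing R) (XRing K) T

/-- The restriction of `(M, ∇)` to `U_K` is the generic fibre of a vector bundle with connection on
`U_R` whose `p`-curvature vanishes for all primes `p` in `T`. -/
def HasVanishingModelOnU {K M : Type} [Field K] [AddCommGroup M] [Module (XRing K) M]
    (c : Connection K (XRing K) M) (R : Type) [CommRing R] [Algebra R K] (T : Set ℕ) : Prop :=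
  letI : Algebra (URing R) (URing K) := (URing.map R K).toAlgebra
  haveI : IsScalarTower R (URing R) (URing K) :=
    .of_algebraMap_eq fun r => (URing.map_algebraMap R K r).symm
  c.HasModelWithVanishingPCurvature R (URing R) (URing K) T

/-- A power series over `ℂ_[p]` that converges on the open disc `|z| < r`. -/
def ConvergesOnDisc {p : ℕ} [Fact p.Prime] (r : ℝ) (g : ℂ_[p]⟦X⟧) : Prop :=
  ∀ z : ℂ_[p], ‖z‖ < r → Summable fun n => PowerSeries.coeff n g * z ^ n

/-- A power series over `ℂ_[p]` that is the germ at `0` of a meromorphic function on the open disc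
`|z| < r`. -/
def IsMeromorphicOnDisc {p : ℕ} [Fact p.Prime] (r : ℝ) (g : ℂ_[p]⟦X⟧) : Prop :=
  ∃ a b : ℂ_[p]⟦X⟧, ConvergesOnDisc r a ∧ ConvergesOnDisc r b ∧ b ≠ 0 ∧ b * g = a

/-- The formal horizontal sections of `(M, ∇)` around `x₀ = (0, 0)`, seen as vectors of power
series in the local parameter `y` by means of a trivialization of `M` near `x₀` (sections of `M`
which form a basis of the formal completion), are germs of meromorphic functions
on the discs `|y| < p ^ (-1 / (p (p - 1)))` in `ℂ_[p]`, for all `p` and all embeddings of `K` in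
`ℂ_[p]`, that is for all finite places of `K`. Here `ι` is the expansion of functions at `x₀`. -/
def FormalSectionsMeromorphic {K M : Type} [Field K] [AddCommGroup M] [Module (XRing K) M]
    (c : Connection K (XRing K) M) : Prop :=
  ∃ ι : XRing K →ₐ[K] K⟦X⟧, ι (yX K) = PowerSeries.X ∧
    PowerSeries.constantCoeff (ι (xX K)) = 0 ∧
    letI : Algebra (XRing K) K⟦X⟧ := ι.toRingHom.toAlgebra
    haveI : IsScalarTower K (XRing K) K⟦X⟧ := .of_algebraMap_eq fun r => (ι.commutes r).symm
    ∃ (n : ℕ) (b : Module.Basis (Fin n) K⟦X⟧ (K⟦X⟧ ⊗[XRing K] M)),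
      (∀ i, ∃ m : M, b i = (1 : K⟦X⟧) ⊗ₜ[XRing K] m) ∧
      ∀ s : K⟦X⟧ ⊗[XRing K] M, c.pullback (PowerSeries.derivative K) s = 0 →
        ∀ (i : Fin n) (p : ℕ) [Fact p.Prime] (σ : K →+* ℂ_[p]),
          IsMeromorphicOnDisc ((p : ℝ) ^ (-(1 / ((p : ℝ) * ((p : ℝ) - 1)))))
            (PowerSeries.map σ (b.repr s i))

/-- The `p`-curvatures of a vector bundle with connection on `X_K` vanish for all `p`: on a model
over `𝒪_K[1/N]` they vanish for all but finitely many `p`, and at each finite place the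
formal horizontal sections around `(0, 0)` are meromorphic on the disc on which vanishing
`p`-curvature, in the case of good reduction, would make them so. -/
structure PCurvaturesVanishForAll {K M : Type} [Field K] [NumberField K] [AddCommGroup M]
    [Module (XRing K) M] (c : Connection K (XRing K) M) : Prop where
  almost_all : ∃ N : ℕ, N ≠ 0 ∧ ∃ E : Finset ℕ,
    HasVanishingModelOnX c (Algebra.adjoin (𝓞 K) {(N : K)⁻¹}) {p | p ∉ E}
  formal : FormalSectionsMeromorphic c

/-! ### Isogenies -/

/-- A rational function on the curve with a pole at the point `O` at infinity. For a nonzero element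
of the coordinate ring, the degree of the norm to `K[x]` is the order of the pole at `O`. -/
def HasPoleAtOrigin {K : Type} [Field K] (g : XField K) : Prop :=
  ∃ a b : XRing K, b ≠ 0 ∧
    g * algebraMap (XRing K) (XField K) b = algebraMap (XRing K) (XField K) a ∧
    (Algebra.norm K[X] b).natDegree < (Algebra.norm K[X] a).natDegree

/-- An isogeny `f : E → E` over `K` of the elliptic curve `E : y² = x³ - x`: a nonconstant morphism,
given by the homomorphism `f^*` of function fields, with `f(O) = O`, that is, such that
the function `f^* x` has a pole at `O`. -/
structure SelfIsogeny (K : Type) [Field K] where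
  comorphism : XField K →ₐ[K] XField K
  map_origin : HasPoleAtOrigin (comorphism (algebraMap (XRing K) (XField K) (xX K)))

namespace SelfIsogeny

variable {K : Type} [Field K] (f : SelfIsogeny K)

/-- The degree `[K(E) : f^* K(E)]`. -/
def degree : ℕ := Module.finrank f.comorphism.fieldRange (XField K)

/-- The function field of the source of `f`, seen as an algebra over the
coordinate ring of `X` through `f^*`. -/
def SourceField (_ : SelfIsogeny K) : Type := XField K

instance : Field f.SourceField := inferInstanceAs (Field (XField K))

instance : Algebra K f.SourceField := inferInstanceAs (Algebra K (XField K))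

instance : Algebra (XRing K) f.SourceField :=
  (f.comorphism.toRingHom.comp (algebraMap (XRing K) (XField K))).toAlgebra

instance : IsScalarTower K (XRing K) f.SourceField := .of_algebraMap_eq fun r => by
  have h := (f.comorphism.commutes r).symm
  rw [IsScalarTower.algebraMap_apply K (XRing K) (XField K)] at h
  exact h

/-- The ring of functions on the affine curve `f⁻¹(X) = E - ker f`, as an algebra over the
coordinate ring of `X`: the integral closure of the coordinate ring of `X` in the function field of
the source. -/
abbrev PreimageRing : Type := integralClosure (XRing K) f.SourceField

end SelfIsogeny

end

noncomputable section

/-! ### Multiplicative connections on algebras -/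

/-! Everything follows from an explicit description of the covering. If `f` has degree two then f^*x
= (a/c)(x² - 1)/x with (c/a)² = -4. As c/a = ±2i = (1 ± i)², this is the square of a multiple of
y/x. Hence the ring of functions on f⁻¹(X) is A[t, s] with t² = x, ts = y, s² = x² - 1, where A is
the coordinate ring of X (`exists_sq_eq`, `nonempty_cover_equiv`). This algebra, `Cover`, is defined
over any base. The identity t⁴ - s² = 1 says that t and s have no common zero, and most computations
with `Cover` rest on it.

To find f^*x one first shows that it is even in y. Otherwise the chord through the point f^*(x, y)
and its conjugate meets the curve in a point over K(x), which is constant by Mason–Stothers, and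
this contradicts the pole at the origin (`conj_comorphism_xF`). Then f^*x = p/q with deg p = 2 and
deg q = 1, and pq(p² - q²) is (x³ - x) times a square. Unique factorization and two discriminants
leave only the solutions above (`pencil_eq`, `pencil_constraints`).

The connection is used only through its Leibniz rule for products. On an unramified algebra there is
at most one such connection, because a difference of two is a derivation over the base, so algebra
isomorphisms are automatically horizontal (`IsMultiplicative.isHorizontal`). For the same reason the
p-curvature, which is also a derivation over the base, vanishes
(`IsMultiplicative.pCurvature_eq_zero`). Where 2 is invertible `Cover` is étale, which gives the
model on X. On U it is the quadratic algebra generated by s, and ∇s = x/(x² - 1) dx ⊗ s has no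
denominator 2. Modulo an odd p the section (x² - 1)^((p-1)/2) s is horizontal, and modulo 2 the
curve equation gives dx = 0, so that s itself is horizontal
(`sqrtConnection_pCurvatureVanishesMod`).

Around (0, 0) the horizontal sections are spanned by 1 and s/√(1 - x²) up to a constant. The
coefficient 1/√(1 - x²) is an integral power series in y⁴/4 (`exists_integral_series`), so it
converges for |y|⁴ < |4|, which for p = 2 is exactly the required disc.

For the Galois group, put g = x² - 1. The generic fibre of every object of the tensor category is
spanned by solutions of ∇v = 0 and of ∇v = (dg/2g)v (`IsSplit.of_inTensorCategory`). The two types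
do not mix, since g is not a constant times a square. Acting by 1 on the first type and by u, u² =
1, on the second gives tensor automorphisms. Conversely an automorphism is determined on the
generator (`FibreAut.app_eq_of_app_base_eq`), where it is an algebra automorphism commuting with the
deck involution and so sends s to us (`exists_app_tmul_s`). Since 2 is invertible, such u correspond
to pairs of complementary idempotents. -/

theorem Derivation.eq_zero_of_formallyUnramified {A C N : Type*} [CommRing A] [CommRing C]
    [Algebra A C] [AddCommGroup N] [Module A N] [Module C N] [IsScalarTower A C N]
    [Algebra.FormallyUnramified A C] (d : Derivation A C N) (b : C) : d b = 0 := by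
  rw [← d.liftKaehlerDifferential_comp_D b, Subsingleton.elim (KaehlerDifferential.D A C b) 0,
    map_zero]

namespace Connection

section Multiplicative

variable {R A C C' : Type} [CommRing R] [CommRing A] [Algebra R A] [CommRing C] [Algebra A C]
  [CommRing C'] [Algebra A C']

/-- A connection on an `A`-algebra `C` that satisfies the Leibniz rule for the product of `C`. -/
def IsMultiplicative (c : Connection R A C) : Prop :=
  ∀ b b' : C, c.toFun (b * b') = LinearMap.lTensor (Ω[A⁄R]) (LinearMap.mulLeft A b) (c.toFun b')
    + LinearMap.lTensor (Ω[A⁄R]) (LinearMap.mulLeft A b') (c.toFun b)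

theorem lTensor_mulLeft_comm {N : Type*} [AddCommGroup N] [Module A N] (b : C) (z : C ⊗[A] N) :
    LinearMap.lTensor N (LinearMap.mulLeft A b) (TensorProduct.comm A C N z)
      = TensorProduct.comm A C N (b • z) := by
  induction z using TensorProduct.induction_on with
  | zero => simp
  | add x y hx hy => simp only [map_add, smul_add, hx, hy]
  | tmul c n => simp [TensorProduct.smul_tmul']

theorem comm_symm_lTensor_mulLeft {N : Type*} [AddCommGroup N] [Module A N] (b : C)
    (z : N ⊗[A] C) :
    (TensorProduct.comm A C N).symm (LinearMap.lTensor N (LinearMap.mulLeft A b) z)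
      = b • (TensorProduct.comm A C N).symm z := by
  rw [LinearEquiv.symm_apply_eq, ← lTensor_mulLeft_comm, LinearEquiv.apply_symm_apply]

/-- This is the Leibniz rule for the exterior derivative of `C`, the only property of the
push-forward connection on which the later arguments depend. -/
theorem pushforwardTrivial_isMultiplicative [Algebra R C] [IsScalarTower R A C]
    [Algebra.Etale A C] : (pushforwardTrivial R A C).IsMultiplicative := by
  intro b b'
  simp only [pushforwardTrivial, AddMonoidHom.comp_apply, LinearMap.toAddMonoidHom_coe,
    LinearEquiv.coe_coe, Derivation.coeFn_coe, Derivation.leibniz, map_add, map_smul,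
    lTensor_mulLeft_comm]

theorem IsMultiplicative.map_one {c : Connection R A C} (hc : c.IsMultiplicative) :
    c.toFun 1 = 0 := by
  have h := hc 1 1
  have h1 : LinearMap.mulLeft A (1 : C) = LinearMap.id := by ext; simp
  rw [h1, LinearMap.lTensor_id, mul_one, LinearMap.id_apply] at h
  exact left_eq_add.1 h

theorem IsMultiplicative.map_algebraMap {c : Connection R A C} (hc : c.IsMultiplicative) (a : A) :
    c.toFun (algebraMap A C a) = KaehlerDifferential.D R A a ⊗ₜ[A] (1 : C) := by
  rw [Algebra.algebraMap_eq_smul_one, c.leibniz, hc.map_one, smul_zero, zero_add]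

/-- An isomorphism of unramified `A`-algebras with multiplicative connections is horizontal. -/
theorem IsMultiplicative.isHorizontal [Algebra.FormallyUnramified A C'] {c : Connection R A C}
    {c' : Connection R A C'} (hc : c.IsMultiplicative) (hc' : c'.IsMultiplicative)
    (e : C ≃ₐ[A] C') : c.IsHorizontal c' e.toLinearMap := by
  have key : ∀ b : C, LinearMap.lTensor (Ω[A⁄R]) e.toLinearMap ∘ₗ
      LinearMap.lTensor (Ω[A⁄R]) (LinearMap.mulLeft A b) =
      LinearMap.lTensor (Ω[A⁄R]) (LinearMap.mulLeft A (e b)) ∘ₗ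
      LinearMap.lTensor (Ω[A⁄R]) e.toLinearMap := fun b => by
    rw [← LinearMap.lTensor_comp, ← LinearMap.lTensor_comp]
    congr 1; ext x; simp
  -- The defect of horizontality, transported to `C'`. The terms da ⊗ n cancel, so it is `A`-linear;
  -- the two product rules then make it a derivation over `A`, which vanishes because `C'` is
  -- unramified.
  let φ : C' →ₗ[A] C' ⊗[A] Ω[A⁄R] := (TensorProduct.comm A C' (Ω[A⁄R])).symm.toLinearMap ∘ₗ
    { toFun := fun n => c'.toFun n - LinearMap.lTensor (Ω[A⁄R]) e.toLinearMap (c.toFun (e.symm n))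
      map_add' := fun m n => by simp only [map_add]; abel
      map_smul' := fun a m => by
        simp only [map_smul, Connection.leibniz, map_add, LinearMap.lTensor_tmul,
          AlgEquiv.toLinearMap_apply, AlgEquiv.apply_symm_apply, RingHom.id_apply, smul_sub]
        abel }
  have hφ : ∀ n, φ n = (TensorProduct.comm A C' (Ω[A⁄R])).symm
      (c'.toFun n - LinearMap.lTensor (Ω[A⁄R]) e.toLinearMap (c.toFun (e.symm n))) := fun n => rfl
  let d : Derivation A C' (C' ⊗[A] Ω[A⁄R]) := Derivation.mk' φ (by
    intro a b
    have h1 := fun (b : C) z => LinearMap.congr_fun (key b) z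
    simp only [LinearMap.comp_apply] at h1
    simp only [hφ, map_mul, hc _ _, hc' _ _, map_add, map_sub, h1, comm_symm_lTensor_mulLeft,
      AlgEquiv.apply_symm_apply, smul_sub]
    abel)
  intro m
  have h0 : φ (e m) = 0 := d.eq_zero_of_formallyUnramified (e m)
  rw [hφ, LinearEquiv.map_eq_zero_iff, e.symm_apply_apply, sub_eq_zero] at h0
  exact h0

theorem isomorphic_of_isMultiplicative [Algebra.FormallyUnramified A C'] {c : Connection R A C}
    {c' : Connection R A C'} (hc : c.IsMultiplicative) (hc' : c'.IsMultiplicative)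
    (e : C ≃ₐ[A] C') : c.Isomorphic c' :=
  ⟨e.toLinearEquiv, hc.isHorizontal hc' e⟩

end Multiplicative

/-! ### Multiplicative connections under base change. -/

section BaseChangeMultiplicative

variable {R A C : Type} [CommRing R] [CommRing A] [Algebra R A] [CommRing C] [Algebra A C]
variable {R' A' N : Type} [CommRing R'] [CommRing A'] [Algebra R' A'] [Algebra R R']
  [Algebra R A'] [Algebra A A'] [IsScalarTower R R' A'] [IsScalarTower R A A']
  [AddCommGroup N] [Module A' N] [Module R' N] [Module A N] [Module R N]
  [IsScalarTower A A' N] [IsScalarTower R R' N] [IsScalarTower R A N]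

theorem pullbackAux_lTensor {M M' : Type} [AddCommGroup M] [Module A M] [AddCommGroup M']
    [Module A M'] (d : Derivation R' A' N) (h : M →ₗ[A] M') (z : Ω[A⁄R] ⊗[A] M) :
    pullbackAux d (LinearMap.lTensor (Ω[A⁄R]) h z)
      = LinearMap.lTensor N (h.baseChange A') (pullbackAux d z) := by
  induction z using TensorProduct.induction_on with
  | zero => simp
  | add x y hx hy => simp only [map_add, hx, hy]
  | tmul ω m =>
    change _ ⊗ₜ _ = LinearMap.lTensor N (h.baseChange A') (_ ⊗ₜ _)
    simp

/-- Both sides are biadditive, so pure tensors suffice; there it is the Leibniz rule of `d` on one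
factor combined with that of `c` on the other. The target `N` is general because power series and
the function field are later used with a single derivation in place of all differentials. -/
theorem IsMultiplicative.pullback_mul {c : Connection R A C} (hc : c.IsMultiplicative)
    (d : Derivation R' A' N) (z w : A' ⊗[A] C) :
    c.pullback d (z * w) = LinearMap.lTensor N (LinearMap.mulLeft A' z) (c.pullback d w)
      + LinearMap.lTensor N (LinearMap.mulLeft A' w) (c.pullback d z) := by
  induction z using TensorProduct.induction_on with
  | zero =>
    have : LinearMap.mulLeft A' (0 : A' ⊗[A] C) = 0 := by ext; simp
    simp [this]
  | add x y hx hy =>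
    have : LinearMap.mulLeft A' (x + y) = LinearMap.mulLeft A' x + LinearMap.mulLeft A' y := by
      ext; simp [add_mul]
    rw [add_mul, map_add, hx, hy, this, LinearMap.lTensor_add, map_add, map_add,
      LinearMap.add_apply]
    abel
  | tmul a b =>
  induction w using TensorProduct.induction_on with
  | zero =>
    have : LinearMap.mulLeft A' (0 : A' ⊗[A] C) = 0 := by ext; simp
    simp [this]
  | add x y hx hy =>
    have : LinearMap.mulLeft A' (x + y) = LinearMap.mulLeft A' x + LinearMap.mulLeft A' y := by
      ext; simp [add_mul]
    rw [mul_add, map_add, hx, hy, this, LinearMap.lTensor_add, map_add, map_add,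
      LinearMap.add_apply]
    abel
  | tmul a' b' =>
  have h1 : ∀ (a : A') (b : C), LinearMap.mulLeft A' (a ⊗ₜ[A] b)
      = a • (LinearMap.mulLeft A b).baseChange A' := by
    intro a b; ext m; simp [TensorProduct.smul_tmul']
  rw [Algebra.TensorProduct.tmul_mul_tmul, pullback_tmul, pullback_tmul, pullback_tmul, hc b b',
    h1, h1, LinearMap.lTensor_smul, LinearMap.lTensor_smul, map_add, pullbackAux_lTensor,
    pullbackAux_lTensor, d.leibniz]
  simp only [LinearMap.smul_apply, map_add, map_smul, LinearMap.lTensor_tmul,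
    LinearMap.baseChange_tmul, LinearMap.mulLeft_apply, smul_add, TensorProduct.add_tmul,
    TensorProduct.smul_tmul', smul_smul, mul_comm b' b, mul_comm a' a]
  abel

theorem IsMultiplicative.baseChange {c : Connection R A C} (hc : c.IsMultiplicative) :
    (c.baseChange R' A').IsMultiplicative :=
  fun z w => hc.pullback_mul (KaehlerDifferential.D R' A') z w

end BaseChangeMultiplicative

end Connection

/-! ### Vanishing of `p`-curvatures -/

section PCurvature

variable {R A : Type} [CommRing R] [CommRing A] [Algebra R A]

theorem Connection.along_smul {M : Type} [AddCommGroup M] [Module A M] (c : Connection R A M)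
    (δ : Derivation R A A) (a : A) (m : M) :
    c.along δ (a • m) = a • c.along δ m + δ a • m := by
  simp [Connection.along, c.leibniz]

theorem derivationPow_apply (p : ℕ) [Fact p.Prime] (hA : (p : A) = 0) (δ : Derivation R A A)
    (a : A) : derivationPow p hA δ a = δ^[p] a := by
  change (δ.toLinearMap ^ p) a = _
  rw [Module.End.pow_apply]; rfl

theorem Connection.exists_addMonoidHom_pCurvature {M : Type} [AddCommGroup M] [Module A M]
    (c : Connection R A M) (p : ℕ) [Fact p.Prime] (hA : (p : A) = 0) (δ : Derivation R A A) :
    ∃ F : M →+ M, ∀ m, F m = c.pCurvature p hA δ m := by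
  let E : AddMonoid.End M := c.along δ
  let G : M →+ M := E ^ p
  refine ⟨c.along (derivationPow p hA δ) - G, fun m => ?_⟩
  have : ∀ (n : ℕ) (m : M), (E ^ n) m = (c.along δ)^[n] m := by
    intro n
    induction n with
    | zero => intro m; rfl
    | succ n ih =>
      intro m
      rw [pow_succ, Function.iterate_succ_apply, ← ih]
      rfl
  exact congrArg (c.along (derivationPow p hA δ) m - ·) (this p m)

/-- The `p`-curvature vanishes if the module is spanned by horizontal elements. -/
theorem Connection.pCurvature_eq_zero_of_span {M : Type} [AddCommGroup M] [Module A M]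
    (c : Connection R A M) (p : ℕ) [Fact p.Prime] (hA : (p : A) = 0) (S : Set M)
    (hS : ∀ m ∈ S, c.toFun m = 0) (hspan : Submodule.span A S = ⊤) (δ : Derivation R A A) (m : M) :
    c.pCurvature p hA δ m = 0 := by
  have h0 : ∀ (δ : Derivation R A A), ∀ m ∈ S, c.along δ m = 0 := fun δ m hm => by
    simp [along, hS m hm]
  -- On multiples of a horizontal element the connection differentiates only the coefficient, so the
  -- two terms of the p-curvature are the same.
  have h1 : ∀ (n : ℕ) (a : A), ∀ m ∈ S, (c.along δ)^[n] (a • m) = (δ^[n] a) • m := by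
    intro n
    induction n with
    | zero => intros; rfl
    | succ n ih =>
      intro a m hm
      rw [Function.iterate_succ_apply, c.along_smul, h0 δ m hm, smul_zero, zero_add, ih _ m hm,
        ← Function.iterate_succ_apply]
  obtain ⟨F, hF⟩ := c.exists_addMonoidHom_pCurvature p hA δ
  have hm : m ∈ Submodule.span A S := hspan ▸ Submodule.mem_top
  obtain ⟨n, f, g, rfl⟩ := Submodule.mem_span_set'.1 hm
  rw [← hF, map_sum]
  refine Finset.sum_eq_zero fun i _ => ?_
  rw [hF, pCurvature, h1 _ _ _ (g i).2, c.along_smul, h0 _ _ (g i).2, derivationPow_apply,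
    smul_zero, zero_add, sub_self]

theorem Connection.IsMultiplicative.along_mul {C : Type} [CommRing C] [Algebra A C]
    {c : Connection R A C} (hc : c.IsMultiplicative) (δ : Derivation R A A) (b b' : C) :
    c.along δ (b * b') = b * c.along δ b' + b' * c.along δ b := by
  have h : ∀ b z, (TensorProduct.lid A C) (LinearMap.rTensor C δ.liftKaehlerDifferential
      (LinearMap.lTensor (Ω[A⁄R]) (LinearMap.mulLeft A b) z)) =
      b * (TensorProduct.lid A C) (LinearMap.rTensor C δ.liftKaehlerDifferential z) := by
    intro b z
    induction z using TensorProduct.induction_on with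
    | zero => simp
    | add x y hx hy => simp only [map_add, hx, hy, mul_add]
    | tmul ω m => simp
  simp only [along, AddMonoidHom.comp_apply, hc b b', map_add, LinearMap.toAddMonoidHom_coe,
    LinearMap.comp_apply, LinearEquiv.coe_coe, h]

/-- The operator ∇(∂) is a derivation of the ring `C` extending ∂. In characteristic p its p-th
power and ∇(∂^p) are both derivations extending ∂^p, so their difference is a derivation over `A`,
and `C` is unramified. -/
theorem Connection.IsMultiplicative.pCurvature_eq_zero {C : Type} [CommRing C] [Algebra A C]
    [Algebra.FormallyUnramified A C] {c : Connection R A C} (hc : c.IsMultiplicative)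
    (p : ℕ) [Fact p.Prime] (hA : (p : A) = 0) (δ : Derivation R A A) (b : C) :
    c.pCurvature p hA δ b = 0 := by
  have hC : (p : C) = 0 := by rw [← map_natCast (algebraMap A C), hA, map_zero]
  have halg : ∀ (δ : Derivation R A A) (a : A),
      c.along δ (algebraMap A C a) = algebraMap A C (δ a) := fun δ a => by
    have h1 : c.along δ 1 = 0 := by simp [along, hc.map_one]
    rw [Algebra.algebraMap_eq_smul_one, c.along_smul, h1, smul_zero, zero_add,
      Algebra.algebraMap_eq_smul_one]
  let D : Derivation ℤ C C := Derivation.mk' (c.along δ).toIntLinearMap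
    fun a b => hc.along_mul δ a b
  have hD : ∀ b, D b = c.along δ b := fun b => rfl
  have hDn : ∀ b, derivationPow p hC D b = (c.along δ)^[p] b := fun b => by
    rw [derivationPow_apply]; rfl
  have hit : ∀ (n : ℕ) a, D^[n] (algebraMap A C a) = algebraMap A C (δ^[n] a) := by
    intro n
    induction n with
    | zero => intro a; rfl
    | succ n ih =>
      intro a
      rw [Function.iterate_succ_apply, hD, halg, ih, ← Function.iterate_succ_apply]
  have hmul : ∀ x y : C, c.pCurvature p hA δ (x * y)
      = x * c.pCurvature p hA δ y + y * c.pCurvature p hA δ x := fun x y => by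
    simp only [pCurvature, ← hDn, Derivation.leibniz, hc.along_mul, smul_eq_mul]; ring
  obtain ⟨F, hF⟩ := c.exists_addMonoidHom_pCurvature p hA δ
  let E : Derivation A C C := Derivation.mk'
    { toFun := c.pCurvature p hA δ
      map_add' := fun x y => by rw [← hF, ← hF, ← hF, map_add]
      map_smul' := fun a x => by
        rw [Algebra.smul_def, hmul, RingHom.id_apply, Algebra.smul_def]
        have : c.pCurvature p hA δ (algebraMap A C a) = 0 := by
          rw [pCurvature, halg, derivationPow_apply, ← hit]
          exact sub_self _
        rw [this, mul_zero, add_zero] }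
    fun x y => hmul x y
  exact E.eq_zero_of_formallyUnramified b

theorem Connection.IsMultiplicative.pCurvatureVanishesMod {C : Type} [CommRing C] [Algebra A C]
    [Algebra.FormallyUnramified A C] {c : Connection R A C} (hc : c.IsMultiplicative)
    (p : ℕ) [Fact p.Prime] : c.PCurvatureVanishesMod p :=
  fun δ m => hc.baseChange.pCurvature_eq_zero p _ δ m

end PCurvature

/-! ### The double cover `x = t²`, `y = t s` -/

/-- The relations `t² = x`, `t s = y` and `s² = x² - 1` between two variables. -/
def coverRelations (A : Type) [CommRing A] (x y : A) : Set (MvPolynomial (Fin 2) A) :=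
  {MvPolynomial.X 0 ^ 2 - MvPolynomial.C x,
    MvPolynomial.X 0 * MvPolynomial.X 1 - MvPolynomial.C y,
    MvPolynomial.X 1 ^ 2 - MvPolynomial.C (x ^ 2 - 1)}

/-- The universal `A`-algebra with elements `t`, `s` such that `t² = x`, `t s = y` and
`s² = x² - 1`. -/
def Cover (A : Type) [CommRing A] (x y : A) : Type :=
  MvPolynomial (Fin 2) A ⧸ Ideal.span (coverRelations A x y)

namespace Cover

variable {A : Type} [CommRing A] {x y : A}

instance : CommRing (Cover A x y) := inferInstanceAs (CommRing (_ ⧸ _))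
instance : Algebra A (Cover A x y) := inferInstanceAs (Algebra A (_ ⧸ _))

variable (A x y) in
/-- The quotient map. -/

def mk : MvPolynomial (Fin 2) A →ₐ[A] Cover A x y := Ideal.Quotient.mkₐ A _

theorem mk_surjective : Function.Surjective (mk A x y) := Ideal.Quotient.mkₐ_surjective A _

/-- The square root of `x`. -/
def t : Cover A x y := mk A x y (MvPolynomial.X 0)
/-- The square root of `x² - 1`. -/
def s : Cover A x y := mk A x y (MvPolynomial.X 1)

theorem mk_eq_zero {f : MvPolynomial (Fin 2) A} (hf : f ∈ coverRelations A x y) : mk A x y f = 0 :=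
  Ideal.Quotient.eq_zero_iff_mem.2 (Ideal.subset_span hf)

theorem mk_C (a : A) : mk A x y (MvPolynomial.C a) = algebraMap A (Cover A x y) a :=
  (mk A x y).commutes a

theorem t_sq : (t : Cover A x y) ^ 2 = algebraMap A _ x := by
  have h := mk_eq_zero (x := x) (y := y) (f := MvPolynomial.X 0 ^ 2 - MvPolynomial.C x) (by simp [coverRelations])
  rwa [map_sub, map_pow, mk_C, sub_eq_zero] at h

theorem t_mul_s : (t : Cover A x y) * s = algebraMap A _ y := by
  have h := mk_eq_zero (x := x) (y := y)
    (f := MvPolynomial.X 0 * MvPolynomial.X 1 - MvPolynomial.C y) (by simp [coverRelations])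
  rwa [map_sub, map_mul, mk_C, sub_eq_zero] at h

theorem s_sq : (s : Cover A x y) ^ 2 = algebraMap A _ (x ^ 2 - 1) := by
  have h := mk_eq_zero (x := x) (y := y)
    (f := MvPolynomial.X 1 ^ 2 - MvPolynomial.C (x ^ 2 - 1)) (by simp [coverRelations])
  rwa [map_sub, map_pow, mk_C, sub_eq_zero] at h

section Lift

variable {C : Type*} [CommRing C] [Algebra A C]

/-- The universal property of the double cover. -/
def lift (t' s' : C) (h1 : t' ^ 2 = algebraMap A C x) (h2 : t' * s' = algebraMap A C y)
    (h3 : s' ^ 2 = algebraMap A C (x ^ 2 - 1)) : Cover A x y →ₐ[A] C :=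
  Ideal.Quotient.liftₐ _ (MvPolynomial.aeval ![t', s']) (by
    intro f hf
    have : Ideal.span (coverRelations A x y) ≤ RingHom.ker (MvPolynomial.aeval (R := A) ![t', s']).toRingHom :=
      Ideal.span_le.2 (by
        rintro f (rfl | rfl | rfl) <;> simp [RingHom.mem_ker, h1, h2, h3, -map_sub, map_sub])
    exact this hf)

variable {t' s' : C} {h1 : t' ^ 2 = algebraMap A C x} {h2 : t' * s' = algebraMap A C y}
    {h3 : s' ^ 2 = algebraMap A C (x ^ 2 - 1)}

theorem lift_t : lift t' s' h1 h2 h3 t = t' := by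
  change MvPolynomial.aeval (R := A) ![t', s'] (MvPolynomial.X 0) = t'
  simp

theorem lift_s : lift t' s' h1 h2 h3 s = s' := by
  change MvPolynomial.aeval (R := A) ![t', s'] (MvPolynomial.X 1) = s'
  simp

theorem algHom_ext {f g : Cover A x y →ₐ[A] C} (ht : f t = g t) (hs : f s = g s) : f = g := by
  have h : f.comp (mk A x y) = g.comp (mk A x y) := by
    ext i
    fin_cases i
    · exact ht
    · exact hs
  ext b
  obtain ⟨b, rfl⟩ := mk_surjective b
  exact DFunLike.congr_fun h b

end Lift

theorem y_smul_s : y • (s : Cover A x y) = (x ^ 2 - 1) • t := by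
  have h := s_sq (x := x) (y := y)
  rw [Algebra.smul_def, Algebra.smul_def, ← h, ← t_mul_s]; ring

/-- The relations turn t², ts and s² into scalars, so monomials of degree at most one suffice. The
three generators are not independent in general. -/
theorem exists_eq (b : Cover A x y) :
    ∃ a₀ a₁ a₂ : A, b = algebraMap A _ a₀ + a₁ • t + a₂ • s := by
  obtain ⟨f, rfl⟩ := mk_surjective b
  induction f using MvPolynomial.induction_on with
  | C a => exact ⟨a, 0, 0, by rw [mk_C]; simp⟩
  | add p q hp hq =>
    obtain ⟨a, b, c, h⟩ := hp
    obtain ⟨a', b', c', h'⟩ := hq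
    exact ⟨a + a', b + b', c + c', by rw [map_add, h, h']; simp only [add_smul, map_add]; ring⟩
  | mul_X p i hp =>
    obtain ⟨a, b, c, h⟩ := hp
    rw [map_mul, h]
    have ht := t_sq (x := x) (y := y)
    have hs := s_sq (x := x) (y := y)
    have hts := t_mul_s (x := x) (y := y)
    fin_cases i
    · refine ⟨b * x + c * y, a, 0, ?_⟩
      change _ * t = _
      simp only [Algebra.smul_def, map_mul, map_add, map_zero, ← ht, ← hts]; ring
    · refine ⟨b * y + c * (x ^ 2 - 1), 0, a, ?_⟩
      change _ * s = _
      rw [map_add, map_mul, map_mul, ← hs, ← hts]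
      simp only [Algebra.smul_def, map_zero]; ring

theorem span_eq_top :
    Submodule.span A {(1 : Cover A x y), t, s} = ⊤ := by
  refine eq_top_iff.2 fun b _ => ?_
  obtain ⟨a₀, a₁, a₂, rfl⟩ := exists_eq b
  rw [Algebra.algebraMap_eq_smul_one]
  exact add_mem (add_mem (Submodule.smul_mem _ _ (Submodule.subset_span (by simp)))
    (Submodule.smul_mem _ _ (Submodule.subset_span (by simp))))
    (Submodule.smul_mem _ _ (Submodule.subset_span (by simp)))

instance : Module.Finite A (Cover A x y) :=
  ⟨⟨({1, t, s} : Set _).toFinite.toFinset, by simpa using span_eq_top⟩⟩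

/-- One Newton step modulo a square-zero ideal, `a`, `g`, `b` being the errors in the three
equations. The linearized equations are tδt = a/2, tδs + sδt = g and sδs = b/2. As t⁴ - s² acts as 1
on the errors, they force δt = t³(tδt) - s(sδt) = t³a/2 - sg + tb/2, and δs likewise. That these
corrections work needs the compatibility 2tsg = as² + t²b, which is the curve equation to first
order. -/
theorem lift_identities {C : Type*} [CommRing C] {t s x y c a b g : C} (h2 : c * 2 = 1)
    (ha : x = t ^ 2 + a) (hg : y = t * s + g) (hb : x ^ 2 - 1 = s ^ 2 + b)
    (hxy : y ^ 2 = x * (x ^ 2 - 1)) (haa : a * a = 0) (hab : a * b = 0) (hag : a * g = 0)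
    (hbb : b * b = 0) (hbg : b * g = 0) (hgg : g * g = 0) :
    (t + (c * t ^ 3 * a - s * g + c * t * b)) ^ 2 = x ∧
    (t + (c * t ^ 3 * a - s * g + c * t * b)) * (s + (t ^ 3 * g - c * t ^ 2 * s * a - c * s * b))
      = y ∧
    (s + (t ^ 3 * g - c * t ^ 2 * s * a - c * s * b)) ^ 2 = x ^ 2 - 1 := by
  have e1 : 2 * t * s * g = a * s ^ 2 + t ^ 2 * b := by
    rw [hg, hb, ha] at hxy
    linear_combination hxy - hgg + hab
  have e2 : t ^ 4 - s ^ 2 = 1 + b - 2 * t ^ 2 * a := by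
    rw [ha] at hb
    linear_combination hb - haa
  have ea : a * (t ^ 4 - s ^ 2) = a := by rw [e2]; linear_combination hab - 2 * t ^ 2 * haa
  have eb : b * (t ^ 4 - s ^ 2) = b := by rw [e2]; linear_combination hbb - 2 * t ^ 2 * hab
  have eg : g * (t ^ 4 - s ^ 2) = g := by rw [e2]; linear_combination hbg - 2 * t ^ 2 * hag
  have n0 : (c * t ^ 3 * a - s * g + c * t * b) ^ 2 = 0 := by
    linear_combination (c * t ^ 3) ^ 2 * haa + s ^ 2 * hgg + (c * t) ^ 2 * hbb
      - 2 * c * t ^ 3 * s * hag + 2 * c * t ^ 3 * c * t * hab - 2 * s * c * t * hbg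
  have m0 : (t ^ 3 * g - c * t ^ 2 * s * a - c * s * b) ^ 2 = 0 := by
    linear_combination t ^ 6 * hgg + (c * t ^ 2 * s) ^ 2 * haa + (c * s) ^ 2 * hbb
      - 2 * t ^ 3 * (c * t ^ 2 * s) * hag - 2 * t ^ 3 * (c * s) * hbg
      + 2 * (c * t ^ 2 * s) * (c * s) * hab
  have nm : (c * t ^ 3 * a - s * g + c * t * b) * (t ^ 3 * g - c * t ^ 2 * s * a - c * s * b) = 0 := by
    linear_combination (c * t ^ 6 + c * t ^ 2 * s ^ 2) * hag - c * t ^ 3 * (c * t ^ 2 * s) * haa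
      - (c * t ^ 3 * (c * s) + c * t * (c * t ^ 2 * s)) * hab - s * t ^ 3 * hgg
      + (s * (c * s) + c * t * t ^ 3) * hbg - c * t * (c * s) * hbb
  refine ⟨?_, ?_, ?_⟩
  · linear_combination n0 - ha + (t ^ 4 * a + t ^ 2 * b) * h2 - e1 + ea
  · linear_combination nm - hg + eg
  · linear_combination m0 - hb - (t ^ 2 * s ^ 2 * a + s ^ 2 * b) * h2 + t ^ 2 * e1 + eb

theorem formallyEtale (h2 : IsUnit (2 : A)) (hxy : y ^ 2 = x * (x ^ 2 - 1)) :
    Algebra.FormallyEtale A (Cover A x y) := by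
  obtain ⟨c, hc⟩ := h2.exists_left_inv
  refine Algebra.FormallyEtale.iff_comp_bijective.2 fun C _ _ I hI => ?_
  have hI2 : ∀ {a b : C}, a ∈ I → b ∈ I → a * b = 0 := fun {a b} ha hb => by
    have : a * b ∈ I ^ 2 := by rw [pow_two]; exact Ideal.mul_mem_mul ha hb
    rwa [hI] at this
  have hc' : algebraMap A C c * 2 = 1 := by
    rw [← map_ofNat (algebraMap A C), ← map_mul, hc, map_one]
  have hxy' : algebraMap A C y ^ 2 = algebraMap A C x * (algebraMap A C x ^ 2 - 1) := by
    rw [← map_pow, hxy]; simp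
  constructor
  -- Uniqueness: the differences n of the images of t and m of those of s satisfy tn = 0, sm = 0 and
  -- tm + sn = 0, where 2 is cancelled, and t⁴ - s² = 1 then gives n = m = 0.
  · intro f g hfg
    have hmem : ∀ b, g b - f b ∈ I := fun b => by
      rw [← Ideal.Quotient.mk_eq_mk_iff_sub_mem]
      exact (DFunLike.congr_fun hfg b).symm
    have hn := hmem t
    have hm := hmem s
    have ht := congrArg f (t_sq (x := x) (y := y))
    have ht' := congrArg g (t_sq (x := x) (y := y))
    have hs := congrArg f (s_sq (x := x) (y := y))
    have hs' := congrArg g (s_sq (x := x) (y := y))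
    have hts := congrArg f (t_mul_s (x := x) (y := y))
    have hts' := congrArg g (t_mul_s (x := x) (y := y))
    simp only [map_pow, map_mul, AlgHom.commutes, map_sub, map_one] at ht ht' hs hs' hts hts'
    have e := hI2 hn hn
    have e' := hI2 hm hm
    have e'' := hI2 hn hm
    obtain ⟨t₀, ht₀⟩ : ∃ z, z = f t := ⟨_, rfl⟩
    obtain ⟨t₁, ht₁⟩ : ∃ z, z = g t := ⟨_, rfl⟩
    obtain ⟨s₀, hs₀⟩ : ∃ z, z = f s := ⟨_, rfl⟩
    obtain ⟨s₁, hs₁⟩ : ∃ z, z = g s := ⟨_, rfl⟩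
    rw [← ht₀, ← ht₁] at e
    rw [← hs₀, ← hs₁] at e'
    rw [← ht₀, ← ht₁, ← hs₀, ← hs₁] at e''
    rw [← ht₀] at ht
    rw [← ht₁] at ht'
    rw [← hs₀] at hs
    rw [← hs₁] at hs'
    rw [← ht₀, ← hs₀] at hts
    rw [← ht₁, ← hs₁] at hts'
    have e1 : t₀ * (t₁ - t₀) = 0 := by
      linear_combination algebraMap A C c * (ht' - ht - e) - t₀ * (t₁ - t₀) * hc'
    have e2 : s₀ * (s₁ - s₀) = 0 := by
      linear_combination algebraMap A C c * (hs' - hs - e') - s₀ * (s₁ - s₀) * hc'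
    have e3 : t₀ * (s₁ - s₀) + s₀ * (t₁ - t₀) = 0 := by linear_combination hts' - hts - e''
    have e4 : t₀ ^ 4 - s₀ ^ 2 = 1 := by rw [hs, ← ht]; ring
    refine algHom_ext ?_ ?_
    · rw [← ht₀, ← ht₁]
      linear_combination -t₀ ^ 3 * e1 + s₀ * e3 - t₀ * e2 + (t₁ - t₀) * e4
    · rw [← hs₀, ← hs₁]
      linear_combination -t₀ ^ 3 * e3 + t₀ ^ 2 * s₀ * e1 + s₀ * e2 + (s₁ - s₀) * e4
  -- Existence: arbitrary lifts of the images of t and s are corrected by `lift_identities`; the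
  -- corrections lie in I, so the reduction is unchanged.
  · intro f
    obtain ⟨t₀, ht₀⟩ := Ideal.Quotient.mk_surjective (f t)
    obtain ⟨s₀, hs₀⟩ := Ideal.Quotient.mk_surjective (f s)
    have hcomm : ∀ a, f (algebraMap A _ a) = Ideal.Quotient.mk I (algebraMap A C a) :=
      fun a => f.commutes a
    have ha : algebraMap A C x - t₀ ^ 2 ∈ I := by
      rw [← Ideal.Quotient.mk_eq_mk_iff_sub_mem, ← hcomm, ← t_sq, map_pow, map_pow, ht₀]
    have hg : algebraMap A C y - t₀ * s₀ ∈ I := by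
      rw [← Ideal.Quotient.mk_eq_mk_iff_sub_mem, ← hcomm, ← t_mul_s, map_mul, map_mul, ht₀, hs₀]
    have hb : (algebraMap A C x ^ 2 - 1) - s₀ ^ 2 ∈ I := by
      have : algebraMap A C x ^ 2 - 1 = algebraMap A C (x ^ 2 - 1) := by simp
      rw [this, ← Ideal.Quotient.mk_eq_mk_iff_sub_mem, ← hcomm, ← s_sq, map_pow, map_pow, hs₀]
    obtain ⟨k1, k2, k3⟩ := lift_identities (t := t₀) (s := s₀) hc' (eq_add_of_sub_eq' rfl)
      (eq_add_of_sub_eq' rfl) (eq_add_of_sub_eq' rfl) hxy' (hI2 ha ha) (hI2 ha hb) (hI2 ha hg)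
      (hI2 hb hb) (hI2 hb hg) (hI2 hg hg)
    refine ⟨lift _ _ k1 k2 (k3.trans (by simp)), algHom_ext ?_ ?_⟩
    · rw [AlgHom.comp_apply, lift_t, ← ht₀, Ideal.Quotient.mkₐ_eq_mk, eq_comm,
        Ideal.Quotient.mk_eq_mk_iff_sub_mem, sub_add_cancel_left]
      exact neg_mem (add_mem (sub_mem (I.mul_mem_left _ ha) (I.mul_mem_left _ hg))
        (I.mul_mem_left _ hb))
    · rw [AlgHom.comp_apply, lift_s, ← hs₀, Ideal.Quotient.mkₐ_eq_mk, eq_comm,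
        Ideal.Quotient.mk_eq_mk_iff_sub_mem, sub_add_cancel_left]
      exact neg_mem (sub_mem (sub_mem (I.mul_mem_left _ hg) (I.mul_mem_left _ ha))
        (I.mul_mem_left _ hb))

theorem etale (h2 : IsUnit (2 : A)) (hxy : y ^ 2 = x * (x ^ 2 - 1)) :
    Algebra.Etale A (Cover A x y) where
  formallyEtale := formallyEtale h2 hxy
  finitePresentation :=
    .quotient (I := Ideal.span (coverRelations A x y))
      ⟨(show (coverRelations A x y).Finite by simp [coverRelations]).toFinset, by simp⟩

/-- An étale algebra is flat and finitely presented as an algebra; being finite it is finitely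
presented as a module too, and flat finitely presented modules are projective. -/
theorem projective_of_etale {C : Type} [CommRing C] [Algebra A C] [Algebra.Etale A C]
    [Module.Finite A C] : Module.Projective A C :=
  have := Module.FinitePresentation.of_finite_of_finitePresentation A C
  Module.Flat.projective_of_finitePresentation

/-! ### Base change of the double cover. -/

section BaseChange

variable (A' : Type) [CommRing A'] [Algebra A A']

/-- Base change of the double cover. -/
def baseChange (x y : A) {x' y' : A'} (hx : algebraMap A A' x = x') (hy : algebraMap A A' y = y') :
    A' ⊗[A] Cover A x y ≃ₐ[A'] Cover A' x' y' := by
  letI : Algebra A (Cover A' x' y') := Algebra.compHom _ (algebraMap A A')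
  haveI : IsScalarTower A A' (Cover A' x' y') := .of_algebraMap_eq fun _ => rfl
  refine AlgEquiv.ofAlgHom
    (Algebra.TensorProduct.lift (Algebra.ofId A' _)
      (lift t s (t_sq.trans ?_) (t_mul_s.trans ?_) (s_sq.trans ?_)) fun _ _ => Commute.all _ _)
    (lift (1 ⊗ₜ t) (1 ⊗ₜ s) ?_ ?_ ?_) ?_ ?_
  · rw [IsScalarTower.algebraMap_apply A A', hx]
  · rw [IsScalarTower.algebraMap_apply A A', hy]
  · rw [IsScalarTower.algebraMap_apply A A' (Cover A' x' y') (x ^ 2 - 1),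
      map_sub (algebraMap A A'), map_pow (algebraMap A A'), hx, map_one (algebraMap A A')]
  · rw [Algebra.TensorProduct.tmul_pow, t_sq, one_pow, ← hx, Algebra.TensorProduct.algebraMap_apply,
      Algebra.algebraMap_self_apply, Algebra.algebraMap_eq_smul_one, Algebra.algebraMap_eq_smul_one,
      TensorProduct.smul_tmul]
  · rw [Algebra.TensorProduct.tmul_mul_tmul, t_mul_s, one_mul, ← hy,
      Algebra.TensorProduct.algebraMap_apply,
      Algebra.algebraMap_self_apply, Algebra.algebraMap_eq_smul_one, Algebra.algebraMap_eq_smul_one,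
      TensorProduct.smul_tmul]
  · rw [Algebra.TensorProduct.tmul_pow, s_sq, one_pow, ← hx, ← map_pow,
      ← map_one (algebraMap A A'), ← map_sub, map_one, Algebra.TensorProduct.algebraMap_apply,
      Algebra.algebraMap_self_apply, Algebra.algebraMap_eq_smul_one, Algebra.algebraMap_eq_smul_one,
      TensorProduct.smul_tmul]
  · refine algHom_ext ?_ ?_
    · simp [lift_t]
    · simp [lift_s]
  · refine Algebra.TensorProduct.ext (by ext) (algHom_ext ?_ ?_)
    · simp [lift_t]
    · simp [lift_s]

theorem baseChange_s (x y : A) {x' y' : A'} (hx : algebraMap A A' x = x')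
    (hy : algebraMap A A' y = y') : baseChange A' x y hx hy (1 ⊗ₜ s) = s := by
  simp [baseChange, lift_s]

end BaseChange

/-! ### The double cover as a quadratic algebra. -/

section Quadratic

/-- Where `x² - 1` is invertible, the double cover is obtained by adjoining `s = √(x² - 1)`. -/
def equivQuadratic (hxy : y ^ 2 = x * (x ^ 2 - 1)) (hg : IsUnit (x ^ 2 - 1)) :
    Cover A x y ≃ₐ[A] QuadraticAlgebra A (x ^ 2 - 1) 0 := by
  have hω : (QuadraticAlgebra.omega : QuadraticAlgebra A (x ^ 2 - 1) 0) ^ 2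
      = algebraMap A _ (x ^ 2 - 1) := by
    rw [pow_two QuadraticAlgebra.omega, QuadraticAlgebra.omega_mul_omega_eq_add, zero_smul, add_zero,
      Algebra.algebraMap_eq_smul_one]
  have hu : (↑hg.unit⁻¹ : A) * (x ^ 2 - 1) = 1 := hg.val_inv_mul
  have hs := s_sq (x := x) (y := y)
  refine AlgEquiv.ofAlgHom
    (lift (algebraMap A _ (y * ↑hg.unit⁻¹) * QuadraticAlgebra.omega) QuadraticAlgebra.omega
      ?_ ?_ hω) (QuadraticAlgebra.lift ⟨s, ?_⟩) ?_ ?_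
  · rw [mul_pow, hω, ← map_pow, ← map_mul]
    congr 1
    linear_combination (↑hg.unit⁻¹ : A) ^ 2 * (x ^ 2 - 1) * hxy
      + (x * ↑hg.unit⁻¹ * (x ^ 2 - 1) + x) * hu
  · rw [mul_assoc, ← pow_two, hω, ← map_mul]
    congr 1
    linear_combination y * hu
  · rw [zero_smul, add_zero, ← pow_two, hs, Algebra.algebraMap_eq_smul_one]
  · refine QuadraticAlgebra.algHom_ext ?_
    simp [lift_s]
  · refine algHom_ext ?_ ?_
    · rw [AlgHom.comp_apply, lift_t, map_mul, AlgHom.commutes, AlgHom.id_apply]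
      have : QuadraticAlgebra.lift (⟨s, by
        rw [zero_smul, add_zero, ← pow_two, hs, Algebra.algebraMap_eq_smul_one]⟩ :
          { u : Cover A x y // u * u = (x ^ 2 - 1) • 1 + (0 : A) • u })
          QuadraticAlgebra.omega = s := by simp
      rw [this, mul_comm y, ← Algebra.smul_def, mul_smul, y_smul_s, smul_smul, hu, one_smul]
    · simp [lift_s]

theorem equivQuadratic_s (hxy : y ^ 2 = x * (x ^ 2 - 1)) (hg : IsUnit (x ^ 2 - 1)) :
    equivQuadratic hxy hg s = QuadraticAlgebra.omega := by
  simp [equivQuadratic, lift_s]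

end Quadratic

end Cover

/-! ### The function field of `y² = x³ - x` -/

section FunctionField

variable (K : Type) [Field K]

/-- The function `x` in the function field. -/
def xF : XField K := algebraMap (XRing K) (XField K) (xX K)

/-- The function `y` in the function field. -/
def yF : XField K := algebraMap (XRing K) (XField K) (yX K)

theorem yX_sq_eq (R : Type) [CommRing R] : yX R ^ 2 = xX R * (xX R ^ 2 - 1) := by
  rw [yX_sq]; ring

theorem yF_sq_eq : yF K ^ 2 = xF K * (xF K ^ 2 - 1) := by
  rw [yF, xF, ← map_pow, yX_sq_eq]; simp

variable {K}

theorem algebraMap_polynomial_eq_aeval {R : Type} [CommRing R] (p : R[X]) :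
    algebraMap R[X] (XRing R) p = Polynomial.aeval (xX R) p := by
  have h : (Algebra.ofId R[X] (XRing R)).restrictScalars R = Polynomial.aeval (xX R) := by
    ext; simp [Algebra.ofId_apply]; rfl
  exact DFunLike.congr_fun h p

theorem algebraMap_polynomial_XField (p : K[X]) :
    algebraMap K[X] (XField K) p = Polynomial.aeval (xF K) p := by
  rw [IsScalarTower.algebraMap_apply K[X] (XRing K) (XField K), algebraMap_polynomial_eq_aeval, xF,
    Polynomial.aeval_algebraMap_apply]

theorem algebraMap_polynomial_injective : Function.Injective (algebraMap K[X] (XField K)) := by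
  rw [IsScalarTower.algebraMap_eq K[X] (XRing K) (XField K)]
  exact (IsFractionRing.injective (XRing K) (XField K)).comp
    (FaithfulSMul.algebraMap_injective K[X] (XRing K))

/-- The inclusion `K(x) → K(x, y)`. -/
def ratMap (K : Type) [Field K] : RatFunc K →ₐ[K[X]] XField K :=
  IsFractionRing.liftAlgHom (g := Algebra.ofId K[X] (XField K)) algebraMap_polynomial_injective

theorem ratMap_injective : Function.Injective (ratMap K) := (ratMap K).toRingHom.injective

theorem ratMap_X : ratMap K RatFunc.X = xF K := by
  rw [← RatFunc.algebraMap_X, AlgHom.commutes, algebraMap_polynomial_XField, Polynomial.aeval_X]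

theorem ratMap_algebraMap (p : K[X]) : ratMap K (algebraMap K[X] (RatFunc K) p)
    = Polynomial.aeval (xF K) p := by
  rw [AlgHom.commutes, algebraMap_polynomial_XField]

/-- The denominator is integral over K[x], hence divides a nonzero polynomial in x; after
rationalizing, the numerator is expanded in the basis 1, y of the coordinate ring. -/
theorem exists_eq_ratMap_add (g : XField K) : ∃ a b, g = ratMap K a + ratMap K b * yF K := by
  obtain ⟨a, b, hb, rfl⟩ := IsFractionRing.div_surjective (A := XRing K) g
  have hb0 : b ≠ 0 := nonZeroDivisors.ne_zero hb
  have : Module.Finite K[X] (XRing K) := .of_basis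
    (WeierstrassCurve.Affine.CoordinateRing.basis (curve K).toAffine)
  obtain ⟨c, d, hd, h⟩ := (Algebra.IsIntegral.isIntegral (R := K[X]) b).isAlgebraic.exists_smul_eq_mul
    a (mem_nonZeroDivisors_of_ne_zero hb0)
  obtain ⟨p, q, hpq⟩ := WeierstrassCurve.Affine.CoordinateRing.exists_smul_basis_eq c
  have hd' : algebraMap K[X] (XField K) d ≠ 0 := by
    simpa using algebraMap_polynomial_injective.ne hd
  have hb' : algebraMap (XRing K) (XField K) b ≠ 0 := by simpa using hb0
  refine ⟨algebraMap K[X] _ p / algebraMap K[X] _ d, algebraMap K[X] _ q / algebraMap K[X] _ d, ?_⟩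
  simp only [map_div₀, AlgHom.commutes]
  have h1 := congrArg (algebraMap (XRing K) (XField K)) h
  rw [← hpq, map_mul, Algebra.smul_def, Algebra.smul_def, Algebra.smul_def, map_mul, map_add,
    map_mul, map_mul, map_one, mul_one, ← IsScalarTower.algebraMap_apply,
    ← IsScalarTower.algebraMap_apply, ← IsScalarTower.algebraMap_apply] at h1
  change _ = _ * (_ + _ * yF K) at h1
  field_simp
  linear_combination h1

theorem ratMap_add_eq_zero {a b : RatFunc K} (h : ratMap K a + ratMap K b * yF K = 0) :
    a = 0 ∧ b = 0 := by
  have ha := RatFunc.num_div_denom a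
  have hb := RatFunc.num_div_denom b
  have hda := RatFunc.denom_ne_zero a
  have hdb := RatFunc.denom_ne_zero b
  have hda' : algebraMap K[X] (XField K) a.denom ≠ 0 := by
    simpa using algebraMap_polynomial_injective.ne hda
  have hdb' : algebraMap K[X] (XField K) b.denom ≠ 0 := by
    simpa using algebraMap_polynomial_injective.ne hdb
  rw [← ha, ← hb] at h
  simp only [map_div₀, AlgHom.commutes] at h
  field_simp at h
  have h2 : algebraMap (XRing K) (XField K) ((a.num * b.denom) • 1 + (b.num * a.denom) • yX K) = 0 := by
    simp only [Algebra.smul_def, map_add, map_mul, mul_one,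
      ← IsScalarTower.algebraMap_apply]
    change _ + _ * yF K = 0
    linear_combination h
  rw [map_eq_zero_iff _ (IsFractionRing.injective (XRing K) (XField K))] at h2
  obtain ⟨h3, h4⟩ := WeierstrassCurve.Affine.CoordinateRing.smul_basis_eq_zero h2
  constructor
  · simpa [hdb] using h3
  · simpa [hda] using h4

theorem ratMap_add_inj {a b c d : RatFunc K}
    (h : ratMap K a + ratMap K b * yF K = ratMap K c + ratMap K d * yF K) : a = c ∧ b = d := by
  have h1 : ratMap K (a - c) + ratMap K (b - d) * yF K = 0 := by
    rw [map_sub, map_sub]; linear_combination h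
  have := ratMap_add_eq_zero h1
  exact ⟨sub_eq_zero.1 this.1, sub_eq_zero.1 this.2⟩

theorem yF_sq_eq_ratMap : yF K ^ 2 = ratMap K (RatFunc.X ^ 3 - RatFunc.X) := by
  rw [yF_sq_eq]; simp only [map_sub, map_pow, ratMap_X]; ring

theorem algebraMap_eq_ratMap (k : K) : algebraMap K (XField K) k = ratMap K (algebraMap K _ k) := by
  rw [IsScalarTower.algebraMap_apply K K[X] (RatFunc K), AlgHom.commutes,
    ← IsScalarTower.algebraMap_apply]

theorem exists_polynomial_of_isIntegral {z : RatFunc K} (h : IsIntegral K[X] z) :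
    ∃ p, z = algebraMap K[X] _ p := by
  obtain ⟨p, hp⟩ := (IsIntegrallyClosed.isIntegral_iff (R := K[X])).1 h
  exact ⟨p, hp.symm⟩

/-- In lowest terms the square of the denominator of `z` divides the squarefree `f`, so the
denominator is a unit. The case `f = 1` treats rational functions whose square is a polynomial. -/
theorem exists_polynomial_of_sq_mul {z : RatFunc K} {f p : K[X]} (hf : Squarefree f)
    (h : z ^ 2 * algebraMap K[X] _ f = algebraMap K[X] _ p) : ∃ q, z = algebraMap K[X] _ q := by
  have hz := RatFunc.num_div_denom z
  have hd : algebraMap K[X] (RatFunc K) z.denom ≠ 0 := by simpa using RatFunc.denom_ne_zero z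
  rw [← hz, div_pow, div_mul_eq_mul_div, div_eq_iff (pow_ne_zero _ hd), ← map_pow, ← map_pow,
    ← map_mul, ← map_mul] at h
  have h1 := IsFractionRing.injective K[X] (RatFunc K) h
  have h2 : z.denom ^ 2 ∣ f := ((RatFunc.isCoprime_num_denom z).symm.pow (m := 2)
    (n := 2)).dvd_of_dvd_mul_left (h1 ▸ dvd_mul_left _ _)
  obtain ⟨u, hu⟩ := (hf z.denom (by rwa [← pow_two])).exists_left_inv
  refine ⟨z.num * u, ?_⟩
  rw [← hz, div_eq_iff hd, ← map_mul, mul_assoc, hu, mul_one, hz]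

theorem eval₂_curve_polynomial_neg_yF :
    (curve K).toAffine.polynomial.eval₂ (Algebra.ofId K[X] (XField K) : K[X] →+* XField K) (-yF K)
      = 0 := by
  refine (congrArg (Polynomial.eval₂ _ _) (curve_polynomial K)).trans ?_
  rw [Polynomial.eval₂_sub, Polynomial.eval₂_pow, Polynomial.eval₂_X,
    Polynomial.eval₂_C]
  change _ - algebraMap K[X] (XField K) _ = 0
  rw [algebraMap_polynomial_XField, map_sub, map_pow, Polynomial.aeval_X, neg_sq, yF_sq_eq]
  ring

/-- The involution `y ↦ -y` on the coordinate ring, with values in the function field. -/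
def conjRing (K : Type) [Field K] : XRing K →ₐ[K[X]] XField K :=
  AdjoinRoot.liftAlgHom _ (Algebra.ofId K[X] (XField K)) (-yF K) eval₂_curve_polynomial_neg_yF

theorem conjRing_yX : conjRing K (yX K) = -yF K :=
  AdjoinRoot.lift_root eval₂_curve_polynomial_neg_yF

theorem conjRing_injective : Function.Injective (conjRing K) := by
  rw [injective_iff_map_eq_zero]
  intro a ha
  obtain ⟨p, q, rfl⟩ := WeierstrassCurve.Affine.CoordinateRing.exists_smul_basis_eq a
  change conjRing K (p • 1 + q • yX K) = 0 at ha
  have h1 : ratMap K (algebraMap K[X] _ p) + ratMap K (-algebraMap K[X] _ q) * yF K = 0 := by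
    rw [map_neg, AlgHom.commutes, AlgHom.commutes]
    rw [map_add, map_smul, map_smul, map_one, conjRing_yX, Algebra.smul_def, Algebra.smul_def] at ha
    linear_combination ha
  obtain ⟨h2, h3⟩ := ratMap_add_eq_zero h1
  have h2 : p = 0 := by simpa using h2
  have h3 : q = 0 := by simpa using h3
  rw [h2, h3, zero_smul, zero_smul, add_zero]

/-- The involution `y ↦ -y` of the function field. -/
def conj (K : Type) [Field K] : XField K →ₐ[K[X]] XField K :=
  IsFractionRing.liftAlgHom conjRing_injective

theorem conj_yF : conj K (yF K) = -yF K :=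
  (IsFractionRing.lift_algebraMap (K := XField K) conjRing_injective (yX K)).trans conjRing_yX

theorem conj_ratMap (a : RatFunc K) : conj K (ratMap K a) = ratMap K a := by
  rw [← RatFunc.num_div_denom a]
  simp only [map_div₀, AlgHom.commutes]

theorem conj_ratMap_add (a b : RatFunc K) :
    conj K (ratMap K a + ratMap K b * yF K) = ratMap K a - ratMap K b * yF K := by
  rw [map_add, map_mul, conj_ratMap, conj_ratMap, conj_yF]; ring

variable [CharZero K]

theorem exists_eq_ratMap_of_conj_eq {g : XField K} (h : conj K g = g) : ∃ a, g = ratMap K a := by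
  obtain ⟨a, b, rfl⟩ := exists_eq_ratMap_add g
  rw [conj_ratMap_add, sub_eq_add_neg, ← neg_mul, ← map_neg] at h
  obtain ⟨-, h2⟩ := ratMap_add_inj h
  have : b = 0 := by
    have h3 : 2 * b = 0 := by linear_combination -h2
    simpa using h3
  exact ⟨a, by rw [this]; simp⟩

theorem exists_eq_mul_of_conj_eq_neg {g : XField K} (h : conj K g = -g) :
    ∃ b, g = ratMap K b * yF K := by
  obtain ⟨a, b, rfl⟩ := exists_eq_ratMap_add g
  rw [conj_ratMap_add, sub_eq_add_neg, ← neg_mul, ← map_neg, neg_add, ← map_neg, ← neg_mul,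
    ← map_neg] at h
  obtain ⟨h2, -⟩ := ratMap_add_inj h
  have : a = 0 := by
    have h3 : 2 * a = 0 := by linear_combination h2
    simpa using h3
  exact ⟨b, by rw [this]; simp⟩

theorem squarefree_X_sq_sub_one : Squarefree (Polynomial.X ^ 2 - 1 : K[X]) := by
  refine Polynomial.Separable.squarefree ?_
  -- Bézout coefficients with the derivative: -(X² - 1) + (X/2)·2X = 1.
  refine ⟨-1, Polynomial.C (1 / 2) * Polynomial.X, ?_⟩
  simp only [Polynomial.derivative_sub, Polynomial.derivative_X_pow, Polynomial.derivative_one]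
  have : (Polynomial.C (1 / 2 : K)) * 2 = 1 := by
    rw [← map_ofNat Polynomial.C, ← map_mul]; simp
  simp only [Nat.cast_ofNat, Nat.add_one_sub_one, pow_one, sub_zero, map_ofNat]
  linear_combination Polynomial.X ^ 2 * this

theorem squarefree_X_cubed_sub_X : Squarefree (Polynomial.X ^ 3 - Polynomial.X : K[X]) := by
  refine Polynomial.Separable.squarefree ?_
  -- Bézout coefficients with the derivative: -9X(X³ - X) + (3X² - 2)(3X² - 1) = 2.
  refine ⟨Polynomial.C (1 / 2) * (-9 * Polynomial.X),
    Polynomial.C (1 / 2) * (3 * Polynomial.X ^ 2 - 2), ?_⟩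
  have h2 : (Polynomial.C (1 / 2 : K)) * 2 = 1 := by
    rw [← map_ofNat Polynomial.C, ← map_mul]; simp
  simp only [Polynomial.derivative_sub, Polynomial.derivative_X_pow, Polynomial.derivative_X,
    Nat.cast_ofNat, Nat.add_one_sub_one, map_ofNat]
  linear_combination h2

/-- The coordinate ring is integrally closed in the function field. -/
theorem exists_eq_of_isIntegral {g : XField K} (hg : IsIntegral (XRing K) g) :
    ∃ a, g = algebraMap (XRing K) (XField K) a := by
  have : Module.Finite K[X] (XRing K) := .of_basis
    (WeierstrassCurve.Affine.CoordinateRing.basis (curve K).toAffine)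
  have hg1 : IsIntegral K[X] g := isIntegral_trans g hg
  have hr : ∀ {z : RatFunc K}, IsIntegral K[X] (ratMap K z) → IsIntegral K[X] z := fun h =>
    (isIntegral_algHom_iff (ratMap K) ratMap_injective).1 h
  obtain ⟨a, b, rfl⟩ := exists_eq_ratMap_add g
  have hg2 := hg1.map (conj K)
  rw [conj_ratMap_add] at hg2
  -- The trace of a + by is 2a; it is integral over K[x], hence a polynomial.
  obtain ⟨p, hp⟩ := exists_polynomial_of_isIntegral (hr (z := 2 * a) (by
    have h2 : ratMap K (2 * a) = (ratMap K a + ratMap K b * yF K)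
        + (ratMap K a - ratMap K b * yF K) := by
      rw [two_mul, map_add]; ring
    rw [h2]
    exact hg1.add hg2))
  have ha : a = algebraMap K[X] _ (Polynomial.C (1 / 2) * p) := by
    have h2 : (Polynomial.C (1 / 2 : K)) * 2 = 1 := by
      rw [← map_ofNat Polynomial.C, ← map_mul]; simp
    have h3 := congrArg (algebraMap K[X] (RatFunc K)) h2
    rw [map_mul, map_one, map_ofNat] at h3
    rw [map_mul, ← hp]
    linear_combination -a * h3
  -- Now by is integral, so its square b²(x³ - x) is a polynomial, and b is one because x³ - x is
  -- squarefree.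
  obtain ⟨d, hd⟩ := exists_polynomial_of_isIntegral
    (hr (z := b ^ 2 * (RatFunc.X ^ 3 - RatFunc.X)) (by
      rw [map_mul, ← yF_sq_eq_ratMap, map_pow, ← mul_pow]
      have h3 : IsIntegral K[X] (ratMap K a) := by
        rw [ha, AlgHom.commutes]; exact isIntegral_algebraMap
      have := (hg1.sub h3).pow 2
      rwa [add_sub_cancel_left] at this))
  obtain ⟨q, hq⟩ := exists_polynomial_of_sq_mul (f := Polynomial.X ^ 3 - Polynomial.X) (p := d)
    squarefree_X_cubed_sub_X (by simpa using hd)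
  refine ⟨algebraMap K[X] _ (Polynomial.C (1 / 2) * p) + algebraMap K[X] _ q * yX K, ?_⟩
  rw [ha, hq, AlgHom.commutes, AlgHom.commutes, map_add, map_mul (algebraMap (XRing K) (XField K)),
    ← IsScalarTower.algebraMap_apply, ← IsScalarTower.algebraMap_apply, yF]

/-- For z = a + by the coefficient 2ab of y in z² vanishes. If a = 0 then b²x = k, which has odd
degree on the left; if b = 0 then k(x² - 1) is the square of a polynomial, although it is squarefree
of degree 2. The constant `k` is arbitrary because differential equations determine functions only
up to constants. -/
theorem not_isSquare_mul_X_sq_sub_one {k : K} (hk : k ≠ 0) (z : XField K) :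
    z ^ 2 ≠ algebraMap K _ k * (xF K ^ 2 - 1) := by
  intro h
  obtain ⟨a, b, rfl⟩ := exists_eq_ratMap_add z
  have hk' : algebraMap K (RatFunc K) k ≠ 0 := by simpa using hk
  have h1 : ratMap K (a ^ 2 + b ^ 2 * (RatFunc.X ^ 3 - RatFunc.X)) + ratMap K (2 * a * b) * yF K
      = ratMap K (algebraMap K _ k * (RatFunc.X ^ 2 - 1)) + ratMap K 0 * yF K := by
    simp only [map_add, map_mul, map_pow, map_sub, ratMap_X, ← algebraMap_eq_ratMap, map_one,
      map_zero, map_ofNat]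
    linear_combination h - ratMap K b ^ 2 * yF_sq_eq K
  obtain ⟨h2, h3⟩ := ratMap_add_inj h1
  have hX : (RatFunc.X ^ 2 - 1 : RatFunc K) = algebraMap K[X] _ (Polynomial.X ^ 2 - 1) := by simp
  have hX0 : (RatFunc.X ^ 2 - 1 : RatFunc K) ≠ 0 := by
    rw [hX, Ne, map_eq_zero_iff _ (IsFractionRing.injective K[X] (RatFunc K))]
    exact squarefree_X_sq_sub_one.ne_zero
  rcases mul_eq_zero.1 h3 with h3 | rfl
  · have ha : a = 0 := by simpa using h3
    subst ha
    have h4 : b ^ 2 * RatFunc.X = algebraMap K _ k := by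
      refine mul_right_cancel₀ hX0 ?_
      linear_combination h2
    have hb : b ≠ 0 := by
      rintro rfl
      exact hk' (by rw [← h4]; simp)
    have h5 := congrArg RatFunc.intDegree h4
    rw [RatFunc.intDegree_mul (pow_ne_zero _ hb) RatFunc.X_ne_zero, pow_two,
      RatFunc.intDegree_mul hb hb, RatFunc.intDegree_X, RatFunc.algebraMap_eq_C,
      RatFunc.intDegree_C] at h5
    omega
  · have h4 : (a ^ 2 : RatFunc K) * algebraMap K[X] _ 1
        = algebraMap K[X] _ (Polynomial.C k * (Polynomial.X ^ 2 - 1)) := by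
      rw [map_mul, ← hX, map_one]
      simp only [ne_eq, OfNat.ofNat_ne_zero, not_false_eq_true, zero_pow, zero_mul, add_zero] at h2
      rw [mul_one, h2, IsScalarTower.algebraMap_apply K K[X] (RatFunc K)]; rfl
    obtain ⟨p, rfl⟩ := exists_polynomial_of_sq_mul squarefree_one h4
    rw [map_one, mul_one, ← map_pow] at h4
    have h5 := IsFractionRing.injective K[X] (RatFunc K) h4
    have hu : IsUnit p := squarefree_X_sq_sub_one p (by
      rw [← pow_two, h5]
      exact ((Polynomial.isUnit_C.2 hk.isUnit).dvd_mul_left.1 dvd_rfl : _))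
    have h6 := congrArg Polynomial.natDegree h5
    rw [Polynomial.natDegree_pow, Polynomial.natDegree_eq_zero_of_isUnit hu,
      Polynomial.natDegree_C_mul hk] at h6
    have : (Polynomial.X ^ 2 - 1 : K[X]).natDegree = 2 := by
      simpa using Polynomial.natDegree_X_pow_sub_C (n := 2) (r := (1 : K))
    omega

end FunctionField

/-! ### Rational functions `u` such that `u³ - u` is a square up to `x³ - x` -/

section RationalFunctions

open Polynomial

variable {K : Type} [Field K]

theorem natDegree_eq_zero_of_derivative_sq_eq_zero [CharZero K] {p : K[X]}
    (h : derivative (p ^ 2) = 0) : p.natDegree = 0 := by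
  have h1 := derivative_eq_zero.1 h
  rw [natDegree_pow] at h1
  omega

/-- Coprime polynomials `p`, `q` such that `p q (p² - q²)` is a square are constant. -/
theorem natDegree_eq_zero_of_isCoprime_of_sq [CharZero K] {p q m : K[X]} (hpq : IsCoprime p q)
    (hp : p ≠ 0) (hq : q ≠ 0) (hs : p ^ 2 - q ^ 2 ≠ 0) (h : p * q * (p ^ 2 - q ^ 2) = m ^ 2) :
    p.natDegree = 0 ∧ q.natDegree = 0 := by
  classical
  have hm : m ≠ 0 := by
    rintro rfl
    rw [zero_pow two_ne_zero] at h
    exact mul_ne_zero (mul_ne_zero hp hq) hs h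
  have hs' : -(p ^ 2 - q ^ 2) ≠ 0 := neg_ne_zero.2 hs
  have hq' : -q ^ 2 ≠ 0 := neg_ne_zero.2 (pow_ne_zero _ hq)
  -- Mason–Stothers for p² - q² - (p² - q²) = 0.
  rcases Polynomial.abc (a := p ^ 2) (b := -q ^ 2) (c := -(p ^ 2 - q ^ 2)) (pow_ne_zero _ hp) hq'
    hs' (hpq.pow (m := 2) (n := 2)).neg_right (by ring) with ⟨h1, h2, h3⟩ | ⟨h1, h2, -⟩
  · exfalso
    -- The product of the three terms divides m⁴, so its radical divides m. Thus 2 deg p, 2 deg q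
    -- and deg(p² - q²) are all less than deg m, against deg p + deg q + deg(p² - q²) = 2 deg m.
    have hr : (UniqueFactorizationMonoid.radical (p ^ 2 * -q ^ 2 * -(p ^ 2 - q ^ 2))).natDegree
        ≤ m.natDegree := by
      refine natDegree_le_of_dvd ?_ hm
      have h4 : p ^ 2 * -q ^ 2 * -(p ^ 2 - q ^ 2) ∣ m ^ 4 :=
        ⟨p ^ 2 - q ^ 2, by rw [show m ^ 4 = (m ^ 2) ^ 2 by ring, ← h]; ring⟩
      refine (UniqueFactorizationMonoid.radical_dvd_radical h4 (pow_ne_zero _ hm)).trans ?_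
      exact UniqueFactorizationMonoid.radical_pow_dvd.trans
        UniqueFactorizationMonoid.radical_dvd_self
    have h4 := congrArg natDegree h
    rw [natDegree_mul (mul_ne_zero hp hq) hs, natDegree_mul hp hq, natDegree_pow] at h4
    rw [natDegree_pow] at h1
    rw [natDegree_neg, natDegree_pow] at h2
    rw [natDegree_neg] at h3
    omega
  · rw [derivative_neg, neg_eq_zero] at h2
    exact ⟨natDegree_eq_zero_of_derivative_sq_eq_zero h1,
      natDegree_eq_zero_of_derivative_sq_eq_zero h2⟩

/-- The curve `b² = a³ - a` has no nonconstant points over `K(x)`. -/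
theorem RatFunc.exists_eq_of_sq_eq [CharZero K] {a b : RatFunc K} (h : b ^ 2 = a ^ 3 - a) :
    ∃ k, a = algebraMap K _ k := by
  have hinj := IsFractionRing.injective K[X] (RatFunc K)
  have ha := RatFunc.num_div_denom a
  have hd0 := RatFunc.denom_ne_zero a
  have hd : algebraMap K[X] (RatFunc K) a.denom ≠ 0 := by simpa using hd0
  -- In the degenerate case a is 0, 1 or -1, the abscissa of a two-torsion point. Otherwise
  -- multiplying b by the square of the denominator makes pq(p² - q²) a square of a polynomial.
  by_cases hs : a.num * a.denom * (a.num ^ 2 - a.denom ^ 2) = 0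
  · have h0 : a * (a - 1) * (a + 1) = 0 := by
      have := congrArg (algebraMap K[X] (RatFunc K)) hs
      rw [← ha]
      field_simp
      simp only [map_mul, map_sub, map_pow, map_zero] at this
      rcases mul_eq_zero.1 this with h | h
      · simp only [mul_eq_zero, hd, or_false] at h
        simp [h]
      · linear_combination (algebraMap K[X] (RatFunc K)) a.num * h
    rcases mul_eq_zero.1 h0 with h | h
    · rcases mul_eq_zero.1 h with h | h
      · exact ⟨0, by simp [h]⟩
      · exact ⟨1, by rw [map_one]; linear_combination h⟩
    · exact ⟨-1, by rw [map_neg, map_one]; linear_combination h⟩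
  · have h1 : (b * algebraMap K[X] _ a.denom ^ 2) ^ 2 * algebraMap K[X] (RatFunc K) 1
        = algebraMap K[X] _ (a.num * a.denom * (a.num ^ 2 - a.denom ^ 2)) := by
      have h2 : a * algebraMap K[X] _ a.denom = algebraMap K[X] _ a.num := by
        nth_rewrite 1 [← ha]; field_simp
      simp only [map_mul, map_sub, map_pow, map_one, ← h2]
      linear_combination algebraMap K[X] (RatFunc K) a.denom ^ 4 * h
    obtain ⟨m, hm⟩ := exists_polynomial_of_sq_mul squarefree_one h1
    rw [hm, map_one, mul_one, ← map_pow] at h1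
    simp only [mul_eq_zero, not_or] at hs
    obtain ⟨h2, h3⟩ := natDegree_eq_zero_of_isCoprime_of_sq (RatFunc.isCoprime_num_denom a)
      hs.1.1 hs.1.2 hs.2 (hinj h1).symm
    obtain ⟨c, hc⟩ : ∃ c, c = a.num.coeff 0 := ⟨_, rfl⟩
    obtain ⟨d, hd⟩ : ∃ d, d = a.denom.coeff 0 := ⟨_, rfl⟩
    rw [eq_C_of_natDegree_eq_zero h2, eq_C_of_natDegree_eq_zero h3, ← hc, ← hd] at ha
    refine ⟨c / d, ?_⟩
    rw [← ha, map_div₀, IsScalarTower.algebraMap_apply K K[X] (RatFunc K),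
      IsScalarTower.algebraMap_apply K K[X] (RatFunc K)]
    rfl

theorem eq_leadingCoeff_mul_sq_of_associated {P d : K[X]} (hP : P.natDegree = 2)
    (h : Associated (d ^ 2) P) : ∃ n, P = C P.leadingCoeff * (X - C n) ^ 2 := by
  obtain ⟨u, hu⟩ := h
  obtain ⟨c, hc, hcu⟩ := isUnit_iff.1 u.isUnit
  have hc0 : c ≠ 0 := hc.ne_zero
  rw [← hcu] at hu
  have hd : d.natDegree = 1 := by
    have := congrArg natDegree hu
    rw [natDegree_mul_C hc0, natDegree_pow, hP] at this
    omega
  obtain ⟨a, ha, b, rfl⟩ := natDegree_eq_one.1 hd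
  have h1 : P = C (a ^ 2 * c) * (X - C (-b / a)) ^ 2 := by
    have h2 : C a * (X - C (-b / a)) = C a * X + C b := by
      rw [mul_sub, ← C_mul, mul_div_cancel₀ _ ha, C_neg]; ring
    rw [← hu, ← h2]; simp only [C_mul, C_pow]; ring
  refine ⟨-b / a, ?_⟩
  have h3 : P.leadingCoeff = a ^ 2 * c := by
    rw [h1, leadingCoeff_mul, leadingCoeff_C, leadingCoeff_pow, leadingCoeff_X_sub_C, one_pow,
      mul_one]
  rw [h3]; exact h1

theorem associated_sq_of_mul_eq {P Q m : K[X]} {c : K} (hc : c ≠ 0) (hPQ : IsCoprime P Q)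
    (h : C c * (P * Q) = m ^ 2) : ∃ d, Associated (d ^ 2) P := by
  refine exists_associated_pow_of_mul_eq_pow' (b := C c * Q) (c := m) ?_ (by rw [← h]; ring)
  exact ((isCoprime_mul_unit_left_right (isUnit_C.2 hc.isUnit) P Q).2 hPQ)

/-- `r₁` and `r₂` cannot be roots of distinct factors. -/
theorem not_dvd_of_mul_eq {P₁ P₂ P₃ m : K[X]} {r₁ r₂ c : K} (hc : c ≠ 0)
    (h12 : IsCoprime P₁ P₂) (h13 : IsCoprime P₁ P₃) (hP₁ : P₁.natDegree = 2)
    (h : C c * (P₁ * P₂ * P₃) = (X - C r₁) * (X - C r₂) * m ^ 2) (h1 : X - C r₁ ∣ P₁)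
    (h2 : X - C r₂ ∣ P₂) : False := by
  obtain ⟨l₁, rfl⟩ := h1
  obtain ⟨l₂, rfl⟩ := h2
  have h3 : C c * (l₁ * (l₂ * P₃)) = m ^ 2 := by
    refine mul_left_cancel₀ (mul_ne_zero (X_sub_C_ne_zero r₁) (X_sub_C_ne_zero r₂)) ?_
    rw [← h]; ring
  -- With both roots cancelled, `l₁` is coprime to the other factors and hence a square up to a
  -- unit, although its degree is one.
  obtain ⟨d, hd⟩ := associated_sq_of_mul_eq hc
    ((h12.of_mul_left_right.of_mul_right_right).mul_right h13.of_mul_left_right) h3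
  have hl₁ : l₁ ≠ 0 := by rintro rfl; simp at hP₁
  rw [natDegree_mul (X_sub_C_ne_zero _) hl₁, natDegree_X_sub_C] at hP₁
  have h4 := natDegree_eq_of_degree_eq (degree_eq_degree_of_associated hd)
  rw [natDegree_pow] at h4
  omega

/-- If `r₁`, `r₂` are roots of the same factor, then the other factors are squares. -/
theorem eq_of_mul_eq_of_dvd {P₁ P₂ P₃ m : K[X]} {r₁ r₂ c : K} (hc : c ≠ 0) (hr : r₁ ≠ r₂)
    (h23 : IsCoprime P₂ P₃) (hP₁ : P₁.natDegree = 2) (hP₂ : P₂.natDegree = 2)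
    (hP₃ : P₃.natDegree = 2) (h : C c * (P₁ * P₂ * P₃) = (X - C r₁) * (X - C r₂) * m ^ 2)
    (h1 : X - C r₁ ∣ P₁) (h2 : X - C r₂ ∣ P₁) :
    P₁ = C P₁.leadingCoeff * ((X - C r₁) * (X - C r₂)) ∧
    (∃ n, P₂ = C P₂.leadingCoeff * (X - C n) ^ 2) ∧ ∃ n, P₃ = C P₃.leadingCoeff * (X - C n) ^ 2 := by
  obtain ⟨l, hl⟩ := (isCoprime_X_sub_C_of_isUnit_sub (sub_ne_zero.2 hr).isUnit).mul_dvd h1 h2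
  have hl0 : l ≠ 0 := by rintro rfl; rw [hl] at hP₁; simp at hP₁
  have hl1 : l.natDegree = 0 := by
    rw [hl, natDegree_mul (mul_ne_zero (X_sub_C_ne_zero _) (X_sub_C_ne_zero _)) hl0,
      natDegree_mul (X_sub_C_ne_zero _) (X_sub_C_ne_zero _), natDegree_X_sub_C,
      natDegree_X_sub_C] at hP₁
    omega
  rw [eq_C_of_natDegree_eq_zero hl1] at hl
  set k := l.coeff 0
  have hk : k ≠ 0 := by
    intro hk; rw [hk] at hl; rw [hl] at hP₁; simp at hP₁
  have h3 : C (c * k) * (P₂ * P₃) = m ^ 2 := by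
    refine mul_left_cancel₀ (mul_ne_zero (X_sub_C_ne_zero r₁) (X_sub_C_ne_zero r₂)) ?_
    rw [← h, hl, C_mul]; ring
  refine ⟨?_, ?_, ?_⟩
  · rw [hl, leadingCoeff_mul, leadingCoeff_mul, leadingCoeff_X_sub_C, leadingCoeff_X_sub_C,
      leadingCoeff_C]; ring_nf
  · obtain ⟨d, hd⟩ := associated_sq_of_mul_eq (mul_ne_zero hc hk) h23 h3
    exact eq_leadingCoeff_mul_sq_of_associated hP₂ hd
  · rw [mul_comm P₂] at h3
    obtain ⟨d, hd⟩ := associated_sq_of_mul_eq (mul_ne_zero hc hk) h23.symm h3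
    exact eq_leadingCoeff_mul_sq_of_associated hP₃ hd

/-- The numerical constraints on a pencil of quadratic polynomials with two squares. -/
theorem pencil_constraints [CharZero K] {α c r r₁ r₂ e e' e'' m n : K} (hα : α ≠ 0) (hc : c ≠ 0)
    (hr : r₁ + r₂ = -r) (hr' : r₁ * r₂ = r ^ 2 - 1) (hr3 : r ^ 3 = r)
    (he : e' + e'' = -e) (he' : e' * e'' = e ^ 2 - 1) (he3 : e ^ 3 = e) (hne : e' ≠ e'')
    (h1 : C α * (X - C m) ^ 2 = C α * ((X - C r₁) * (X - C r₂)) + C (e - e') * (C c * (X - C r)))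
    (h2 : C α * (X - C n) ^ 2 = C α * ((X - C r₁) * (X - C r₂)) + C (e - e'') * (C c * (X - C r))) :
    e = 0 ∧ r = 0 ∧ (c / α) ^ 2 = -4 := by
  have a0 := congrArg (eval 0) h1
  have a1 := congrArg (eval 1) h1
  have b0 := congrArg (eval 0) h2
  have b1 := congrArg (eval 1) h2
  simp only [eval_mul, eval_C, eval_pow, eval_sub, eval_X, eval_add] at a0 a1 b0 b1
  have am : -2 * α * m = α * r + (e - e') * c := by linear_combination a1 - a0 - α * hr
  have bm : -2 * α * n = α * r + (e - e'') * c := by linear_combination b1 - b0 - α * hr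
  -- The quadratic on the right of `h1` has a double root, so its discriminant vanishes; `bq` is the
  -- same for `h2`.
  have aq : (α * r + (e - e') * c) ^ 2 = 4 * α * (α * (r ^ 2 - 1) - (e - e') * c * r) := by
    rw [← am, ← hr']; linear_combination 4 * α * a0
  have bq : (α * r + (e - e'') * c) ^ 2 = 4 * α * (α * (r ^ 2 - 1) - (e - e'') * c * r) := by
    rw [← bm, ← hr']; linear_combination 4 * α * b0
  -- The difference of the two discriminants is divisible by (e'' - e')c; this is the quotient, up
  -- to the factor 3.
  have s1 : e * c = -2 * α * r := by
    have hne' : (e'' - e') * c * 3 ≠ 0 :=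
      mul_ne_zero (mul_ne_zero (sub_ne_zero.2 hne.symm) hc) (by norm_num)
    refine mul_left_cancel₀ hne' ?_
    have he'2 : e'' = -e - e' := by linear_combination he
    subst he'2
    linear_combination aq - bq
  have s2 : (3 * e ^ 2 - 1) * c ^ 2 = α ^ 2 * (4 - 3 * r ^ 2) := by
    have he'2 : e'' = -e - e' := by linear_combination he
    subst he'2
    linear_combination -c ^ 2 * he' + 3 * (e - e') * c * s1 - aq
  have s3 : c ^ 2 = α ^ 2 * (15 * r ^ 2 - 4) := by
    linear_combination 3 * (e * c - 2 * α * r) * s1 - s2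
  -- If e ≠ 0 then e² = 1, and c² = 4α²r² by `s1`. With `s3` this gives 11r² = 4, impossible for r²
  -- equal to 0 or 1.
  have e0 : e = 0 := by
    by_contra h0
    have he2 : e ^ 2 = 1 := by
      refine mul_left_cancel₀ h0 ?_
      linear_combination he3
    have h4 : 4 * r ^ 2 = 15 * r ^ 2 - 4 := by
      refine mul_left_cancel₀ (pow_ne_zero 2 hα) ?_
      rw [← s3]
      linear_combination c ^ 2 * he2 - (e * c - 2 * α * r) * s1
    by_cases hr0 : r = 0
    · rw [hr0] at h4; norm_num at h4
    · have hr2 : r ^ 2 = 1 := by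
        refine mul_left_cancel₀ hr0 ?_
        linear_combination hr3
      rw [hr2] at h4; norm_num at h4
  have r0 : r = 0 := by
    rw [e0, zero_mul] at s1
    have : -2 * α ≠ 0 := mul_ne_zero (by norm_num) hα
    exact (mul_eq_zero.1 s1.symm).resolve_left this
  refine ⟨e0, r0, ?_⟩
  rw [div_pow, s3, r0]
  field_simp
  ring

/-- The members p, p - q, p + q of the pencil are pairwise coprime quadratics whose product is (X -
r₁)(X - r₂) times a square, up to a constant. A member containing exactly one of r₁, r₂ would have a
linear cofactor that is a square, so one member contains both and the other two are squares;
`pencil_constraints` then fixes the parameters. -/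
theorem pencil_eq [CharZero K] {p q m : K[X]} {r r₁ r₂ c : K} (hc : c ≠ 0) (hr12 : r₁ ≠ r₂)
    (hr : r₁ + r₂ = -r) (hr' : r₁ * r₂ = r ^ 2 - 1) (hr3 : r ^ 3 = r) (hq : q = C c * (X - C r))
    (hpq : IsCoprime p q) (hp : p.natDegree = 2)
    (h : C c * (p * (p - q) * (p + q)) = (X - C r₁) * (X - C r₂) * m ^ 2) :
    ∃ α, α ≠ 0 ∧ (c / α) ^ 2 = -4 ∧ p = C α * (X ^ 2 - 1) ∧ q = C c * X := by
  have hq1 : q.natDegree < p.natDegree := by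
    rw [hq, natDegree_C_mul hc, natDegree_X_sub_C, hp]; norm_num
  have hp0 : p ≠ 0 := by rintro rfl; simp at hp
  have hα : p.leadingCoeff ≠ 0 := leadingCoeff_ne_zero.2 hp0
  have hqd := degree_lt_degree hq1
  have d1 : (p - q).natDegree = 2 := by rw [natDegree_sub_eq_left_of_natDegree_lt hq1, hp]
  have d2 : (p + q).natDegree = 2 := by rw [natDegree_add_eq_left_of_natDegree_lt hq1, hp]
  have l1 : (p - q).leadingCoeff = p.leadingCoeff := leadingCoeff_sub_of_degree_lt hqd
  have l2 : (p + q).leadingCoeff = p.leadingCoeff := leadingCoeff_add_of_degree_lt' hqd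
  have c1 : IsCoprime p (p - q) := by
    have := (hpq.neg_right.add_mul_left_right 1)
    rwa [mul_one, neg_add_eq_sub] at this
  have c2 : IsCoprime p (p + q) := by
    have := (hpq.add_mul_left_right 1)
    rwa [mul_one, add_comm] at this
  have c3 : IsCoprime (p - q) (p + q) := by
    have h1 : IsCoprime (p - q) q := by
      have := (hpq.symm.add_mul_left_right (-1))
      rw [mul_neg_one, ← sub_eq_add_neg] at this
      exact this.symm
    have h2 : IsCoprime (p - q) (2 * q) := by
      refine (isCoprime_mul_unit_left_right ?_ _ _).2 h1
      rw [← map_ofNat C]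
      exact isUnit_C.2 (by norm_num)
    have := h2.add_mul_left_right 1
    rwa [mul_one, show 2 * q + (p - q) = p + q by ring] at this
  set α := p.leadingCoeff with hαdef
  have hdvd : ∀ z ∈ ({r₁, r₂} : Set K), X - C z ∣ p ∨ X - C z ∣ p - q ∨ X - C z ∣ p + q := by
    intro z hz
    have hz' : X - C z ∣ p * (p - q) * (p + q) := by
      have : X - C z ∣ C c * (p * (p - q) * (p + q)) := by
        rw [h]
        rcases hz with rfl | rfl
        · exact (dvd_mul_right _ _).mul_right _
        · exact (dvd_mul_left _ _).mul_right _
      exact (isUnit_C.2 hc.isUnit).dvd_mul_left.1 this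
    rcases (prime_X_sub_C z).dvd_or_dvd hz' with h1 | h1
    · rcases (prime_X_sub_C z).dvd_or_dvd h1 with h2 | h2
      · exact .inl h2
      · exact .inr (.inl h2)
    · exact .inr (.inr h1)
  have perm : ∀ {P₁ P₂ P₃ : K[X]}, P₁ * P₂ * P₃ = p * (p - q) * (p + q) →
      C c * (P₁ * P₂ * P₃) = (X - C r₁) * (X - C r₂) * m ^ 2 := fun h' => by rw [h', h]
  -- Here p - eq is the member with roots r₁, r₂, and e', e'' index the other two: {e, e', e''} =
  -- {0, 1, -1}, encoded by symmetric functions.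
  have fin : ∀ {e e' e'' : K} , e' + e'' = -e → e' * e'' = e ^ 2 - 1 → e ^ 3 = e → e' ≠ e'' →
      (p - C e * q = C α * ((X - C r₁) * (X - C r₂)) ∧ (∃ n, p - C e' * q = C α * (X - C n) ^ 2) ∧
        ∃ n, p - C e'' * q = C α * (X - C n) ^ 2) →
      ∃ α, α ≠ 0 ∧ (c / α) ^ 2 = -4 ∧ p = C α * (X ^ 2 - 1) ∧ q = C c * X := by
    rintro e e' e'' he he' he3 hne ⟨k1, ⟨m, k2⟩, ⟨n, k3⟩⟩
    obtain ⟨rfl, rfl, h4⟩ := pencil_constraints hα hc hr hr' hr3 he he' he3 hne (m := m) (n := n)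
      (by rw [← k1, ← k2, ← hq, C_sub]; ring) (by rw [← k1, ← k3, ← hq, C_sub]; ring)
    refine ⟨α, hα, h4, ?_, by rw [hq, C_0, sub_zero]⟩
    have h5 : C r₁ + C r₂ = (0 : K[X]) := by rw [← C_add, hr, neg_zero, C_0]
    have h6 : C r₁ * C r₂ = (-1 : K[X]) := by rw [← C_mul, hr']; simp
    rw [C_0, zero_mul, sub_zero] at k1
    rw [k1]
    linear_combination C α * (h6 - X * h5)
  -- Of the nine placements of r₁ and r₂ only the three in a common member survive.
  rcases hdvd r₁ (by simp) with h1 | h1 | h1 <;> rcases hdvd r₂ (by simp) with h2 | h2 | h2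
  · obtain ⟨k1, k2, k3⟩ := eq_of_mul_eq_of_dvd hc hr12 c3 hp d1 d2 h h1 h2
    rw [l1] at k2
    rw [l2] at k3
    exact fin (e := 0) (e' := 1) (e'' := -1) (by ring) (by ring) (by ring) (by norm_num)
      ⟨by simpa using k1, by simpa using k2, by simpa using k3⟩
  · exact (not_dvd_of_mul_eq hc c1 c2 hp h h1 h2).elim
  · exact (not_dvd_of_mul_eq hc c2 c1 hp (perm (by ring)) h1 h2).elim
  · exact (not_dvd_of_mul_eq hc c1.symm c3 d1 (perm (by ring)) h1 h2).elim
  · obtain ⟨k1, k2, k3⟩ := eq_of_mul_eq_of_dvd hc hr12 c2 d1 hp d2 (perm (by ring)) h1 h2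
    rw [l1] at k1
    rw [l2] at k3
    exact fin (e := 1) (e' := 0) (e'' := -1) (by ring) (by ring) (by ring) (by norm_num)
      ⟨by simpa using k1, by simpa using k2, by simpa using k3⟩
  · exact (not_dvd_of_mul_eq hc c3 c1.symm d1 (perm (by ring)) h1 h2).elim
  · exact (not_dvd_of_mul_eq hc c2.symm c3.symm d2 (perm (by ring)) h1 h2).elim
  · exact (not_dvd_of_mul_eq hc c3.symm c2.symm d2 (perm (by ring)) h1 h2).elim
  · obtain ⟨k1, k2, k3⟩ := eq_of_mul_eq_of_dvd hc hr12 c1 d2 hp d1 (perm (by ring)) h1 h2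
    rw [l2] at k1
    rw [l1] at k3
    exact fin (e := -1) (e' := 0) (e'' := 1) (by ring) (by ring) (by ring) (by norm_num)
      ⟨by simpa using k1, by simpa using k2, by simpa using k3⟩

/-- The root r of q is a root of x³ - x. Otherwise r would be a root of m, hence a multiple root of
the right side, while it is simple on the left because p, p - q and p + q do not vanish there.
Dividing by X - r leaves the situation of `pencil_eq`, with r₁, r₂ the other two roots of x³ - x. -/
theorem exists_root_of_mul_eq [CharZero K] {p q m : K[X]} (hpq : IsCoprime p q)
    (hp : p.natDegree = 2) (hq : q.natDegree = 1)
    (h : p * q * (p ^ 2 - q ^ 2) = (X ^ 3 - X) * m ^ 2) :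
    ∃ α c, α ≠ 0 ∧ c ≠ 0 ∧ (c / α) ^ 2 = -4 ∧ p = C α * (X ^ 2 - 1) ∧ q = C c * X := by
  obtain ⟨c, hc, b, hq'⟩ := natDegree_eq_one.1 hq
  obtain ⟨r, hr⟩ : ∃ r, r = -b / c := ⟨_, rfl⟩
  have hqr : q = C c * (X - C r) := by
    rw [← hq', hr, mul_sub, ← C_mul, mul_div_cancel₀ _ hc, C_neg]; ring
  have hdq : X - C r ∣ q := ⟨C c, by rw [hqr]; ring⟩
  have hpr : eval r p ≠ 0 := by
    intro h0
    exact (prime_X_sub_C r).not_isUnit (hpq.isUnit_of_dvd' (dvd_iff_isRoot.2 h0) hdq)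
  have hq0 : eval r q = 0 := by rw [hqr]; simp
  have hr3 : r ^ 3 - r = 0 := by
    by_contra h0
    have h1 : X - C r ∣ m := by
      refine dvd_iff_isRoot.2 ?_
      have := congrArg (eval r) h
      simp only [eval_mul, hq0, mul_zero, zero_mul, eval_sub, eval_pow, eval_X] at this
      have := (mul_eq_zero.1 this.symm).resolve_left h0
      exact (pow_eq_zero_iff two_ne_zero).1 this
    obtain ⟨m', rfl⟩ := h1
    have h2 : C c * (p * (p ^ 2 - q ^ 2)) = (X - C r) * ((X ^ 3 - X) * m' ^ 2) := by
      refine mul_left_cancel₀ (X_sub_C_ne_zero r) ?_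
      rw [hqr] at h ⊢
      linear_combination h
    have h3 := congrArg (eval r) h2
    simp only [eval_mul, hq0, eval_sub, eval_pow, eval_X, eval_C, sub_self, zero_mul] at h3
    refine mul_ne_zero hc (mul_ne_zero hpr (pow_ne_zero 2 hpr)) ?_
    linear_combination h3
  have key : ∀ {r₁ r₂ : K}, r₁ ≠ r₂ → r₁ + r₂ = -r → r₁ * r₂ = r ^ 2 - 1 →
      ∃ α c, α ≠ 0 ∧ c ≠ 0 ∧ (c / α) ^ 2 = -4 ∧ p = C α * (X ^ 2 - 1) ∧ q = C c * X := by
    intro r₁ r₂ h1 h2 h3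
    obtain ⟨α, k1, k2, k3, k4⟩ := pencil_eq (m := m) hc h1 h2 h3 (sub_eq_zero.1 hr3) hqr hpq hp (by
      refine mul_left_cancel₀ (X_sub_C_ne_zero r) ?_
      have h4 : C r₁ + C r₂ = -C r := by rw [← C_add, h2, C_neg]
      have h5 : C r₁ * C r₂ = C r ^ 2 - 1 := by rw [← C_mul, h3]; simp
      have h6 : C r ^ 3 - C r = 0 := by rw [← C_pow, ← C_sub, hr3, C_0]
      have h7 : (X - C r) * ((X - C r₁) * (X - C r₂)) = X ^ 3 - X := by
        linear_combination (X - C r) * h5 - (X - C r) * X * h4 - h6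
      have h8 : (X - C r) * ((X - C r₁) * (X - C r₂) * m ^ 2) = p * q * (p ^ 2 - q ^ 2) := by
        rw [h, ← h7]; ring
      rw [h8]
      nth_rewrite 3 [hqr]
      ring)
    exact ⟨α, c, k1, hc, k2, k3, k4⟩
  have hr4 : r * ((r - 1) * (r + 1)) = 0 := by linear_combination hr3
  rcases mul_eq_zero.1 hr4 with h0 | h0
  · exact key (r₁ := 1) (r₂ := -1) (by norm_num) (by rw [h0]; ring) (by rw [h0]; ring)
  rcases mul_eq_zero.1 h0 with h0 | h0
  · rw [sub_eq_zero] at h0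
    exact key (r₁ := 0) (r₂ := -1) (by norm_num) (by rw [h0]; ring) (by rw [h0]; ring)
  · rw [← eq_neg_iff_add_eq_zero] at h0
    exact key (r₁ := 0) (r₂ := 1) (by norm_num) (by rw [h0]; ring) (by rw [h0]; ring)

end RationalFunctions

/-! ### Self-isogenies of degree two -/

section Isogeny

variable {K : Type} [Field K]

theorem algebraMap_norm (b : XRing K) : algebraMap K[X] (XField K) (Algebra.norm K[X] b) =
    algebraMap (XRing K) (XField K) b * conj K (algebraMap (XRing K) (XField K) b) := by
  obtain ⟨p, q, rfl⟩ := WeierstrassCurve.Affine.CoordinateRing.exists_smul_basis_eq b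
  rw [WeierstrassCurve.Affine.CoordinateRing.norm_smul_basis]
  change _ = algebraMap (XRing K) (XField K) (p • 1 + q • yX K) * conj K (algebraMap (XRing K) (XField K) (p • 1 + q • yX K))
  have h : algebraMap (XRing K) (XField K) (p • 1 + q • yX K)
      = algebraMap K[X] (XField K) p + algebraMap K[X] (XField K) q * yF K := by
    simp only [Algebra.smul_def, map_add, map_mul, mul_one, ← IsScalarTower.algebraMap_apply, yF]
  have hX : algebraMap K[X] (XField K) Polynomial.X = xF K := by
    rw [algebraMap_polynomial_XField, Polynomial.aeval_X]
  rw [h, map_add, map_mul, AlgHom.commutes, AlgHom.commutes, conj_yF]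
  simp only [curve, map_zero, map_neg, map_one, zero_mul, add_zero, mul_zero, sub_zero, map_sub,
    map_mul, map_pow, map_add, hX]
  linear_combination algebraMap K[X] (XField K) q ^ 2 * yF_sq_eq K

/-- The product of g = a/b with its conjugate is N(a)/N(b) in K(x), so its degree is the difference
of the two degrees compared in the definition of the pole. -/
theorem HasPoleAtOrigin.intDegree_pos {α β : RatFunc K}
    (h : HasPoleAtOrigin (ratMap K α + ratMap K β * yF K)) :
    0 < (α ^ 2 - β ^ 2 * (RatFunc.X ^ 3 - RatFunc.X)).intDegree := by
  obtain ⟨a, b, hb, hab, hd⟩ := h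
  set n := α ^ 2 - β ^ 2 * (RatFunc.X ^ 3 - RatFunc.X) with hn
  have h1 := congrArg (conj K) hab
  rw [map_mul, conj_ratMap_add] at h1
  have h2 : ratMap K (n * algebraMap K[X] _ (Algebra.norm K[X] b))
      = ratMap K (algebraMap K[X] _ (Algebra.norm K[X] a)) := by
    rw [map_mul, AlgHom.commutes, AlgHom.commutes, algebraMap_norm, algebraMap_norm, ← hab, map_mul,
      conj_ratMap_add, hn, map_sub, map_mul, ← yF_sq_eq_ratMap, map_pow, map_pow]
    ring
  have h3 := ratMap_injective h2
  have ha : algebraMap K[X] (RatFunc K) (Algebra.norm K[X] a) ≠ 0 := by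
    rw [Ne, map_eq_zero_iff _ (IsFractionRing.injective K[X] (RatFunc K))]
    intro h0
    rw [h0] at hd
    simp at hd
  have hn0 : n ≠ 0 := by
    rintro h0
    rw [h0, zero_mul] at h3
    exact ha h3.symm
  have hb0 : algebraMap K[X] (RatFunc K) (Algebra.norm K[X] b) ≠ 0 := by
    intro h0
    rw [h0, mul_zero] at h3
    exact ha h3.symm
  have h4 := congrArg RatFunc.intDegree h3
  rw [RatFunc.intDegree_mul hn0 hb0, RatFunc.intDegree_polynomial, RatFunc.intDegree_polynomial]
    at h4
  omega

variable [CharZero K]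

/-- The two terms of the norm have degrees of different parity, since x³ - x has degree 3, so their
leading terms cannot cancel. -/
theorem inftyValuation_sq_le [DecidableEq (RatFunc K)] (α β : RatFunc K) :
    RatFunc.inftyValuation K α ^ 2 ≤
      RatFunc.inftyValuation K (α ^ 2 - β ^ 2 * (RatFunc.X ^ 3 - RatFunc.X)) := by
  rcases eq_or_ne β 0 with rfl | hβ
  · simp
  rcases eq_or_ne α 0 with rfl | hα
  · simp
  have hX : (RatFunc.X ^ 3 - RatFunc.X : RatFunc K)
      = algebraMap K[X] _ (Polynomial.X ^ 3 - Polynomial.X) := by simp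
  have hd : (Polynomial.X ^ 3 - Polynomial.X : K[X]).natDegree = 3 := by compute_degree!
  have hX0 : (RatFunc.X ^ 3 - RatFunc.X : RatFunc K) ≠ 0 := by
    rw [hX, Ne, map_eq_zero_iff _ (IsFractionRing.injective K[X] (RatFunc K))]
    exact squarefree_X_cubed_sub_X.ne_zero
  have hXd : (RatFunc.X ^ 3 - RatFunc.X : RatFunc K).intDegree = 3 := by
    rw [hX, RatFunc.intDegree_polynomial, hd]; rfl
  have h2 : RatFunc.inftyValuation K (α ^ 2)
      ≠ RatFunc.inftyValuation K (β ^ 2 * (RatFunc.X ^ 3 - RatFunc.X)) := by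
    rw [RatFunc.inftyValuation_apply, RatFunc.inftyValuation_apply,
      RatFunc.inftyValuation_of_nonzero K (pow_ne_zero 2 hα),
      RatFunc.inftyValuation_of_nonzero K (mul_ne_zero (pow_ne_zero 2 hβ) hX0),
      Ne, WithZero.exp_inj, RatFunc.intDegree_mul (pow_ne_zero 2 hβ) hX0, pow_two, pow_two,
      RatFunc.intDegree_mul hα hα, RatFunc.intDegree_mul hβ hβ, hXd]
    omega
  rw [sub_eq_add_neg, Valuation.map_add_of_distinct_val _ (by rwa [Valuation.map_neg]), map_pow]
  exact le_max_left _ _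

/-- Both points over a point of the base line cannot lie on a line through a constant point. -/
theorem add_one_sq_ne {α β : RatFunc K} (k : K)
    (h : 0 < (α ^ 2 - β ^ 2 * (RatFunc.X ^ 3 - RatFunc.X)).intDegree) :
    ((α ^ 2 - β ^ 2 * (RatFunc.X ^ 3 - RatFunc.X)) + algebraMap K _ k * (2 * α) + 1) ^ 2 ≠
      4 * algebraMap K _ k * (α ^ 2 - β ^ 2 * (RatFunc.X ^ 3 - RatFunc.X)) *
        (2 * α + algebraMap K _ k) := by
  classical
  have hα := inftyValuation_sq_le α β
  set n := α ^ 2 - β ^ 2 * (RatFunc.X ^ 3 - RatFunc.X)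
  set w := RatFunc.inftyValuation K
  have hn0 : n ≠ 0 := by rintro h0; rw [h0] at h; simp at h
  have hn : 1 < w n := by
    rw [RatFunc.inftyValuation_apply, RatFunc.inftyValuation_of_nonzero K hn0, ← WithZero.exp_zero,
      WithZero.exp_lt_exp]
    exact h
  have hc : ∀ k : K, w (algebraMap K _ k) ≤ 1 := fun k => by
    rcases eq_or_ne k 0 with rfl | hk
    · simp
    · rw [RatFunc.algebraMap_eq_C, RatFunc.inftyValuation.C K hk]
  have hαn : w α < w n := by
    by_contra! h1
    have := pow_le_pow_left' h1 2
    have h2 := this.trans hα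
    rw [pow_two] at h2
    have h3 : w n * 1 < w n * w n := mul_lt_mul_of_pos_left hn (zero_lt_one.trans hn)
    rw [mul_one] at h3
    exact absurd h2 (not_le.2 h3)
  have hk : ∀ (k : K) (z : RatFunc K), w (algebraMap K _ k * z) ≤ w z := fun k z => by
    rw [map_mul]; exact mul_le_of_le_one_left' (hc k)
  intro heq
  -- On the left n dominates, so the degree is 2 deg n; on the right it is smaller.
  have h1 : w (n + algebraMap K _ k * (2 * α) + 1) = w n := by
    rw [add_assoc]
    refine Valuation.map_add_eq_of_lt_left _ ?_
    refine Valuation.map_add_lt _ ?_ (lt_of_eq_of_lt (map_one w) hn)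
    refine lt_of_le_of_lt ?_ hαn
    have := hk (k * 2) α
    rwa [map_mul (algebraMap K (RatFunc K)), map_ofNat, mul_assoc] at this
  have h2 : w (2 * α + algebraMap K _ k) < w n := by
    refine Valuation.map_add_lt _ ?_ ((hc k).trans_lt hn)
    have := hk 2 α
    rw [map_ofNat] at this
    exact this.trans_lt hαn
  have h3 := congrArg w heq
  rw [map_pow, h1, map_mul, pow_two] at h3
  have h4 : w (4 * algebraMap K _ k * n) ≤ w n := by
    have := hk (4 * k) n
    rwa [map_mul (algebraMap K (RatFunc K)), map_ofNat] at this
  have h5 := lt_of_le_of_lt (mul_le_mul_left h4 (w (2 * α + algebraMap K _ k)))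
    (mul_lt_mul_of_pos_left h2 (zero_lt_one.trans hn))
  exact absurd h3 h5.ne'

namespace SelfIsogeny

variable (f : SelfIsogeny K)

theorem comorphism_yF_sq {K : Type} [Field K] (f : SelfIsogeny K) : f.comorphism (yF K) ^ 2
    = f.comorphism (xF K) ^ 3 - f.comorphism (xF K) := by
  rw [← map_pow, yF_sq_eq, map_mul, map_sub, map_pow, map_one]; ring

/-- Suppose u = f^*x differs from its conjugate ū. The chord through (u, v) and its conjugate is
invariant under y ↦ -y, hence so is its third intersection with the curve. This is a point over
K(x), so its abscissa is a constant k. Vieta's formulas on the chord yield (uū + k(u + ū) + 1)² =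
4k·uū(u + ū + k), which `add_one_sq_ne` excludes at the pole of u. -/
theorem conj_comorphism_xF : conj K (f.comorphism (xF K)) = f.comorphism (xF K) := by
  obtain ⟨α, β, hαβ⟩ := exists_eq_ratMap_add (f.comorphism (xF K))
  by_contra hne
  have hpole : HasPoleAtOrigin (f.comorphism (xF K)) := f.map_origin
  rw [hαβ] at hpole
  have hdeg := hpole.intDegree_pos
  set u := f.comorphism (xF K) with hu
  set v := f.comorphism (yF K) with hv
  have huv : v ^ 2 = u ^ 3 - u := f.comorphism_yF_sq
  have huv' : conj K v ^ 2 = conj K u ^ 3 - conj K u := by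
    rw [← map_pow, huv, map_sub, map_pow]
  have hconj : ∀ z : XField K, conj K (conj K z) = z := fun z => by
    obtain ⟨a, b, rfl⟩ := exists_eq_ratMap_add z
    rw [conj_ratMap_add, map_sub, map_mul, conj_ratMap, conj_ratMap, conj_yF]; ring
  have hu1 : u - conj K u ≠ 0 := sub_ne_zero.2 (Ne.symm hne)
  -- The slope of the chord.
  obtain ⟨l, hl⟩ : ∃ l, l = (v - conj K v) / (u - conj K u) := ⟨_, rfl⟩
  have hl1 : l * (u - conj K u) = v - conj K v := by rw [hl, div_mul_cancel₀ _ hu1]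
  have hlc : conj K l = l := by
    rw [hl, map_div₀, map_sub, map_sub, hconj, hconj, ← neg_sub v, ← neg_sub u, neg_div_neg_eq]
  -- The coordinates a, b of the third intersection point, the abscissa from the sum of the roots of
  -- the cubic on the chord.
  obtain ⟨a, ha⟩ := exists_eq_ratMap_of_conj_eq (g := l ^ 2 - u - conj K u) (by
    rw [map_sub, map_sub, map_pow, hlc, hconj]; ring)
  obtain ⟨b, hb⟩ := exists_eq_ratMap_of_conj_eq (g := l * (l ^ 2 - u - conj K u - u) + v) (by
    rw [map_add, map_mul, map_sub, map_sub, map_sub, map_pow, hlc, hconj]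
    linear_combination hl1)
  have hv' : conj K v = l * (conj K u - u) + v := by linear_combination hl1
  have hab : b ^ 2 = a ^ 3 - a := by
    refine ratMap_injective ?_
    rw [map_sub, map_pow, map_pow, ← ha, ← hb]
    refine mul_left_cancel₀ hu1 ?_
    rw [hv'] at huv'
    linear_combination (l ^ 2 - u - conj K u - conj K u) * huv - (l ^ 2 - u - conj K u - u) * huv'
  obtain ⟨k, rfl⟩ := RatFunc.exists_eq_of_sq_eq hab
  refine add_one_sq_ne k hdeg (ratMap_injective ?_)
  have hn : ratMap K (α ^ 2 - β ^ 2 * (RatFunc.X ^ 3 - RatFunc.X)) = u * conj K u := by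
    rw [hαβ, conj_ratMap_add, map_sub, map_mul, ← yF_sq_eq_ratMap, map_pow, map_pow]; ring
  have ht : ratMap K (2 * α) = u + conj K u := by
    rw [hαβ, conj_ratMap_add, map_mul, map_ofNat]; ring
  rw [map_mul, map_mul, map_mul, map_add (ratMap K) (2 * α), map_pow, map_add, map_add, hn, map_mul,
    ht, ← ha, map_one, map_ofNat]
  -- Vieta for the second symmetric function; `h2` is the product of the roots. The intercept of the
  -- chord is v - lu.
  have h1 : u * conj K u + (l ^ 2 - u - conj K u) * (u + conj K u) + 1 = - 2 * l * (v - l * u) := by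
    refine mul_left_cancel₀ hu1 ?_
    rw [hv'] at huv'
    linear_combination huv - huv'
  have h2 : (v - l * u) ^ 2 = (l ^ 2 - u - conj K u) * (u * conj K u) := by
    refine mul_left_cancel₀ hu1 ?_
    rw [hv'] at huv'
    linear_combination -conj K u * huv + u * huv'
  rw [h1, mul_pow]
  linear_combination 4 * l ^ 2 * h2

/-- Since f^*x is even, the conjugate of f^*y is ±f^*y. With the sign + the pair would be a point
over K(x), so f^*x would be constant and have no pole; hence f^*y is w times y. -/
theorem exists_eq_ratMap : ∃ α w : RatFunc K, f.comorphism (xF K) = ratMap K α ∧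
    0 < α.intDegree ∧ α ^ 3 - α = w ^ 2 * (RatFunc.X ^ 3 - RatFunc.X) := by
  obtain ⟨α, hα⟩ := exists_eq_ratMap_of_conj_eq f.conj_comorphism_xF
  have hpole : HasPoleAtOrigin (f.comorphism (xF K)) := f.map_origin
  have hd : 0 < α.intDegree := by
    rw [hα, ← add_zero (ratMap K α), ← zero_mul (yF K), ← map_zero (ratMap K)] at hpole
    have h := hpole.intDegree_pos
    rw [zero_pow two_ne_zero, zero_mul, sub_zero] at h
    have hα0 : α ≠ 0 := by rintro rfl; simp at h
    rw [pow_two, RatFunc.intDegree_mul hα0 hα0] at h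
    omega
  have hv := f.comorphism_yF_sq
  have hv' : conj K (f.comorphism (yF K)) ^ 2 = f.comorphism (yF K) ^ 2 := by
    rw [← map_pow, hv, map_sub, map_pow, f.conj_comorphism_xF]
  rcases sq_eq_sq_iff_eq_or_eq_neg.1 hv' with h | h
  · obtain ⟨w, hw⟩ := exists_eq_ratMap_of_conj_eq h
    rw [hw, hα, ← map_pow, ← map_pow, ← map_sub] at hv
    obtain ⟨k, rfl⟩ := RatFunc.exists_eq_of_sq_eq (ratMap_injective hv)
    rw [RatFunc.algebraMap_eq_C, RatFunc.intDegree_C] at hd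
    exact absurd hd (lt_irrefl _)
  · obtain ⟨w, hw⟩ := exists_eq_mul_of_conj_eq_neg h
    refine ⟨α, w, hα, hd, ratMap_injective ?_⟩
    rw [map_mul, ← yF_sq_eq_ratMap, map_sub, map_pow, map_pow, ← mul_pow, ← hw, ← hα, hv]

open IntermediateField in
-- The degree of the function field over K(f^*x) is computed in two ways, through K(x) and through
-- the image of `f.comorphism`. The factor [K(E) : K(x)] occurs in both, transported by `f` in the
-- second, and cancels because it is finite and nonzero.
theorem max_natDegree_eq_degree {K : Type} [Field K] (f : SelfIsogeny K) {α : RatFunc K} (hα : f.comorphism (xF K) = ratMap K α) :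
    max α.num.natDegree α.denom.natDegree = f.degree := by
  let r : RatFunc K →ₐ[K] XField K := (ratMap K).restrictScalars K
  have hE : r.fieldRange = K⟮xF K⟯ := by
    rw [AlgHom.fieldRange_eq_map, ← RatFunc.adjoin_X, adjoin_map, Set.image_singleton]
    change K⟮ratMap K RatFunc.X⟯ = _
    rw [ratMap_X]
  have h1 : K⟮xF K⟯.map f.comorphism = K⟮α⟯.map r := by
    rw [adjoin_map, adjoin_map, Set.image_singleton, Set.image_singleton, hα]; rfl
  have h2 : relfinrank (K⟮α⟯.map r) K⟮xF K⟯ = max α.num.natDegree α.denom.natDegree := by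
    rw [← hE, AlgHom.fieldRange_eq_map, relfinrank_map_map, relfinrank_top_right,
      RatFunc.finrank_eq_max_natDegree]
  have h3 : relfinrank (K⟮α⟯.map r) f.comorphism.fieldRange = Module.finrank K⟮xF K⟯ (XField K) := by
    rw [← h1, AlgHom.fieldRange_eq_map, relfinrank_map_map, relfinrank_top_right]
  have h4 := relfinrank_mul_finrank_top (show K⟮α⟯.map r ≤ K⟮xF K⟯ from by
    rw [← hE, AlgHom.fieldRange_eq_map]; exact IntermediateField.map_mono _ le_top)
  have h5 := relfinrank_mul_finrank_top (show K⟮α⟯.map r ≤ f.comorphism.fieldRange from by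
    rw [← h1, AlgHom.fieldRange_eq_map]; exact IntermediateField.map_mono _ le_top)
  have hfin : Module.Finite K⟮xF K⟯ (XField K) := by
    refine ⟨{1, yF K}, ?_⟩
    rw [eq_top_iff]
    rintro z -
    obtain ⟨a, b, rfl⟩ := exists_eq_ratMap_add z
    have hm : ∀ a, ratMap K a ∈ K⟮xF K⟯ := fun a => hE ▸ ⟨a, rfl⟩
    rw [← mul_one (ratMap K a)]
    exact add_mem
      (Submodule.smul_mem _ (⟨_, hm a⟩ : K⟮xF K⟯) (Submodule.subset_span (by simp)))
      (Submodule.smul_mem _ (⟨_, hm b⟩ : K⟮xF K⟯) (Submodule.subset_span (by simp)))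
  have hpos : 0 < Module.finrank K⟮xF K⟯ (XField K) := Module.finrank_pos
  rw [h2] at h4
  rw [h3] at h5
  have h6 : Module.finrank f.comorphism.fieldRange (XField K) = f.degree := rfl
  rw [h6, ← h4, mul_comm] at h5
  exact (Nat.eq_of_mul_eq_mul_right hpos h5).symm

/-- The degree and the pole give deg p = 2 and deg q < 2. Comparing degrees in pq(p² - q²) = (x³ -
x)m² gives 6 + deg q = 3 + 2 deg m, so deg q is odd and equals 1. -/
theorem exists_eq_of_degree_eq_two (hf : f.degree = 2) : ∃ (α : RatFunc K) (a c : K),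
    f.comorphism (xF K) = ratMap K α ∧ a ≠ 0 ∧ c ≠ 0 ∧ (c / a) ^ 2 = -4 ∧
      α * algebraMap K[X] _ (Polynomial.C c * Polynomial.X)
        = algebraMap K[X] _ (Polynomial.C a * (Polynomial.X ^ 2 - 1)) := by
  obtain ⟨α, w, hα, hd, hw⟩ := f.exists_eq_ratMap
  have hmax := f.max_natDegree_eq_degree hα
  rw [hf] at hmax
  set p := α.num with hp
  set q := α.denom with hq
  have hpq : IsCoprime p q := RatFunc.isCoprime_num_denom α
  have hq0 : q ≠ 0 := RatFunc.denom_ne_zero α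
  have hdeg : α.intDegree = p.natDegree - q.natDegree := rfl
  have hp2 : p.natDegree = 2 := by omega
  have hq2 : q.natDegree < 2 := by omega
  have hq' : algebraMap K[X] (RatFunc K) q ≠ 0 := by simpa using hq0
  have hαpq : α * algebraMap K[X] _ q = algebraMap K[X] _ p := by
    rw [eq_comm, ← div_eq_iff hq']; exact RatFunc.num_div_denom α
  have h1 : (w * algebraMap K[X] _ q ^ 2) ^ 2 * algebraMap K[X] _ (Polynomial.X ^ 3 - Polynomial.X)
      = algebraMap K[X] _ (p * q * (p ^ 2 - q ^ 2)) := by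
    simp only [map_mul, map_sub, map_pow, RatFunc.algebraMap_X, ← hαpq]
    linear_combination -algebraMap K[X] (RatFunc K) q ^ 4 * hw
  obtain ⟨m, hm⟩ := exists_polynomial_of_sq_mul squarefree_X_cubed_sub_X h1
  rw [hm, ← map_pow, ← map_mul] at h1
  have h2 := ((mul_comm _ _).trans (IsFractionRing.injective K[X] (RatFunc K) h1)).symm
  have hp0 : p ≠ 0 := by rintro h0; rw [h0] at hp2; simp at hp2
  have hlt : (q ^ 2).natDegree < (p ^ 2).natDegree := by
    rw [Polynomial.natDegree_pow, Polynomial.natDegree_pow]; omega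
  have hs : (p ^ 2 - q ^ 2).natDegree = 4 := by
    rw [Polynomial.natDegree_sub_eq_left_of_natDegree_lt hlt, Polynomial.natDegree_pow, hp2]
  have hs0 : p ^ 2 - q ^ 2 ≠ 0 := by rintro h0; rw [h0] at hs; simp at hs
  have hm0 : m ≠ 0 := by
    rintro rfl
    rw [zero_pow two_ne_zero, mul_zero] at h2
    exact mul_ne_zero (mul_ne_zero hp0 hq0) hs0 h2
  have hX3 : (Polynomial.X ^ 3 - Polynomial.X : K[X]).natDegree = 3 := by compute_degree!
  have hq1 : q.natDegree = 1 := by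
    have h3 := congrArg Polynomial.natDegree h2
    rw [Polynomial.natDegree_mul (mul_ne_zero hp0 hq0) hs0, Polynomial.natDegree_mul hp0 hq0, hs, hp2,
      Polynomial.natDegree_mul squarefree_X_cubed_sub_X.ne_zero (pow_ne_zero _ hm0), hX3,
      Polynomial.natDegree_pow] at h3
    omega
  obtain ⟨a, c, ha, hc, hac, hpa, hqc⟩ := exists_root_of_mul_eq hpq hp2 hq1 h2
  exact ⟨α, a, c, hα, ha, hc, hac, hpa ▸ hqc ▸ hαpq⟩

/-- The function `f^* x` is a square if `f` has degree two. -/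
theorem exists_sq_eq (hi : ∃ i : K, i ^ 2 = -1) (hf : f.degree = 2) :
    ∃ t : XField K, t ^ 2 = f.comorphism (xF K) := by
  obtain ⟨i, hi⟩ := hi
  obtain ⟨α, a, c, hα, ha, hc, hac, hαpq⟩ := f.exists_eq_of_degree_eq_two hf
  -- From (c/a)² = -4 one gets c/a = ±2i = (1 ± i)².
  obtain ⟨r, hr⟩ : ∃ r : K, r ^ 2 = c / a := by
    have h3 : (c / a - 2 * i) * (c / a + 2 * i) = 0 := by linear_combination hac - 4 * hi
    rcases mul_eq_zero.1 h3 with h3 | h3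
    · exact ⟨1 + i, by linear_combination hi - h3⟩
    · exact ⟨1 - i, by linear_combination hi - h3⟩
  have hr0 : r ≠ 0 := by
    rintro rfl
    rw [zero_pow two_ne_zero] at hr
    exact div_ne_zero hc ha hr.symm
  have hx : xF K ≠ 0 := by
    rw [← ratMap_X, Ne, map_eq_zero_iff _ ratMap_injective]
    exact RatFunc.X_ne_zero
  have hr' : algebraMap K (XField K) r ≠ 0 := by simpa using hr0
  have ha' : algebraMap K (XField K) a ≠ 0 := by simpa using ha
  -- f^*x = (a/c)(x² - 1)/x = (a/c)y²/x².
  refine ⟨yF K / (algebraMap K _ r * xF K), ?_⟩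
  have h4 := congrArg (ratMap K) hαpq
  rw [map_mul, ← hα, ratMap_algebraMap, ratMap_algebraMap] at h4
  simp only [map_mul, Polynomial.aeval_C, Polynomial.aeval_X, map_sub, map_pow, map_one] at h4
  have h5 : algebraMap K (XField K) r ^ 2 * algebraMap K (XField K) a = algebraMap K (XField K) c := by
    rw [← map_pow, ← map_mul, hr, div_mul_cancel₀ _ ha]
  rw [div_pow, div_eq_iff (pow_ne_zero _ (mul_ne_zero hr' hx))]
  refine mul_left_cancel₀ ha' ?_
  linear_combination algebraMap K (XField K) a * yF_sq_eq K - xF K * h4 - f.comorphism (xF K) * xF K ^ 2 * h5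

end SelfIsogeny

end Isogeny

/-! ### The ring of functions on the preimage of X. -/

namespace SelfIsogeny

variable {K : Type} [Field K] [CharZero K] (f : SelfIsogeny K)

/-- The comorphism, as a homomorphism of algebras over the coordinate ring of `X`. -/
def toSource {K : Type} [Field K] (f : SelfIsogeny K) : XField K →ₐ[XRing K] f.SourceField where
  __ := f.comorphism
  commutes' _ := rfl

theorem toSource_injective {K : Type} [Field K] (f : SelfIsogeny K) :
    Function.Injective f.toSource :=
  f.toSource.toRingHom.injective

theorem not_isSquare_xF (z : XField K) : z ^ 2 ≠ xF K := by
  intro h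
  have hx : xF K ≠ 0 := by
    rw [← ratMap_X, Ne, map_eq_zero_iff _ ratMap_injective]
    exact RatFunc.X_ne_zero
  refine not_isSquare_mul_X_sq_sub_one one_ne_zero (yF K / z) ?_
  rw [div_pow, yF_sq_eq, h, mul_div_cancel_left₀ _ hx, map_one, one_mul]

variable {f} {t s : f.SourceField}

theorem eq_zero_of_add_mul_eq_zero (ht : t ^ 2 = f.toSource (xF K)) {a b : XField K}
    (h : f.toSource a + f.toSource b * t = 0) : a = 0 ∧ b = 0 := by
  have hb : b = 0 := by
    by_contra hb
    have hb' : f.toSource b ≠ 0 := by simpa using hb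
    refine not_isSquare_xF (a / b) (f.toSource_injective ?_)
    rw [map_pow, map_div₀, ← ht, div_pow, div_eq_iff (pow_ne_zero 2 hb')]
    linear_combination (f.toSource a - f.toSource b * t) * h
  subst hb
  refine ⟨f.toSource_injective ?_, rfl⟩
  rw [map_zero, zero_mul, add_zero] at h
  rw [h, map_zero]

/-- 1 and t are independent over the image of the comorphism because x is not a square in the
function field; in degree two they form a basis. -/
theorem exists_eq_add_mul (hf : f.degree = 2) (ht : t ^ 2 = f.toSource (xF K))
    (g : f.SourceField) : ∃ a b, g = f.toSource a + f.toSource b * t := by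
  let g' : XField K := g
  let t' : XField K := t
  have hli : LinearIndependent f.comorphism.fieldRange ![1, t'] := by
    rw [LinearIndependent.pair_iff]
    rintro ⟨_, a, rfl⟩ ⟨_, b, rfl⟩ h
    have h1 : f.toSource a + f.toSource b * t = 0 := by
      refine Eq.trans ?_ h
      change _ = f.comorphism a * (1 : XField K) + f.comorphism b * t'
      rw [mul_one]; rfl
    obtain ⟨rfl, rfl⟩ := eq_zero_of_add_mul_eq_zero ht h1
    constructor <;> ext <;> simp
  have : FiniteDimensional f.comorphism.fieldRange (XField K) :=
    FiniteDimensional.of_finrank_pos (by change 0 < f.degree; omega)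
  have hspan := hli.span_eq_top_of_card_eq_finrank' (by
    rw [Fintype.card_fin]; exact hf.symm)
  have hg : g' ∈ Submodule.span f.comorphism.fieldRange (Set.range ![1, t']) := by
    rw [hspan]; trivial
  rw [Matrix.range_cons, Matrix.range_cons, Matrix.range_empty, Set.union_empty,
    Set.singleton_union, Submodule.mem_span_pair] at hg
  obtain ⟨⟨_, a, rfl⟩, ⟨_, b, rfl⟩, h⟩ := hg
  refine ⟨a, b, Eq.trans h.symm ?_⟩
  change f.comorphism a * (1 : XField K) + f.comorphism b * t' = _
  rw [mul_one]; rfl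

/-- Conjugation t ↦ -t preserves integrality. Evaluating one polynomial at the two conjugates gives
u + vt and u - vt with the same u, v, so a monic equation of one is an equation of the other. -/
theorem isIntegral_sub_mul (ht : t ^ 2 = f.toSource (xF K)) {a b : XField K}
    (h : IsIntegral (XRing K) (f.toSource a + f.toSource b * t)) :
    IsIntegral (XRing K) (f.toSource a - f.toSource b * t) := by
  have key : ∀ P : (XRing K)[X], ∃ u v,
      Polynomial.aeval (f.toSource a + f.toSource b * t) P = f.toSource u + f.toSource v * t ∧
      Polynomial.aeval (f.toSource a - f.toSource b * t) P = f.toSource u - f.toSource v * t := by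
    intro P
    induction P using Polynomial.induction_on' with
    | add p q hp hq =>
      obtain ⟨u, v, h1, h2⟩ := hp
      obtain ⟨u', v', h3, h4⟩ := hq
      refine ⟨u + u', v + v', ?_, ?_⟩ <;> simp only [map_add, h1, h2, h3, h4] <;> ring
    | monomial n c =>
      induction n with
      | zero =>
        refine ⟨algebraMap _ _ c, 0, ?_, ?_⟩ <;> simp
      | succ n ih =>
        obtain ⟨u, v, h1, h2⟩ := ih
        rw [Polynomial.aeval_monomial] at h1 h2
        refine ⟨u * a + v * b * xF K, u * b + v * a, ?_, ?_⟩
        · rw [Polynomial.aeval_monomial, pow_succ, ← mul_assoc, h1]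
          simp only [map_add, map_mul, ← ht]; ring
        · rw [Polynomial.aeval_monomial, pow_succ, ← mul_assoc, h2]
          simp only [map_add, map_mul, ← ht]; ring
  obtain ⟨P, hP, h0⟩ := h
  obtain ⟨u, v, h1, h2⟩ := key P
  rw [Polynomial.aeval_def, h0] at h1
  obtain ⟨rfl, rfl⟩ := eq_zero_of_add_mul_eq_zero ht h1.symm
  refine ⟨P, hP, ?_⟩
  rw [← Polynomial.aeval_def, h2]; simp

theorem exists_eq_of_isIntegral_toSource {z : XField K}
    (h : IsIntegral (XRing K) (f.toSource z)) : ∃ a, z = algebraMap (XRing K) (XField K) a :=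
  exists_eq_of_isIntegral ((isIntegral_algHom_iff f.toSource f.toSource_injective).1 h)

theorem algebraMap_xX {K : Type} [Field K] (f : SelfIsogeny K) : algebraMap (XRing K) f.SourceField (xX K) = f.toSource (xF K) := rfl

theorem algebraMap_yX {K : Type} [Field K] (f : SelfIsogeny K) : algebraMap (XRing K) f.SourceField (yX K) = f.toSource (yF K) := rfl

/-- If `f^* x` has a square root `t`, the ring of functions on the preimage of `X` is generated by
the square roots of `f^* x` and `f^* (x² - 1)`. -/
theorem nonempty_cover_equiv (hf : f.degree = 2) (ht : t ^ 2 = f.toSource (xF K)) :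
    Nonempty (Cover (XRing K) (xX K) (yX K) ≃ₐ[XRing K] f.PreimageRing) := by
  have hx : xF K ≠ 0 := by
    rw [← ratMap_X, Ne, map_eq_zero_iff _ ratMap_injective]
    exact RatFunc.X_ne_zero
  have ht0 : t ≠ 0 := by
    rintro rfl
    rw [zero_pow two_ne_zero] at ht
    exact hx (f.toSource_injective (by rw [← ht, map_zero]))
  obtain ⟨s, hs⟩ : ∃ s, t * s = f.toSource (yF K) := ⟨_, mul_div_cancel₀ _ ht0⟩
  have hs2 : s ^ 2 = f.toSource (xF K ^ 2 - 1) := by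
    refine mul_left_cancel₀ (pow_ne_zero 2 ht0) ?_
    rw [← mul_pow, hs, ht, ← map_pow, yF_sq_eq, map_mul]
  let l : Cover (XRing K) (xX K) (yX K) →ₐ[XRing K] f.SourceField := Cover.lift t s
    (by rw [ht, algebraMap_xX]) (by rw [hs, algebraMap_yX])
    (by rw [hs2, map_sub, map_pow, map_sub, map_pow, map_one, map_one, algebraMap_xX])
  have hlt : l Cover.t = t := Cover.lift_t ..
  have hls : l Cover.s = s := Cover.lift_s ..
  have hA : ∀ a, algebraMap (XRing K) f.SourceField a = f.toSource (algebraMap _ _ a) := fun a => rfl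
  -- The identity t⁴ - s² = 1, with one factor t² written as f^*x.
  have h1 : (1 : f.SourceField) = f.toSource (xF K) * t ^ 2 - s ^ 2 := by
    rw [ht, hs2, map_sub, map_pow, map_one]; ring
  -- Multiplying a relation a₀ + a₁t + a₂s = 0 by t² and by ts and separating the coefficients of 1
  -- and t gives a₀ = 0, a₁x + a₂y = 0 and a₁y + a₂(x² - 1) = 0. In the cover these kill a₁t + a₂s,
  -- after multiplication by 1 = t⁴ - s².
  have hinj : Function.Injective l := by
    rw [injective_iff_map_eq_zero]
    intro b hb
    obtain ⟨a₀, a₁, a₂, rfl⟩ := Cover.exists_eq b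
    rw [map_add, map_add, map_smul, map_smul, AlgHom.commutes, hlt, hls, Algebra.smul_def,
      Algebra.smul_def, hA, hA, hA] at hb
    have e1 : f.toSource (algebraMap _ _ (xX K * a₀))
        + f.toSource (algebraMap _ _ (a₁ * xX K + a₂ * yX K)) * t = 0 := by
      simp only [map_add, map_mul]
      change f.toSource (xF K) * _ + (_ * f.toSource (xF K) + _ * f.toSource (yF K)) * t = 0
      rw [← hs, ← ht]
      linear_combination t ^ 2 * hb
    have e2 : f.toSource (algebraMap _ _ (yX K * a₀))
        + f.toSource (algebraMap _ _ (a₁ * yX K + a₂ * (xX K ^ 2 - 1))) * t = 0 := by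
      simp only [map_add, map_mul, map_sub, map_pow, map_one]
      change f.toSource (yF K) * _ + (_ * f.toSource (yF K) + _ * (f.toSource (xF K) ^ 2 - 1)) * t = 0
      have : f.toSource (xF K) ^ 2 - 1 = s ^ 2 := by rw [hs2, map_sub, map_pow, map_one]
      rw [this, ← hs]
      linear_combination t * s * hb
    have hinjA := IsFractionRing.injective (XRing K) (XField K)
    obtain ⟨k1, k2⟩ := eq_zero_of_add_mul_eq_zero ht e1
    obtain ⟨-, k3⟩ := eq_zero_of_add_mul_eq_zero ht e2
    rw [map_eq_zero_iff _ hinjA] at k1 k2 k3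
    have hx0 : xX K ≠ 0 := by rintro h0; exact hx (by rw [xF, h0, map_zero])
    obtain rfl : a₀ = 0 := (mul_eq_zero.1 k1).resolve_left hx0
    have c2 := congrArg (algebraMap (XRing K) (Cover (XRing K) (xX K) (yX K))) k2
    have c3 := congrArg (algebraMap (XRing K) (Cover (XRing K) (xX K) (yX K))) k3
    simp only [map_add, map_mul, map_zero, ← Cover.t_sq, ← Cover.t_mul_s, ← Cover.s_sq] at c2 c3
    have h2 : (1 : Cover (XRing K) (xX K) (yX K)) = Cover.t ^ 4 - Cover.s ^ 2 := by
      rw [show (4 : ℕ) = 2 * 2 from rfl, pow_mul, Cover.t_sq, Cover.s_sq]; simp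
    rw [Algebra.smul_def, Algebra.smul_def, map_zero, zero_add]
    linear_combination (algebraMap _ _ a₁ * Cover.t + algebraMap _ _ a₂ * Cover.s) * h2
      + Cover.t ^ 3 * c2 - Cover.s * c3
  have hint : ∀ {z : f.SourceField} {a : XRing K}, z ^ 2 = algebraMap _ _ a → IsIntegral (XRing K) z :=
    fun {z a} h => IsIntegral.of_pow (n := 2) two_pos (h ▸ isIntegral_algebraMap)
  have hti : IsIntegral (XRing K) t := hint (a := xX K) (by rw [ht, algebraMap_xX])
  have hsi : IsIntegral (XRing K) s := hint (a := xX K ^ 2 - 1)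
    (by rw [hs2, hA, map_sub (algebraMap (XRing K) (XField K)), map_pow, map_one]; rfl)
  have hrange : l.range = integralClosure (XRing K) f.SourceField := by
    refine le_antisymm ?_ ?_
    · rintro _ ⟨b, rfl⟩
      exact (Algebra.IsIntegral.isIntegral (R := XRing K) b).map l
    · intro g hg
      have hg : IsIntegral (XRing K) g := hg
      obtain ⟨a, b, rfl⟩ := exists_eq_add_mul hf ht g
      have hg' := isIntegral_sub_mul ht hg
      have ha : IsIntegral (XRing K) (f.toSource a) := by
        have e1 : algebraMap K (XRing K) (1 / 2) •
            ((f.toSource a + f.toSource b * t) + (f.toSource a - f.toSource b * t))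
            = f.toSource a := by
          have e2 : algebraMap (XRing K) f.SourceField (algebraMap K (XRing K) (1 / 2)) * 2 = 1 := by
            rw [← map_ofNat (algebraMap (XRing K) f.SourceField),
              ← map_ofNat (algebraMap K (XRing K)), ← map_mul, ← map_mul]
            simp
          rw [Algebra.smul_def]
          linear_combination f.toSource a * e2
        rw [← e1]
        exact (hg.add hg').smul _
      have hb : IsIntegral (XRing K) (f.toSource b * t) := by
        have := hg.sub ha
        rwa [add_sub_cancel_left] at this
      obtain ⟨a', rfl⟩ := exists_eq_of_isIntegral_toSource ha
      obtain ⟨p, hp⟩ := exists_eq_of_isIntegral_toSource (z := b * xF K) (by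
        rw [map_mul, ← ht, pow_two, ← mul_assoc]
        exact hb.mul hti)
      obtain ⟨q, hq⟩ := exists_eq_of_isIntegral_toSource (z := b * yF K) (by
        rw [map_mul, ← hs, ← mul_assoc]
        exact hb.mul hsi)
      -- bt = bt(t⁴ - s²), where p = bx and q = by are regular functions because bt·t and bt·s are
      -- integral.
      refine ⟨algebraMap _ _ a' + (p * xX K) • Cover.t - q • Cover.s, ?_⟩
      change l _ = _
      have hp' := congrArg f.toSource hp
      have hq' := congrArg f.toSource hq
      rw [map_mul] at hp' hq'
      rw [map_sub, map_add, map_smul, map_smul, AlgHom.commutes, hlt, hls, Algebra.smul_def,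
        Algebra.smul_def, map_mul, algebraMap_xX, hA, hA, hA, ← hp', ← hq', ← hs]
      linear_combination -f.toSource b * t * h1 - f.toSource b * f.toSource (xF K) * t * ht
  exact ⟨(AlgEquiv.ofInjective l hinj).trans (Subalgebra.equivOfEq _ _ hrange)⟩

end SelfIsogeny

/-! ### The connection on `A[ω] / (ω² - (x² - 1))` -/

section SqrtConnection

variable {R A : Type} [CommRing R] [CommRing A] [Algebra R A]

open QuadraticAlgebra TensorProduct

theorem QuadraticAlgebra.eq_smul_one_add_smul_omega {a b : A} (q : QuadraticAlgebra A a b) :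
    q = q.re • 1 + q.im • omega := by
  ext <;> simp [QuadraticAlgebra.re_one, QuadraticAlgebra.im_one]

/-- The connection with `∇ ω = x / (x² - 1) dx ⊗ ω`. -/
def sqrtConnection (R : Type) [CommRing R] [Algebra R A] (x g' : A) :
    Connection R A (QuadraticAlgebra A (x ^ 2 - 1) 0) where
  toFun := AddMonoidHom.mk' (fun q => KaehlerDifferential.D R A q.re ⊗ₜ 1 +
    (KaehlerDifferential.D R A q.im + (q.im * (g' * x)) • KaehlerDifferential.D R A x) ⊗ₜ omega) (by
      intro q q'
      simp only [re_add, im_add, map_add, add_tmul, add_mul, add_smul]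
      abel)
  leibniz a q := by
    have h1 : KaehlerDifferential.D R A a ⊗ₜ[A] q
        = q.re • KaehlerDifferential.D R A a ⊗ₜ[A] (1 : QuadraticAlgebra A (x ^ 2 - 1) 0)
          + q.im • KaehlerDifferential.D R A a ⊗ₜ[A] omega := by
      rw [← tmul_smul, ← tmul_smul, ← tmul_add,
        ← QuadraticAlgebra.eq_smul_one_add_smul_omega]
    rw [h1]
    simp only [AddMonoidHom.mk'_apply, re_smul, im_smul, smul_eq_mul, Derivation.leibniz, add_tmul,
      smul_add, ← smul_tmul', smul_smul]
    module

variable {x g' : A}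

theorem sqrtConnection_apply (x g' : A) (q : QuadraticAlgebra A (x ^ 2 - 1) 0) :
    (sqrtConnection R x g').toFun q = KaehlerDifferential.D R A q.re ⊗ₜ 1 +
      (KaehlerDifferential.D R A q.im + (q.im * (g' * x)) • KaehlerDifferential.D R A x) ⊗ₜ omega :=
  rfl

/-- The essential case is ω·ω = x² - 1, where 2(x² - 1)·g'x dx = 2x dx = d(x² - 1). No division by 2
occurs. -/
theorem sqrtConnection_isMultiplicative (h : g' * (x ^ 2 - 1) = 1) : (sqrtConnection R x g').IsMultiplicative := by
  intro q q'
  have h1 : ∀ (q : QuadraticAlgebra A (x ^ 2 - 1) 0) (u : Ω[A⁄R]), u ⊗ₜ[A] q = q.re • u ⊗ₜ[A] 1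
      + q.im • u ⊗ₜ[A] omega := fun q u => by
    rw [← tmul_smul, ← tmul_smul, ← tmul_add,
      ← QuadraticAlgebra.eq_smul_one_add_smul_omega]
  have h2 : KaehlerDifferential.D R A (x ^ 2 - 1) = (2 * x) • KaehlerDifferential.D R A x := by
    rw [map_sub, Derivation.map_one_eq_zero, sub_zero, Derivation.leibniz_pow, mul_smul, ← Nat.cast_smul_eq_nsmul A]; simp
  simp only [sqrtConnection_apply, map_add, LinearMap.lTensor_tmul, LinearMap.mulLeft_apply, mul_one]
  simp only [h1 q, h1 q', h1 (q * omega), h1 (q' * omega), re_mul, im_mul, omega_re, omega_im,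
    mul_zero, mul_one, zero_mul, zero_add, add_zero, map_add, Derivation.leibniz, h2,
    add_tmul, ← smul_tmul', smul_add, smul_smul]
  have h3 : ((2 * q.im * q'.im * x) • KaehlerDifferential.D R A x ⊗ₜ[A] (1 : QuadraticAlgebra A (x ^ 2 - 1) 0))
     = (2 * q.im * q'.im * x * (g' * (x ^ 2 - 1))) • KaehlerDifferential.D R A x ⊗ₜ[A] (1 : QuadraticAlgebra A (x ^ 2 - 1) 0) := by
    rw [h, mul_one]
  linear_combination (norm := module) h3

end SqrtConnection

/-! ### Integral models -/

section Models

/-- Over A' both modules are isomorphic, as algebras, to the same double cover. The connections are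
multiplicative and the algebra is unramified on the generic side, so the algebra isomorphism is
horizontal and no connection has to be computed. -/
theorem hasModelWithVanishingPCurvature_of_algEquiv_cover {K A B R S A' N : Type} [CommRing K]
    [CommRing A] [Algebra K A] [CommRing B] [Algebra A B] [Algebra K B] [IsScalarTower K A B]
    [Algebra.Etale A B] [CommRing R] [CommRing S] [CommRing A'] [Algebra R S] [Algebra R K]
    [Algebra K A'] [Algebra R A'] [Algebra S A'] [Algebra A A'] [IsScalarTower R K A']
    [IsScalarTower R S A'] [IsScalarTower K A A'] [CommRing N] [Algebra S N] {x y : A} {x₀ y₀ : S}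
    (hx : algebraMap S A' x₀ = algebraMap A A' x) (hy : algebraMap S A' y₀ = algebraMap A A' y)
    (e : Cover A x y ≃ₐ[A] B) (e₀ : N ≃ₐ[S] Cover S x₀ y₀) {c₀ : Connection R S N}
    (hc₀ : c₀.IsMultiplicative) (hfin : Module.Finite S N) (hproj : Module.Projective S N)
    (T : Set ℕ) (hT : ∀ (p : ℕ) [Fact p.Prime], p ∈ T → c₀.PCurvatureVanishesMod p) :
    (Connection.pushforwardTrivial K A B).HasModelWithVanishingPCurvature R S A' T := by
  refine ⟨N, inferInstance, inferInstance, c₀, hfin, hproj, ?_, hT⟩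
  refine Connection.isomorphic_of_isMultiplicative hc₀.baseChange
    Connection.pushforwardTrivial_isMultiplicative.baseChange ?_
  exact (Algebra.TensorProduct.congr AlgEquiv.refl e₀).trans
    ((Cover.baseChange A' x₀ y₀ hx hy).trans
      ((Cover.baseChange A' x y rfl rfl).symm.trans
        (Algebra.TensorProduct.congr AlgEquiv.refl e)))

variable {K B : Type} [Field K] [CommRing B] [Algebra (XRing K) B] [Algebra K B]
  [IsScalarTower K (XRing K) B] [Algebra.Etale (XRing K) B]

theorem XRing.map_yX (R R' : Type) [CommRing R] [CommRing R'] [Algebra R R'] :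
    XRing.map R R' (yX R) = yX R' := by
  simp [XRing.map, yX]

/-- When 2 is invertible the double cover is étale over X_R itself, and the push-forward of its
trivial connection is a model with all p-curvatures zero. -/
theorem hasVanishingModelOnX_of_isUnit (e : Cover (XRing K) (xX K) (yX K) ≃ₐ[XRing K] B)
    (R : Type) [CommRing R] [Algebra R K] (h2 : IsUnit (2 : R)) (T : Set ℕ) :
    HasVanishingModelOnX (Connection.pushforwardTrivial K (XRing K) B) R T := by
  let _ : Algebra (XRing R) (XRing K) := (XRing.map R K).toAlgebra
  have : IsScalarTower R (XRing R) (XRing K) :=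
    .of_algebraMap_eq fun r => (XRing.map_algebraMap R K r).symm
  have h2' : IsUnit (2 : XRing R) := by
    rw [← map_ofNat (algebraMap R (XRing R))]; exact h2.map _
  have : Algebra.Etale (XRing R) (Cover (XRing R) (xX R) (yX R)) := Cover.etale h2' (yX_sq_eq R)
  let _ : Algebra R (Cover (XRing R) (xX R) (yX R)) :=
    Algebra.compHom _ (algebraMap R (XRing R))
  have : IsScalarTower R (XRing R) (Cover (XRing R) (xX R) (yX R)) := .of_algebraMap_eq fun _ => rfl
  have hm := Connection.pushforwardTrivial_isMultiplicative (R := R) (A := XRing R)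
    (C := Cover (XRing R) (xX R) (yX R))
  exact hasModelWithVanishingPCurvature_of_algEquiv_cover (XRing.map_xX R K) (XRing.map_yX R K) e
    AlgEquiv.refl hm inferInstance Cover.projective_of_etale T fun p _ _ => hm.pCurvatureVanishesMod p

/-- Differentiating the curve equation modulo 2 leaves (x² - 1)dx = 0, and x² - 1 is invertible. -/
theorem KaehlerDifferential.D_eq_zero_of_two_eq_zero {R A : Type} [CommRing R] [CommRing A]
    [Algebra R A] (h2 : (2 : A) = 0) {x y g' : A} (h : g' * (x ^ 2 - 1) = 1)
    (hxy : y ^ 2 = x * (x ^ 2 - 1)) : D R A x = 0 := by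
  have e := congrArg (D R A) hxy
  rw [Derivation.leibniz_pow, Derivation.leibniz, map_sub, Derivation.leibniz_pow,
    ← Nat.cast_smul_eq_nsmul A, ← Nat.cast_smul_eq_nsmul A, Nat.cast_ofNat, h2,
    Derivation.map_one_eq_zero, zero_smul, zero_smul, sub_zero, smul_zero, zero_add] at e
  rw [← one_smul A (D R A x), ← h, mul_smul, ← e, smul_zero]

/-- The module is spanned modulo p by horizontal sections. For odd p the section (x² - 1)^((p-1)/2)
ω has logarithmic derivative (p - 1)x/(x² - 1) + x/(x² - 1), a multiple of p; for p = 2 one has dx =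
0. -/
theorem sqrtConnection_pCurvatureVanishesMod {R A : Type} [CommRing R] [CommRing A] [Algebra R A]
    {x y g' : A} (h : g' * (x ^ 2 - 1) = 1) (hxy : y ^ 2 = x * (x ^ 2 - 1)) (p : ℕ)
    [hp : Fact p.Prime] : (sqrtConnection R x g').PCurvatureVanishesMod p := by
  intro δ m
  set Ap := A ⧸ Ideal.span {(p : A)}
  have hpA : (p : Ap) = 0 := by
    rw [← map_natCast (Ideal.Quotient.mk (Ideal.span {(p : A)}))]
    exact Ideal.Quotient.eq_zero_iff_mem.2 (Ideal.mem_span_singleton_self _)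
  let N := QuadraticAlgebra A (x ^ 2 - 1) 0
  -- For p = 2 the truncated quotient is 0, so the same family of sections serves both cases.
  let n : ℕ := (p - 1) / 2
  have hu : IsUnit ((x ^ 2 - 1) ^ n) := (isUnit_iff_exists_inv'.2 ⟨g', h⟩).pow n
  have hn : (x ^ 2 - 1) ^ n • (QuadraticAlgebra.omega : N) = ⟨0, (x ^ 2 - 1) ^ n⟩ := by
    ext <;> simp
  refine Connection.pCurvature_eq_zero_of_span _ p hpA
    {1 ⊗ₜ[A] (1 : N), 1 ⊗ₜ[A] ((x ^ 2 - 1) ^ n • (QuadraticAlgebra.omega : N))} ?_ ?_ δ m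
  · have h1 : ∀ m : N, ((sqrtConnection R x g').baseChange R Ap).toFun (1 ⊗ₜ[A] m)
        = Connection.pullbackAux (KaehlerDifferential.D R Ap) ((sqrtConnection R x g').toFun m) :=
      fun m => (Connection.pullback_tmul _ _ _ _).trans (by
        rw [one_smul, Derivation.map_one_eq_zero, TensorProduct.zero_tmul, add_zero])
    rintro _ (rfl | rfl)
    · rw [h1, sqrtConnection_isMultiplicative h |>.map_one, map_zero]
    · rw [h1, hn, sqrtConnection_apply]
      simp only [map_zero, TensorProduct.zero_tmul, zero_add]
      rcases hp.out.eq_two_or_odd' with rfl | ⟨k, hk⟩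
      · have hn0 : n = 0 := rfl
        have hD : KaehlerDifferential.D R Ap (algebraMap A Ap x) = 0 := by
          refine KaehlerDifferential.D_eq_zero_of_two_eq_zero (by exact_mod_cast hpA)
            (y := algebraMap A Ap y) (g' := algebraMap A Ap g') ?_ ?_
          · rw [← map_pow, ← map_one (algebraMap A Ap), ← map_sub, ← map_mul, h]
          · rw [← map_pow, hxy, map_mul, map_sub, map_pow, map_one]
        rw [hn0, pow_zero, Derivation.map_one_eq_zero, zero_add, ← TensorProduct.smul_tmul', map_smul,
          Connection.pullbackAux_D_tmul, hD, TensorProduct.zero_tmul, smul_zero]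
      · have hnk : n = k := by change (p - 1) / 2 = k; omega
        have e1 : KaehlerDifferential.D R A ((x ^ 2 - 1) ^ n)
            + ((x ^ 2 - 1) ^ n * (g' * x)) • KaehlerDifferential.D R A x
            = (p : A) • ((x ^ 2 - 1) ^ n * (g' * x)) • KaehlerDifferential.D R A x := by
          have e2 : KaehlerDifferential.D R A (x ^ 2 - 1) = (2 * x) • KaehlerDifferential.D R A x := by
            rw [map_sub, Derivation.map_one_eq_zero, sub_zero, Derivation.leibniz_pow, mul_smul,
              ← Nat.cast_smul_eq_nsmul A]
            simp
          have e3 : (n : A) * (x ^ 2 - 1) ^ (n - 1) = n * (x ^ 2 - 1) ^ n * g' := by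
            rcases Nat.eq_zero_or_pos n with h0 | h0
            · simp [h0]
            · obtain ⟨l, hl⟩ := Nat.exists_eq_succ_of_ne_zero h0.ne'
              rw [hl, Nat.succ_sub_one, Nat.succ_eq_add_one, pow_succ (x ^ 2 - 1) l]
              linear_combination -(((l + 1 : ℕ) : A)) * (x ^ 2 - 1) ^ l * h
          rw [Derivation.leibniz_pow, ← Nat.cast_smul_eq_nsmul A, smul_smul, e3, e2, hk, ← hnk,
            smul_smul]
          push_cast
          module
        rw [e1, ← TensorProduct.smul_tmul', map_smul, ← algebraMap_smul Ap, map_natCast, hpA,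
          zero_smul]
  · rw [eq_top_iff]
    rintro z -
    induction z using TensorProduct.induction_on with
    | zero => exact zero_mem _
    | add z w hz hw => exact add_mem hz hw
    | tmul a q =>
      obtain ⟨w, hw⟩ := hu.exists_left_inv
      have e1 : a ⊗ₜ[A] q = (algebraMap A Ap q.re * a) • (1 : Ap) ⊗ₜ[A] (1 : N)
          + (algebraMap A Ap (q.im * w) * a) • (1 : Ap) ⊗ₜ[A] ((x ^ 2 - 1) ^ n • (QuadraticAlgebra.omega : N)) := by
        rw [TensorProduct.tmul_smul, ← algebraMap_smul Ap ((x ^ 2 - 1) ^ n), smul_smul,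
          TensorProduct.smul_tmul', TensorProduct.smul_tmul', smul_eq_mul, smul_eq_mul, mul_one,
          mul_one, mul_right_comm, ← map_mul, mul_assoc, hw, mul_one, ← Algebra.smul_def,
          ← Algebra.smul_def, TensorProduct.smul_tmul, TensorProduct.smul_tmul,
          ← TensorProduct.tmul_add]
        conv_lhs => rw [QuadraticAlgebra.eq_smul_one_add_smul_omega q]
      rw [e1]
      exact add_mem (Submodule.smul_mem _ _ (Submodule.subset_span (by simp)))
        (Submodule.smul_mem _ _ (Submodule.subset_span (by simp)))

/-! ### The model on U. -/

section ModelU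

variable {K B : Type} [Field K] [CommRing B] [Algebra (XRing K) B] [Algebra K B]
  [IsScalarTower K (XRing K) B] [Algebra.Etale (XRing K) B]

theorem URing.map_algebraMap_XRing (R R' : Type) [CommRing R] [CommRing R'] [Algebra R R']
    (a : XRing R) : URing.map R R' (algebraMap (XRing R) (URing R) a)
      = algebraMap (XRing R') (URing R') (XRing.map R R' a) := by
  rw [URing.map, IsLocalization.Away.lift_eq, RingHom.comp_apply]

/-- On U the double cover is free with basis 1, ω over any base ring. It need not be étale above 2,
but freeness and the explicit multiplicative connection suffice. -/
theorem hasVanishingModelOnU (e : Cover (XRing K) (xX K) (yX K) ≃ₐ[XRing K] B)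
    (R : Type) [CommRing R] [Algebra R K] (T : Set ℕ) :
    HasVanishingModelOnU (Connection.pushforwardTrivial K (XRing K) B) R T := by
  let _ : Algebra (URing R) (URing K) := (URing.map R K).toAlgebra
  have : IsScalarTower R (URing R) (URing K) :=
    .of_algebraMap_eq fun r => (URing.map_algebraMap R K r).symm
  let x₀ : URing R := algebraMap _ _ (xX R)
  let y₀ : URing R := algebraMap _ _ (yX R)
  have hg : IsUnit (x₀ ^ 2 - 1) := by
    have := IsLocalization.Away.algebraMap_isUnit (S := URing R) (xX R ^ 2 - 1)
    rwa [map_sub, map_pow, map_one] at this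
  have hxy : y₀ ^ 2 = x₀ * (x₀ ^ 2 - 1) := by
    rw [← map_pow, yX_sq_eq, map_mul, map_sub, map_pow, map_one]
  obtain ⟨g', hg'⟩ := hg.exists_left_inv
  exact hasModelWithVanishingPCurvature_of_algEquiv_cover
    (by
      change URing.map R K _ = _
      rw [URing.map_algebraMap_XRing, XRing.map_xX])
    (by
      change URing.map R K _ = _
      rw [URing.map_algebraMap_XRing, XRing.map_yX]) e
    (Cover.equivQuadratic hxy hg).symm (sqrtConnection_isMultiplicative (R := R) hg') inferInstance
    inferInstance T fun p _ _ => sqrtConnection_pCurvatureVanishesMod hg' hxy p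

end ModelU

end Models

/-! ### The expansion at the origin -/

section Expansion

open PowerSeries

/-- The variable stands for y⁴/4, q for √(1 - x²) and h for 1/q. The curve gives x = -y²h², so P =
q² satisfies P³ - P² + y⁴ = 0, where y⁴ is 4X. -/
theorem exists_integral_series : ∃ q h : ℤ⟦X⟧, q * h = 1 ∧
    1 - q ^ 2 = 4 * (X * h ^ 4) := by
  let I : Ideal ℤ⟦X⟧ := Ideal.span {X}
  have hens : ∀ (f : ℤ⟦X⟧[X]) (_ : f.Monic) (a₀ : ℤ⟦X⟧) (_ : f.eval a₀ ∈ I)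
      (_ : IsUnit (Ideal.Quotient.mk I (f.derivative.eval a₀))), ∃ a, f.IsRoot a ∧ a - a₀ ∈ I :=
    HenselianRing.is_henselian
  have hI : ∀ z : ℤ⟦X⟧, z ∈ I ↔ constantCoeff z = 0 := fun z => by
    rw [Ideal.mem_span_singleton, X_dvd_iff]
  have hunit : ∀ {z : ℤ⟦X⟧}, constantCoeff z = 1 → IsUnit z := fun {z} hz => by
    rw [isUnit_iff_constantCoeff, hz]; exact isUnit_one
  -- P = 1 is a simple root modulo X.
  obtain ⟨P, hP, hP1⟩ := hens (Polynomial.X ^ 3 - Polynomial.X ^ 2 + Polynomial.C (4 * X))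
    (by monicity!) 1 (by rw [hI]; simp) (by
      have : Polynomial.eval 1 (Polynomial.derivative
          (Polynomial.X ^ 3 - Polynomial.X ^ 2 + Polynomial.C (4 * X : ℤ⟦X⟧))) = 1 := by
        simp; norm_num
      rw [this, map_one]
      exact isUnit_one)
  have hP0 : constantCoeff P = 1 := by
    rw [hI, map_sub, map_one, sub_eq_zero] at hP1; exact hP1
  obtain ⟨Q, hQ⟩ := (hunit hP0).exists_right_inv
  simp only [Polynomial.IsRoot, Polynomial.eval_add, Polynomial.eval_sub, Polynomial.eval_pow,
    Polynomial.eval_X, Polynomial.eval_C] at hP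
  -- The square root of P = 1 - 4XQ² is sought as 1 - 2v: the factors 4 cancel and v satisfies v² -
  -- v + XQ² = 0, with the simple root 0 modulo X. This keeps the square root integral.
  obtain ⟨v, hv, hv0⟩ := hens (Polynomial.X ^ 2 - Polynomial.X + Polynomial.C (X * Q ^ 2))
    (by monicity!) 0 (by rw [hI]; simp) (by
      have : Polynomial.eval 0 (Polynomial.derivative
          (Polynomial.X ^ 2 - Polynomial.X + Polynomial.C (X * Q ^ 2))) = -1 := by
        rw [Polynomial.derivative_add, Polynomial.derivative_C]; simp
      rw [this, map_neg, map_one]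
      exact (isUnit_one : IsUnit (1 : ℤ⟦X⟧ ⧸ I)).neg)
  rw [hI, sub_zero] at hv0
  simp only [Polynomial.IsRoot, Polynomial.eval_add, Polynomial.eval_sub, Polynomial.eval_pow,
    Polynomial.eval_X, Polynomial.eval_C] at hv
  obtain ⟨h, hh⟩ := (hunit (z := 1 - 2 * v) (by simp [hv0])).exists_right_inv
  have h1 : (1 - 2 * v) ^ 2 = P := by
    have h2 : P ^ 2 * (1 - P) = 4 * X := by linear_combination -hP
    have h3 : 1 - P = 4 * X * Q ^ 2 := by
      rw [← h2]
      linear_combination -(1 - P) * (P * Q + 1) * hQ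
    linear_combination 4 * hv + h3
  refine ⟨1 - 2 * v, h, hh, ?_⟩
  have h4 : h ^ 2 = Q := by
    have h5 : P * h ^ 2 = 1 := by rw [← h1, ← mul_pow, hh, one_pow]
    linear_combination Q * h5 - h ^ 2 * hQ
  rw [show h ^ 4 = (h ^ 2) ^ 2 by ring, h4]
  linear_combination -4 * hv

/-- The ring homomorphism `f(Z) ↦ f(X⁴ / 4)`. -/
def expandFour (F : Type) [Field F] : ℤ⟦X⟧ →+* F⟦X⟧ :=
  ((expand 4 four_ne_zero : F⟦X⟧ →ₐ[F] F⟦X⟧).toRingHom.comp (rescale (1 / 4 : F))).comp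
    (PowerSeries.map (Int.castRingHom F))

variable {F : Type} [Field F]

theorem expandFour_X [CharZero F] : 4 * expandFour F X = X ^ 4 := by
  have h : expandFour F X = expand 4 four_ne_zero (rescale (1 / 4 : F) (PowerSeries.map (Int.castRingHom F) X)) := rfl
  rw [h, map_X, rescale_X, map_mul, expand_X, expand_C, ← map_ofNat C, ← mul_assoc, ← map_mul]
  simp

theorem coeff_expandFour_mul (f : ℤ⟦X⟧) (n : ℕ) :
    coeff (4 * n) (expandFour F f) = (1 / 4) ^ n * (coeff n f : ℤ) := by
  refine (coeff_expand_mul 4 four_ne_zero _ n).trans ?_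
  rw [coeff_rescale, coeff_map]; rfl

theorem coeff_expandFour_of_not_dvd (f : ℤ⟦X⟧) {n : ℕ} (h : ¬ 4 ∣ n) :
    coeff n (expandFour F f) = 0 :=
  coeff_expand_of_not_dvd 4 four_ne_zero _ h

variable {p : ℕ} [hp : Fact p.Prime]

/-- For p = 2 the radius is 2^(-1/2), whose fourth power is 1/4 = |4|. For odd p one has |4| = 1,
and the radius is at most 1. -/
theorem norm_pow_four_div_lt_one {z : ℂ_[p]}
    (hz : ‖z‖ < (p : ℝ) ^ (-(1 / ((p : ℝ) * ((p : ℝ) - 1))))) : ‖1 / 4 * z ^ 4‖ < 1 := by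
  have hp1 : (1 : ℝ) < p := by exact_mod_cast hp.out.one_lt
  have hp0 : (0 : ℝ) < p := by linarith
  have hn : ∀ n : ℕ, ‖(n : ℂ_[p])‖ = ‖(n : ℚ_[p])‖ := fun n => by
    rw [← map_natCast (algebraMap ℚ_[p] ℂ_[p]), norm_algebraMap']
  rcases hp.out.eq_two_or_odd with rfl | hodd
  · have h4 : ‖(4 : ℂ_[2])‖ = 1 / 4 := by
      have h2 : ‖(2 : ℂ_[2])‖ = 1 / 2 := by
        have := hn 2
        rw [Padic.norm_p] at this
        simpa using this
      rw [show (4 : ℂ_[2]) = 2 * 2 by norm_num, norm_mul, h2]; norm_num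
    rw [norm_mul, norm_div, norm_one, h4, norm_pow]
    have h5 : ‖z‖ ^ 4 < ((2 : ℝ) ^ (-(1 / 2) : ℝ)) ^ 4 := by
      refine pow_lt_pow_left₀ ?_ (norm_nonneg _) (by norm_num)
      have h6 : -(1 / (((2 : ℕ) : ℝ) * (((2 : ℕ) : ℝ) - 1))) = -(1 / 2) := by norm_num
      rw [h6, Nat.cast_ofNat] at hz
      exact hz
    rw [← Real.rpow_natCast ((2 : ℝ) ^ (-(1 / 2) : ℝ)), ← Real.rpow_mul (by norm_num)] at h5
    norm_num at h5
    linarith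
  · have h4 : ‖(4 : ℂ_[p])‖ = 1 := by
      have h := hn 4
      have h1 : ‖((4 : ℕ) : ℚ_[p])‖ = 1 := by
        rw [Padic.norm_natCast_eq_one_iff]
        refine (Nat.coprime_primes hp.out Nat.prime_two).2 (by rintro rfl; simp at hodd) |>.pow_right 2
      rw [h1] at h
      simpa using h
    rw [norm_mul, norm_div, norm_one, h4, norm_pow, div_one, one_mul]
    refine pow_lt_one₀ (norm_nonneg _) (hz.trans_le ?_) (by norm_num)
    refine Real.rpow_le_one_of_one_le_of_nonpos hp1.le ?_
    have : 0 ≤ 1 / ((p : ℝ) * ((p : ℝ) - 1)) := by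
      have : 0 < (p : ℝ) - 1 := by linarith
      positivity
    linarith

theorem convergesOnDisc_C (r : ℝ) (c : ℂ_[p]) : ConvergesOnDisc r (C c) := fun z _ => by
  refine summable_of_ne_finset_zero (s := {0}) fun n hn => ?_
  rw [coeff_C, if_neg (by simpa using hn), zero_mul]

theorem IsMeromorphicOnDisc.of_convergesOnDisc {r : ℝ} {g : ℂ_[p]⟦X⟧} (hg : ConvergesOnDisc r g) :
    IsMeromorphicOnDisc r g :=
  ⟨g, 1, hg, by rw [← map_one C]; exact convergesOnDisc_C r 1, one_ne_zero, one_mul g⟩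

/-- Only exponents divisible by 4 occur, and the terms are integers times c(z⁴/4)^n, dominated by a
geometric series. -/
theorem convergesOnDisc_expandFour (σ : F →+* ℂ_[p]) (c : F) (f : ℤ⟦X⟧) :
    ConvergesOnDisc ((p : ℝ) ^ (-(1 / ((p : ℝ) * ((p : ℝ) - 1)))))
      (PowerSeries.map σ (C c * expandFour F f)) := by
  intro z hz
  have hinj : Function.Injective (fun n : ℕ => 4 * n) := fun a b h => by simpa using h
  rw [← hinj.summable_iff]
  · refine Summable.of_norm_bounded (g := fun n => ‖σ c‖ * ‖1 / 4 * z ^ 4‖ ^ n)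
      ((summable_geometric_of_lt_one (norm_nonneg _) (norm_pow_four_div_lt_one hz)).mul_left _) ?_
    intro n
    have h1 : coeff (4 * n) (PowerSeries.map σ (C c * expandFour F f)) * z ^ (4 * n)
        = σ c * (1 / 4 * z ^ 4) ^ n * (coeff n f : ℤ) := by
      rw [coeff_map, coeff_C_mul, coeff_expandFour_mul, map_mul, map_mul, map_pow, map_div₀, map_one,
        map_ofNat, map_intCast, mul_pow, ← pow_mul]
      ring
    have h2 : ‖((coeff n f : ℤ) : ℂ_[p])‖ ≤ 1 := IsUltrametricDist.norm_intCast_le_one _ _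
    rw [Function.comp_apply, h1, norm_mul, norm_mul, norm_pow]
    exact mul_le_of_le_one_right (by positivity) h2
  · intro n hn
    rw [coeff_map, coeff_C_mul, coeff_expandFour_of_not_dvd, mul_zero, map_zero, zero_mul]
    rintro ⟨k, rfl⟩
    exact hn ⟨k, rfl⟩

end Expansion

/-! ### Derivatives of sections of a pullback -/

namespace Connection

section Nabla

open TensorProduct

variable {R A M : Type} [CommRing R] [CommRing A] [Algebra R A] [AddCommGroup M] [Module A M]
variable {R' A' : Type} [CommRing R'] [CommRing A'] [Algebra R' A'] [Algebra R R']
  [Algebra R A'] [Algebra A A'] [IsScalarTower R R' A'] [IsScalarTower R A A']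

/-- The derivative along a derivation `d` of `A'` of sections of the pullback to `A'`. -/
def nabla (c : Connection R A M) (d : Derivation R' A' A') : A' ⊗[A] M →+ A' ⊗[A] M :=
  (TensorProduct.lid A' (A' ⊗[A] M)).toLinearMap.toAddMonoidHom.comp (c.pullback d)

variable (c : Connection R A M) (d : Derivation R' A' A')

theorem nabla_eq_zero_iff (z : A' ⊗[A] M) : c.nabla d z = 0 ↔ c.pullback d z = 0 :=
  (TensorProduct.lid A' (A' ⊗[A] M)).map_eq_zero_iff

theorem nabla_tmul (a : A') (m : M) : c.nabla d (a ⊗ₜ m)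
    = a • LinearMap.rTensor M (diffMap (R := R) (A := A) d) (c.toFun m) + d a ⊗ₜ m := by
  have h : ∀ z : Ω[A⁄R] ⊗[A] M, TensorProduct.lid A' (A' ⊗[A] M) (pullbackAux d z)
      = LinearMap.rTensor M (diffMap (R := R) (A := A) d) z := fun z => by
    induction z using TensorProduct.induction_on with
    | zero => simp
    | add z w hz hw => simp only [map_add, hz, hw]
    | tmul ω m =>
      have h1 : pullbackAux d (ω ⊗ₜ[A] m)
          = diffMap (R := R) (A := A) d ω ⊗ₜ[A'] ((1 : A') ⊗ₜ[A] m) := rfl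
      rw [h1, lid_tmul, LinearMap.rTensor_tmul, smul_tmul', smul_eq_mul, mul_one]
  change TensorProduct.lid A' (A' ⊗[A] M) (c.pullback d (a ⊗ₜ m)) = _
  rw [pullback_tmul, map_add, map_smul, h, lid_tmul, smul_tmul', smul_eq_mul, mul_one]

theorem nabla_smul (a : A') (z : A' ⊗[A] M) :
    c.nabla d (a • z) = a • c.nabla d z + d a • z := by
  induction z using TensorProduct.induction_on with
  | zero => simp
  | add z w hz hw => rw [smul_add, map_add, hz, hw, map_add, smul_add, smul_add]; abel
  | tmul b m =>
    rw [smul_tmul', smul_eq_mul, nabla_tmul, nabla_tmul, Derivation.leibniz, add_tmul, smul_add,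
      smul_smul, smul_tmul', smul_tmul', smul_eq_mul, smul_eq_mul, smul_eq_mul, mul_comm b, add_assoc]

theorem IsHorizontal.nabla_baseChange {M' : Type} [AddCommGroup M'] [Module A M']
    {c : Connection R A M} {c' : Connection R A M'} {h : M →ₗ[A] M'} (hh : c.IsHorizontal c' h)
    (z : A' ⊗[A] M) : c'.nabla d (h.baseChange A' z) = h.baseChange A' (c.nabla d z) := by
  induction z using TensorProduct.induction_on with
  | zero => simp
  | add z w hz hw => simp only [map_add, hz, hw]
  | tmul b m =>
    have h1 : ∀ z : Ω[A⁄R] ⊗[A] M, LinearMap.rTensor M' (diffMap (R := R) (A := A) d)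
        (LinearMap.lTensor (Ω[A⁄R]) h z)
        = h.baseChange A' (LinearMap.rTensor M (diffMap (R := R) (A := A) d) z) := fun z => by
      induction z using TensorProduct.induction_on with
      | zero => simp
      | add z w hz hw => simp only [map_add, hz, hw]
      | tmul ω m => simp
    rw [LinearMap.baseChange_tmul, nabla_tmul, nabla_tmul, hh, h1, map_add, map_smul,
      LinearMap.baseChange_tmul]

theorem IsMultiplicative.nabla_mul {C : Type} [CommRing C] [Algebra A C] {c : Connection R A C}
    (hc : c.IsMultiplicative) (z w : A' ⊗[A] C) :
    c.nabla d (z * w) = z * c.nabla d w + w * c.nabla d z := by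
  have h : ∀ z (u : A' ⊗[A'] (A' ⊗[A] C)), TensorProduct.lid A' (A' ⊗[A] C)
      (LinearMap.lTensor A' (LinearMap.mulLeft A' z) u)
      = z * TensorProduct.lid A' (A' ⊗[A] C) u := fun z u => by
    induction u using TensorProduct.induction_on with
    | zero => simp
    | add u w hz hw => simp only [map_add, hz, hw, mul_add]
    | tmul a u => simp
  change TensorProduct.lid A' (A' ⊗[A] C) (c.pullback d (z * w)) = _
  rw [hc.pullback_mul, map_add, h, h]; rfl

theorem IsMultiplicative.nabla_one {C : Type} [CommRing C] [Algebra A C] {c : Connection R A C}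
    (hc : c.IsMultiplicative) : c.nabla d (1 : A' ⊗[A] C) = 0 := by
  have := hc.nabla_mul d 1 1
  rw [one_mul, one_mul] at this
  exact left_eq_add.1 this

/-- If `s² = g` with `g` in the base, then `2 g ∇ s = dg s`. -/
theorem IsMultiplicative.two_smul_nabla_of_sq {C : Type} [CommRing C] [Algebra A C]
    {c : Connection R A C} (hc : c.IsMultiplicative) {s : A' ⊗[A] C} {g : A'}
    (h : s * s = algebraMap A' _ g) : (2 * g) • c.nabla d s = d g • s := by
  have h1 : c.nabla d (s * s) = algebraMap A' _ (d g) := by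
    rw [h, Algebra.algebraMap_eq_smul_one, nabla_smul, hc.nabla_one, smul_zero, zero_add,
      Algebra.algebraMap_eq_smul_one]
  rw [hc.nabla_mul] at h1
  rw [Algebra.smul_def, Algebra.smul_def, ← h1, map_mul, ← h, map_ofNat]
  ring

end Nabla

end Connection

namespace Cover

variable {A B : Type} [CommRing A] [CommRing B] [Algebra A B] {x y : A} (A' : Type) [CommRing A']
  [Algebra A A']

/-- Over a ring in which `x² - 1` is invertible, the covering is given by adjoining a square root. -/
def tensorEquivQuadratic (hxy : y ^ 2 = x * (x ^ 2 - 1)) (hg : IsUnit (algebraMap A A' x ^ 2 - 1))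
    (e : Cover A x y ≃ₐ[A] B) : A' ⊗[A] B ≃ₐ[A'] QuadraticAlgebra A' (algebraMap A A' x ^ 2 - 1) 0 :=
  (Algebra.TensorProduct.congr AlgEquiv.refl e.symm).trans
    ((Cover.baseChange A' x y rfl rfl).trans
      (Cover.equivQuadratic (by rw [← map_pow, hxy, map_mul, map_sub, map_pow, map_one]) hg))

variable {A'} (hxy : y ^ 2 = x * (x ^ 2 - 1)) (hg : IsUnit (algebraMap A A' x ^ 2 - 1))
  (e : Cover A x y ≃ₐ[A] B)

theorem tensorEquivQuadratic_s :
    tensorEquivQuadratic A' hxy hg e (1 ⊗ₜ e s) = QuadraticAlgebra.omega := by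
  have h : Algebra.TensorProduct.congr (AlgEquiv.refl (R := A') (A₁ := A')) e.symm (1 ⊗ₜ e s)
      = 1 ⊗ₜ s := by simp
  rw [tensorEquivQuadratic, AlgEquiv.trans_apply, AlgEquiv.trans_apply, h, baseChange_s,
    equivQuadratic_s]

/-- The basis of the covering that consists of `1` and a square root of `x² - 1`. -/
def tensorBasis : Module.Basis (Fin 2) A' (A' ⊗[A] B) :=
  (QuadraticAlgebra.basis _ _).map (tensorEquivQuadratic A' hxy hg e).symm.toLinearEquiv

theorem tensorBasis_zero : tensorBasis hxy hg e 0 = 1 ⊗ₜ 1 := by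
  rw [tensorBasis, Module.Basis.map_apply]
  refine (tensorEquivQuadratic A' hxy hg e).symm_apply_eq.2 ?_
  rw [← Algebra.TensorProduct.one_def, map_one]
  refine (QuadraticAlgebra.basis _ _).repr.injective ?_
  ext i
  fin_cases i <;> simp [QuadraticAlgebra.re_one, QuadraticAlgebra.im_one]

theorem tensorBasis_one : tensorBasis hxy hg e 1 = 1 ⊗ₜ e s := by
  rw [tensorBasis, Module.Basis.map_apply]
  refine (tensorEquivQuadratic A' hxy hg e).symm_apply_eq.2 ?_
  rw [tensorEquivQuadratic_s]
  refine (QuadraticAlgebra.basis _ _).repr.injective ?_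
  ext i
  fin_cases i <;> simp

theorem tmul_s_mul_tmul_s : ((1 : A') ⊗ₜ[A] e s) * (1 ⊗ₜ e s)
    = algebraMap A' _ (algebraMap A A' x ^ 2 - 1) := by
  rw [Algebra.TensorProduct.tmul_mul_tmul, ← map_mul, ← pow_two s, s_sq, AlgEquiv.commutes, mul_one,
    Algebra.TensorProduct.algebraMap_apply, Algebra.algebraMap_self_apply]
  rw [← map_one (algebraMap A A'), ← map_pow, ← map_sub, Algebra.algebraMap_eq_smul_one (A := B),
    ← TensorProduct.smul_tmul, map_one, Algebra.algebraMap_eq_smul_one]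

end Cover

/-! ### Formal horizontal sections -/

/-- In the basis 1, s one has ∇1 = 0 and 2g∇s = dg·s with g = x² - 1; the equations are the
coordinates of 2g∇z = 0. -/
theorem Cover.eq_zero_of_nabla_eq_zero {R A B R' A' : Type} [CommRing R] [CommRing A]
    [Algebra R A] [CommRing B] [Algebra A B] [CommRing R'] [CommRing A'] [Algebra R' A']
    [Algebra R R'] [Algebra R A'] [Algebra A A'] [IsScalarTower R R' A'] [IsScalarTower R A A']
    (h2' : IsUnit (2 : A')) {x y : A} (hxy : y ^ 2 = x * (x ^ 2 - 1)) (hg : IsUnit (algebraMap A A' x ^ 2 - 1))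
    (e : Cover A x y ≃ₐ[A] B) {c : Connection R A B} (hc : c.IsMultiplicative)
    (d : Derivation R' A' A') {z : A' ⊗[A] B} (hz : c.nabla d z = 0) :
    d ((tensorBasis hxy hg e).repr z 0) = 0 ∧
      2 * (algebraMap A A' x ^ 2 - 1) * d ((tensorBasis hxy hg e).repr z 1)
        + (tensorBasis hxy hg e).repr z 1 * d (algebraMap A A' x ^ 2 - 1) = 0 := by
  let b := tensorBasis hxy hg e
  set g := algebraMap A A' x ^ 2 - 1 with hgdef
  set f₁ := b.repr z 0 with hf₁
  set f₂ := b.repr z 1 with hf₂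
  have hb0 : c.nabla d (b 0) = 0 := by
    rw [tensorBasis_zero, ← Algebra.TensorProduct.one_def, hc.nabla_one]
  have hb1 : (2 * g) • c.nabla d (b 1) = d g • b 1 := by
    have h := tmul_s_mul_tmul_s (A' := A') e
    rw [← tensorBasis_one hxy hg e] at h
    exact hc.two_smul_nabla_of_sq d h
  have h1 : z = f₁ • b 0 + f₂ • b 1 := by
    rw [← Fin.sum_univ_two (fun i => b.repr z i • b i), b.sum_repr]
  have h2 : (2 * g * d f₁) • b 0 + (2 * g * d f₂ + f₂ * d g) • b 1 = 0 := by
    have h3 : (2 * g) • c.nabla d z = 0 := by rw [hz, smul_zero]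
    rw [h1, map_add, Connection.nabla_smul, Connection.nabla_smul, hb0, smul_zero, zero_add,
      smul_add, smul_add, smul_comm (2 * g) f₂, hb1] at h3
    rw [← h3]
    module
  have h3 := congrArg b.repr h2
  rw [map_add, map_smul, map_smul, b.repr_self, b.repr_self, map_zero] at h3
  have e0 := DFunLike.congr_fun h3 0
  have e1 := DFunLike.congr_fun h3 1
  simp only [Finsupp.add_apply, Finsupp.smul_apply, Finsupp.single_apply, smul_eq_mul,
    Finsupp.zero_apply, if_true, zero_ne_one, one_ne_zero, if_false, mul_one, mul_zero, add_zero,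
    zero_add] at e0 e1
  exact ⟨(IsUnit.mul_right_eq_zero (h2'.mul hg)).1 e0, e1⟩

section Formal

open PowerSeries

variable {K B : Type} [Field K] [CommRing B] [Algebra (XRing K) B] [Algebra K B]
  [IsScalarTower K (XRing K) B] [Algebra.Etale (XRing K) B]

theorem eval₂_curve_polynomial_eq_zero {S : Type} [CommRing S] [Algebra K S] {x y : S}
    (h : y ^ 2 = x ^ 3 - x) :
    (curve K).toAffine.polynomial.eval₂ (Polynomial.eval₂RingHom (algebraMap K S) x) y = 0 := by
  refine (congrArg (Polynomial.eval₂ _ _) (curve_polynomial K)).trans ?_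
  simp only [map_sub, map_pow, Polynomial.eval₂_sub, Polynomial.eval₂_pow, Polynomial.eval₂_X,
    Polynomial.eval₂_C, Polynomial.coe_eval₂RingHom, h, sub_self]

/-- The homomorphism from the coordinate ring of `X` that is given by a point of `X`. -/
def XRing.lift {S : Type} [CommRing S] [Algebra K S] (x y : S) (h : y ^ 2 = x ^ 3 - x) :
    XRing K →ₐ[K] S where
  __ := AdjoinRoot.lift (Polynomial.eval₂RingHom (algebraMap K S) x) y
    (eval₂_curve_polynomial_eq_zero h)
  commutes' r := by
    have h' : algebraMap K (XRing K) r = AdjoinRoot.of _ (Polynomial.C r) := rfl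
    change AdjoinRoot.lift _ _ (eval₂_curve_polynomial_eq_zero h) _ = _
    rw [h', AdjoinRoot.lift_of]
    simp

theorem XRing.lift_xX {S : Type} [CommRing S] [Algebra K S] {x y : S} (h : y ^ 2 = x ^ 3 - x) :
    XRing.lift (K := K) x y h (xX K) = x := by
  change AdjoinRoot.lift _ _ (eval₂_curve_polynomial_eq_zero h) _ = _
  simp [xX]

theorem XRing.lift_yX {S : Type} [CommRing S] [Algebra K S] {x y : S} (h : y ^ 2 = x ^ 3 - x) :
    XRing.lift (K := K) x y h (yX K) = y := by
  change AdjoinRoot.lift _ _ (eval₂_curve_polynomial_eq_zero h) _ = _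
  simp [yX]

theorem eq_C_of_derivative_eq_zero [CharZero K] {f : K⟦X⟧} (h : derivative K f = 0) :
    f = C (constantCoeff f) :=
  derivative.ext (by rw [h, derivative_C]) (by simp)

/-- A horizontal section has coordinates a constant and a constant times h = 1/√(1 - x²); both
converge on the disc, so no denominator is needed. -/
theorem formalSectionsMeromorphic [CharZero K]
    (e : Cover (XRing K) (xX K) (yX K) ≃ₐ[XRing K] B) :
    FormalSectionsMeromorphic (Connection.pushforwardTrivial K (XRing K) B) := by
  obtain ⟨q₀, h₀, hqh₀, hq₀⟩ := exists_integral_series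
  set q : K⟦X⟧ := expandFour K q₀
  set h : K⟦X⟧ := expandFour K h₀ with hh
  have hqh : q * h = 1 := by rw [← map_mul, hqh₀, map_one]
  have hq : 1 - q ^ 2 = X ^ 4 * h ^ 4 := by
    have := congrArg (expandFour K) hq₀
    rw [map_sub, map_one, map_pow, map_mul, map_mul, map_pow, map_ofNat, ← mul_assoc,
      expandFour_X] at this
    exact this
  have hx : (X : K⟦X⟧) ^ 2 = (-(X ^ 2 * h ^ 2)) ^ 3 - -(X ^ 2 * h ^ 2) := by
    linear_combination -X ^ 2 * h ^ 2 * hq - X ^ 2 * (q * h + 1) * hqh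
  let ι : XRing K →ₐ[K] K⟦X⟧ := XRing.lift (-(X ^ 2 * h ^ 2)) X hx
  refine ⟨ι, XRing.lift_yX hx, by rw [XRing.lift_xX hx]; simp, ?_⟩
  let _ : Algebra (XRing K) K⟦X⟧ := ι.toRingHom.toAlgebra
  have : IsScalarTower K (XRing K) K⟦X⟧ := .of_algebraMap_eq fun r => (ι.commutes r).symm
  have hιx : algebraMap (XRing K) K⟦X⟧ (xX K) = -(X ^ 2 * h ^ 2) := XRing.lift_xX hx
  have hgq : algebraMap (XRing K) K⟦X⟧ (xX K) ^ 2 - 1 = -q ^ 2 := by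
    rw [hιx]; linear_combination -hq
  have hqu : IsUnit q := .of_mul_eq_one _ hqh
  have hg : IsUnit (algebraMap (XRing K) K⟦X⟧ (xX K) ^ 2 - 1) := by
    rw [hgq]; exact (hqu.pow 2).neg
  have h2 : IsUnit (2 : K⟦X⟧) := by
    rw [← map_ofNat C]; exact (IsUnit.mk0 _ two_ne_zero).map C
  refine ⟨2, Cover.tensorBasis (yX_sq_eq K) hg e, ?_, ?_⟩
  · intro i
    fin_cases i
    · exact ⟨1, Cover.tensorBasis_zero _ hg e⟩
    · exact ⟨e Cover.s, Cover.tensorBasis_one _ hg e⟩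
  · intro z hz i p _ σ
    rw [← Connection.nabla_eq_zero_iff] at hz
    obtain ⟨e0, e1⟩ := Cover.eq_zero_of_nabla_eq_zero h2 (yX_sq_eq K) hg e
      Connection.pushforwardTrivial_isMultiplicative (derivative K) hz
    refine .of_convergesOnDisc ?_
    fin_cases i
    · change ConvergesOnDisc _ (PowerSeries.map σ
        ((Cover.tensorBasis (yX_sq_eq K) hg e).repr z 0))
      rw [eq_C_of_derivative_eq_zero e0, map_C]
      exact convergesOnDisc_C _ _
    · change ConvergesOnDisc _ (PowerSeries.map σ
        ((Cover.tensorBasis (yX_sq_eq K) hg e).repr z 1))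
      set f := (Cover.tensorBasis (yX_sq_eq K) hg e).repr z 1
      -- With g = -q² the equation 2gf' + fg' = 0 reads -2q(qf)' = 0.
      have h3 : derivative K (q * f) = 0 := by
        rw [hgq, Derivation.map_neg, Derivation.leibniz_pow] at e1
        rw [Derivation.leibniz]
        simp only [smul_eq_mul, nsmul_eq_mul, Nat.cast_ofNat, Nat.add_one_sub_one, pow_one] at e1 ⊢
        refine (IsUnit.mul_right_eq_zero (h2.mul hqu)).1 ?_
        linear_combination -e1
      have h4 : f = C (constantCoeff (q * f)) * h := by
        rw [← eq_C_of_derivative_eq_zero h3]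
        linear_combination -f * hqh
      rw [h4]
      exact convergesOnDisc_expandFour σ _ h₀

end Formal

/-! ### A derivation of the function field -/

section FunctionFieldDerivation

open TrivSqZeroExt

variable (K : Type) [Field K]

/-- The vector field x ↦ 2y, y ↦ 3x² - 1 is tangent to the curve, that is, it gives a point with
values in the dual numbers; the derivation is read off from this point. -/
theorem tangent_equation : (inl (yF K) + inr (3 * xF K ^ 2 - 1) : TrivSqZeroExt (XField K) (XField K)) ^ 2
    = (inl (xF K) + inr (2 * yF K)) ^ 3 - (inl (xF K) + inr (2 * yF K)) := by
  have h := yF_sq_eq K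
  ext
  · simp only [fst_pow, fst_add, fst_inl, fst_inr, add_zero, fst_sub]
    rw [h]; ring
  · simp [snd_pow, pow_two]
    ring

/-- The ring homomorphism to the dual numbers given by the invariant vector field. -/
def tangentRing : XRing K →ₐ[K] TrivSqZeroExt (XField K) (XField K) :=
  XRing.lift _ _ (tangent_equation K)

variable {K}

theorem XRing.algHom_ext {S : Type} [CommRing S] [Algebra K S] {f g : XRing K →ₐ[K] S}
    (hx : f (xX K) = g (xX K)) (hy : f (yX K) = g (yX K)) : f = g := by
  refine AlgHom.ext fun a => ?_
  obtain ⟨p, q, rfl⟩ := WeierstrassCurve.Affine.CoordinateRing.exists_smul_basis_eq a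
  have h : ∀ p : K[X], f (algebraMap K[X] (XRing K) p) = g (algebraMap K[X] (XRing K) p) := by
    intro p
    rw [algebraMap_polynomial_eq_aeval, ← Polynomial.aeval_algHom_apply,
      ← Polynomial.aeval_algHom_apply, hx]
  change f (p • 1 + q • yX K) = g (p • 1 + q • yX K)
  rw [Algebra.smul_def, Algebra.smul_def, map_add, map_add, map_mul, map_mul, map_mul, map_mul, h, h,
    hy, map_one, map_one]

theorem fst_tangentRing (a : XRing K) : (tangentRing K a).fst = algebraMap (XRing K) (XField K) a := by
  have h : (fstHom K (XField K) (XField K)).comp (tangentRing K)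
      = (Algebra.algHom K (XRing K) (XField K)) := by
    refine XRing.algHom_ext ?_ ?_
    · simp [tangentRing, XRing.lift_xX]; rfl
    · simp [tangentRing, XRing.lift_yX]; rfl
  exact DFunLike.congr_fun h a

variable (K) in
/-- The extension of `tangentRing` to the function field. -/
def tangentField : XField K →+* TrivSqZeroExt (XField K) (XField K) :=
  IsLocalization.lift (M := nonZeroDivisors (XRing K)) (g := (tangentRing K).toRingHom) (by
    intro a
    refine isUnit_iff_isUnit_fst.2 ?_
    change IsUnit (tangentRing K a).fst
    rw [fst_tangentRing]
    exact IsLocalization.map_units _ a)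

theorem tangentField_algebraMap (a : XRing K) :
    tangentField K (algebraMap (XRing K) (XField K) a) = tangentRing K a :=
  IsLocalization.lift_eq _ a

theorem fst_tangentField (z : XField K) : (tangentField K z).fst = z := by
  have h : (fstHom K (XField K) (XField K)).toRingHom.comp (tangentField K) = RingHom.id _ := by
    refine IsLocalization.ringHom_ext (nonZeroDivisors (XRing K)) ?_
    refine RingHom.ext fun a => ?_
    change (tangentField K (algebraMap _ _ a)).fst = _
    rw [tangentField_algebraMap, fst_tangentRing]; rfl
  exact DFunLike.congr_fun h z

variable (K) in
/-- The invariant derivation of the function field: `x ↦ 2 y`, `y ↦ 3 x² - 1`. -/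
def invDeriv : Derivation K (XField K) (XField K) :=
  Derivation.mk'
    { toFun := fun z => (tangentField K z).snd
      map_add' := fun z w => by rw [map_add, snd_add]
      map_smul' := fun k z => by
        rw [Algebra.smul_def, map_mul, IsScalarTower.algebraMap_apply K (XRing K) (XField K),
          tangentField_algebraMap, AlgHom.commutes, snd_mul]
        simp [algebraMap_eq_inl', Algebra.smul_def] }
    (by
      intro z w
      simp [snd_mul, fst_tangentField, mul_comm])

theorem invDeriv_xF : invDeriv K (xF K) = 2 * yF K := by
  change (tangentField K (algebraMap _ _ (xX K))).snd = _
  rw [tangentField_algebraMap, tangentRing, XRing.lift_xX]; simp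

theorem invDeriv_yF : invDeriv K (yF K) = 3 * xF K ^ 2 - 1 := by
  change (tangentField K (algebraMap _ _ (yX K))).snd = _
  rw [tangentField_algebraMap, tangentRing, XRing.lift_yX]; simp

theorem yF_ne_zero : yF K ≠ 0 := by
  intro h
  have := ratMap_add_eq_zero (K := K) (a := 0) (b := 1) (by rw [h]; simp)
  exact one_ne_zero this.2

variable [CharZero K]

/-- By the chain rule the derivative of a(x) is 2y times its derivative in x. If it vanishes, so
does the Wronskian of the coprime numerator and denominator, and in characteristic zero both are
constant. -/
theorem exists_invDeriv_ratMap (a : RatFunc K) : ∃ a', invDeriv K (ratMap K a) = ratMap K a' * yF K ∧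
    (a' = 0 → ∃ k, a = algebraMap K _ k) := by
  have ha := RatFunc.num_div_denom a
  have hd : algebraMap K[X] (RatFunc K) a.denom ≠ 0 := by simpa using RatFunc.denom_ne_zero a
  have hd' : Polynomial.aeval (xF K) a.denom ≠ 0 := by
    rw [← ratMap_algebraMap]; exact (map_ne_zero_iff _ ratMap_injective).2 hd
  have hpoly : ∀ p : K[X], invDeriv K (Polynomial.aeval (xF K) p)
      = Polynomial.aeval (xF K) (Polynomial.derivative p) * (2 * yF K) := fun p => by
    rw [← invDeriv_xF, Derivation.map_aeval, smul_eq_mul]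
  have h1 : ratMap K a * Polynomial.aeval (xF K) a.denom = Polynomial.aeval (xF K) a.num := by
    rw [← ratMap_algebraMap, ← ratMap_algebraMap, ← map_mul, eq_comm, ← (div_eq_iff hd).1 ha]
  refine ⟨2 * algebraMap K[X] _ (Polynomial.derivative a.num * a.denom
    - a.num * Polynomial.derivative a.denom) / algebraMap K[X] _ a.denom ^ 2, ?_, ?_⟩
  · have h2 := congrArg (invDeriv K) h1
    rw [Derivation.leibniz, hpoly, hpoly, smul_eq_mul, smul_eq_mul] at h2
    rw [map_div₀, map_pow, map_mul, map_ofNat, ratMap_algebraMap, ratMap_algebraMap, map_sub, map_mul,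
      map_mul, ← h1]
    field_simp
    linear_combination h2
  · intro h0
    rw [div_eq_zero_iff, or_iff_left (pow_ne_zero _ hd), mul_eq_zero, or_iff_right two_ne_zero,
      map_eq_zero_iff _ (IsFractionRing.injective K[X] (RatFunc K))] at h0
    have hw : Polynomial.wronskian a.num a.denom = 0 := by
      rw [Polynomial.wronskian]; linear_combination -h0
    obtain ⟨e1, e2⟩ := (RatFunc.isCoprime_num_denom a).wronskian_eq_zero_iff.1 hw
    rw [Polynomial.derivative_eq_zero, Polynomial.natDegree_eq_zero] at e1 e2
    obtain ⟨k, hk⟩ := e1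
    obtain ⟨l, hl⟩ := e2
    refine ⟨k / l, ?_⟩
    rw [← ha, ← hk, ← hl, map_div₀, IsScalarTower.algebraMap_apply K K[X] (RatFunc K),
      IsScalarTower.algebraMap_apply K K[X] (RatFunc K)]
    rfl

/-- The derivation exchanges K(x) and K(x)y, so a and by are killed separately. Then a is constant,
and so is (by)² = b²(x³ - x), which has odd degree unless b = 0. -/
theorem exists_eq_of_invDeriv_eq_zero {c : XField K} (hc : invDeriv K c = 0) :
    ∃ k, c = algebraMap K _ k := by
  obtain ⟨a, b, rfl⟩ := exists_eq_ratMap_add c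
  obtain ⟨a', ha', ha⟩ := exists_invDeriv_ratMap a
  obtain ⟨b', hb', -⟩ := exists_invDeriv_ratMap b
  have h1 : ratMap K (b' * (RatFunc.X ^ 3 - RatFunc.X) + b * (3 * RatFunc.X ^ 2 - 1))
      + ratMap K a' * yF K = ratMap K 0 + ratMap K 0 * yF K := by
    rw [map_add, Derivation.leibniz, ha', hb', smul_eq_mul, smul_eq_mul, invDeriv_yF] at hc
    simp only [map_add, map_mul, map_sub, map_pow, ratMap_X, map_one, map_ofNat, map_zero]
    linear_combination hc - ratMap K b' * yF_sq_eq K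
  obtain ⟨h2, h3⟩ := ratMap_add_inj h1
  obtain ⟨k, rfl⟩ := ha h3
  obtain ⟨z', hz', hz⟩ := exists_invDeriv_ratMap (b ^ 2 * (RatFunc.X ^ 3 - RatFunc.X))
  have h4 : z' = 0 := by
    have e1 : invDeriv K (ratMap K b * yF K) = 0 := by
      rw [map_add, ← algebraMap_eq_ratMap, Derivation.map_algebraMap, zero_add] at hc
      exact hc
    rw [map_mul, ← yF_sq_eq_ratMap, map_pow, ← mul_pow, Derivation.leibniz_pow, e1, smul_zero,
      nsmul_zero] at hz'
    have := (mul_eq_zero.1 hz'.symm).resolve_right yF_ne_zero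
    exact (map_eq_zero_iff _ ratMap_injective).1 this
  obtain ⟨l, hl⟩ := hz h4
  have hb : b = 0 := by
    by_contra hb
    have hX : (RatFunc.X ^ 3 - RatFunc.X : RatFunc K)
        = algebraMap K[X] _ (Polynomial.X ^ 3 - Polynomial.X) := by simp
    have hX0 : (RatFunc.X ^ 3 - RatFunc.X : RatFunc K) ≠ 0 := by
      rw [hX, Ne, map_eq_zero_iff _ (IsFractionRing.injective K[X] (RatFunc K))]
      exact squarefree_X_cubed_sub_X.ne_zero
    have hXd : (RatFunc.X ^ 3 - RatFunc.X : RatFunc K).intDegree = 3 := by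
      have hd : (Polynomial.X ^ 3 - Polynomial.X : K[X]).natDegree = 3 := by compute_degree!
      rw [hX, RatFunc.intDegree_polynomial, hd]; rfl
    have h5 := congrArg RatFunc.intDegree hl
    rw [RatFunc.intDegree_mul (pow_ne_zero _ hb) hX0, pow_two, RatFunc.intDegree_mul hb hb, hXd,
      RatFunc.algebraMap_eq_C, RatFunc.intDegree_C] at h5
    omega
  exact ⟨k, by rw [hb, map_zero, zero_mul, add_zero, algebraMap_eq_ratMap]⟩

variable (K) in
/-- The function `x² - 1`. -/
def gF : XField K := xF K ^ 2 - 1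

theorem gF_ne_zero : gF K ≠ 0 := by
  intro h
  refine not_isSquare_mul_X_sq_sub_one (K := K) one_ne_zero 0 ?_
  rw [gF] at h
  rw [h, mul_zero, zero_pow two_ne_zero]

variable (K) in
/-- Half the logarithmic derivative of `x² - 1`. -/
def halfLogDeriv : XField K := invDeriv K (gF K) / (2 * gF K)

theorem invDeriv_gF : invDeriv K (gF K) = 2 * halfLogDeriv K * gF K := by
  have := gF_ne_zero (K := K)
  have h2 : (2 : XField K) ≠ 0 := by
    rw [← map_ofNat (algebraMap K (XField K))]; simp
  rw [halfLogDeriv]; field_simp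

theorem invDeriv_inv_gF : invDeriv K (gF K)⁻¹ = -2 * halfLogDeriv K * (gF K)⁻¹ := by
  have := gF_ne_zero (K := K)
  rw [Derivation.leibniz_inv, invDeriv_gF, smul_eq_mul]
  field_simp

/-- c²/g has derivative zero, so c² is a constant times g, which is impossible for c ≠ 0. This is
what makes the Galois group nontrivial. -/
theorem eq_zero_of_invDeriv_eq {c : XField K} (hc : invDeriv K c = halfLogDeriv K * c) : c = 0 := by
  have h1 : invDeriv K (c ^ 2 * (gF K)⁻¹) = 0 := by
    rw [Derivation.leibniz, Derivation.leibniz_pow, invDeriv_inv_gF, hc]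
    simp only [smul_eq_mul, nsmul_eq_mul, Nat.cast_ofNat, Nat.add_one_sub_one, pow_one]
    ring
  obtain ⟨k, hk⟩ := exists_eq_of_invDeriv_eq_zero h1
  rw [mul_inv_eq_iff_eq_mul₀ gF_ne_zero] at hk
  by_contra h0
  refine not_isSquare_mul_X_sq_sub_one (k := k) ?_ c hk
  rintro rfl
  rw [map_zero, zero_mul] at hk
  exact h0 ((pow_eq_zero_iff two_ne_zero).1 hk)

theorem eq_zero_of_invDeriv_eq_neg {c : XField K} (hc : invDeriv K c = -halfLogDeriv K * c) :
    c = 0 := by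
  have h1 : invDeriv K (c * gF K) = halfLogDeriv K * (c * gF K) := by
    rw [Derivation.leibniz, invDeriv_gF, hc, smul_eq_mul, smul_eq_mul]; ring
  exact (mul_eq_zero.1 (eq_zero_of_invDeriv_eq h1)).resolve_right gF_ne_zero

end FunctionFieldDerivation

/-! ### Differential modules over the function field -/

section DifferentialModules

variable {K : Type} [Field K]
variable {E E' : Type*} [AddCommGroup E] [Module (XField K) E] [AddCommGroup E']
  [Module (XField K) E']

/-- An additive endomorphism that satisfies the Leibniz rule for the invariant derivation. -/
def IsDifferential (K : Type) [Field K] {E : Type*} [AddCommGroup E] [Module (XField K) E]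
    (N : E →+ E) : Prop :=
  ∀ (c : XField K) (v : E), N (c • v) = c • N v + invDeriv K c • v

/-- The solutions of `∇ v = 0` and of `∇ v = (dg / 2 g) v` for `g = x² - 1`. -/
def solutions (K : Type) [Field K] {E : Type*} [AddCommGroup E] [Module (XField K) E]
    (N : E →+ E) : Set E :=
  {v | N v = 0 ∨ N v = halfLogDeriv K • v}

theorem mem_solutions_of_eq_smul {N : E →+ E} {m : XField K} {v : E} (hm : m = 0 ∨ m = halfLogDeriv K)
    (h : N v = m • v) : v ∈ solutions K N := by
  rcases hm with rfl | rfl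
  · exact .inl (by rw [h, zero_smul])
  · exact .inr h

theorem exists_eq_smul_of_mem_solutions {N : E →+ E} {v : E} (h : v ∈ solutions K N) :
    ∃ m : XField K, (m = 0 ∨ m = halfLogDeriv K) ∧ N v = m • v := by
  rcases h with h | h
  · exact ⟨0, .inl rfl, by rw [h, zero_smul]⟩
  · exact ⟨_, .inr rfl, h⟩

theorem IsDifferential.map_linearCombination {N : E →+ E} (hN : IsDifferential K N) {ι : Type*}
    {b : ι → E} {m : ι → XField K} (hb : ∀ i, N (b i) = m i • b i) (c : ι →₀ XField K) :
    N (Finsupp.linearCombination _ b c)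
      = c.sum fun i a => (m i * a + invDeriv K a) • b i := by
  rw [Finsupp.linearCombination_apply, Finsupp.sum, Finsupp.sum, map_sum]
  refine Finset.sum_congr rfl fun i _ => ?_
  rw [hN, hb, smul_smul, ← add_smul, mul_comm]

/-- The coefficients of a solution with respect to linearly independent solutions. -/
theorem IsDifferential.invDeriv_coeff {N : E →+ E} (hN : IsDifferential K N)
    {W : Submodule (XField K) E}
    (hW : ∀ w ∈ W, N w ∈ W) {ι : Type*} {b : ι → E} {m : ι → XField K}
    (hb : ∀ i, N (b i) = m i • b i) (hli : LinearIndependent (XField K) (W.mkQ ∘ b))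
    {c : ι →₀ XField K} {n : XField K} {v : E} (hv : N v = n • v)
    (hvc : v - Finsupp.linearCombination _ b c ∈ W) (i : ι) :
    invDeriv K (c i) = (n - m i) * c i := by
  have h1 := hW _ hvc
  -- Applying ∇ - n to v - Σ cᵢbᵢ stays in W and kills v; the bᵢ are independent modulo W, so each
  -- coefficient of the rest vanishes.
  have h2 := W.sub_mem h1 (W.smul_mem n hvc)
  have h3 : (N (v - Finsupp.linearCombination _ b c) - n • (v - Finsupp.linearCombination _ b c))
      = - Finsupp.linearCombination _ b (Finsupp.onFinset c.support
        (fun i => m i * c i + invDeriv K (c i) - n * c i) (fun i hi => by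
          rw [Finsupp.mem_support_iff]
          intro h0
          apply hi
          rw [h0, mul_zero, mul_zero, map_zero, add_zero, sub_zero])) := by
    rw [map_sub, hN.map_linearCombination hb, hv, smul_sub, Finsupp.linearCombination_apply,
      Finsupp.linearCombination_apply, Finsupp.sum, Finsupp.smul_sum, Finsupp.sum, Finsupp.onFinset_sum,
      Finset.sum_congr rfl fun i _ => sub_smul _ _ _, Finset.sum_sub_distrib]
    · simp only [smul_smul]
      abel
    · intro i; rw [zero_smul]
  rw [h3, neg_mem_iff, ← Submodule.Quotient.mk_eq_zero, ← Submodule.mkQ_apply,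
    Finsupp.apply_linearCombination] at h2
  have h4 := DFunLike.congr_fun (linearIndependent_iff.1 hli _ h2) i
  rw [Finsupp.onFinset_apply, Finsupp.zero_apply] at h4
  linear_combination h4

/-- A stable subspace of a differential module that is spanned by solutions is spanned by
solutions. -/
theorem IsDifferential.le_span_solutions {N : E →+ E} (hN : IsDifferential K N)
    (hS : Submodule.span (XField K) (solutions K N) = ⊤) {W : Submodule (XField K) E}
    (hW : ∀ w ∈ W, N w ∈ W) : W ≤ Submodule.span (XField K) (solutions K N ∩ W) := by
  -- Solutions whose classes form a basis of E/W; a complement to W is built from them.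
  obtain ⟨q, hq, hqs, hli⟩ := exists_linearIndependent (XField K) (W.mkQ '' solutions K N)
  choose b hbS hbq using fun i : q => hq i.2
  choose m hm hbm using fun i : q => exists_eq_smul_of_mem_solutions (hbS i)
  have hcomp : W.mkQ ∘ b = Subtype.val := funext hbq
  have hli' : LinearIndependent (XField K) (W.mkQ ∘ b) := by rw [hcomp]; exact hli
  -- The coefficients of a solution modulo W have exactly the derivatives that make Σ cᵢbᵢ satisfy
  -- the same equation, so the difference is again a solution, now inside W.
  have hsol : ∀ h ∈ solutions K N, ∃ c : q →₀ XField K,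
      h - Finsupp.linearCombination _ b c
        ∈ Submodule.span (XField K) (solutions K N ∩ W) := by
    intro h hh
    obtain ⟨n, hn, hhn⟩ := exists_eq_smul_of_mem_solutions hh
    have h1 : W.mkQ h ∈ Submodule.span (XField K) (Set.range (Subtype.val : q → E ⧸ W)) := by
      rw [Subtype.range_coe, hqs]
      exact Submodule.subset_span ⟨h, hh, rfl⟩
    obtain ⟨c, hc⟩ := (Finsupp.mem_span_range_iff_exists_finsupp).1 h1
    have hW' : h - Finsupp.linearCombination _ b c ∈ W := by
      rw [← Submodule.Quotient.mk_eq_zero, ← Submodule.mkQ_apply, map_sub,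
        Finsupp.apply_linearCombination, hcomp, Finsupp.linearCombination_apply, hc, sub_self]
    have hcoef := hN.invDeriv_coeff hW hbm hli' hhn hW'
    refine ⟨c, Submodule.subset_span ⟨mem_solutions_of_eq_smul hn ?_, hW'⟩⟩
    rw [map_sub, hN.map_linearCombination hbm, hhn, smul_sub, Finsupp.linearCombination_apply,
      Finsupp.smul_sum]
    congr 1
    refine Finset.sum_congr rfl fun i _ => ?_
    simp only [hcoef, smul_smul]
    congr 1
    ring
  have hall : ∀ v : E, ∃ c : q →₀ XField K,
      v - Finsupp.linearCombination _ b c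
        ∈ Submodule.span (XField K) (solutions K N ∩ W) := by
    intro v
    have hv : v ∈ Submodule.span (XField K) (solutions K N) := by rw [hS]; trivial
    induction hv using Submodule.span_induction with
    | mem h hh => exact hsol h hh
    | zero => exact ⟨0, by rw [map_zero, sub_zero]; exact zero_mem _⟩
    | add v w _ _ hv hw =>
      obtain ⟨c, hc⟩ := hv
      obtain ⟨c', hc'⟩ := hw
      refine ⟨c + c', ?_⟩
      rw [map_add, add_sub_add_comm]
      exact add_mem hc hc'
    | smul a v _ hv =>
      obtain ⟨c, hc⟩ := hv
      refine ⟨a • c, ?_⟩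
      rw [map_smul, ← smul_sub]
      exact Submodule.smul_mem _ _ hc
  intro w hw
  obtain ⟨c, hc⟩ := hall w
  have hle : Submodule.span (XField K) (solutions K N ∩ W) ≤ W :=
    Submodule.span_le.2 Set.inter_subset_right
  have h1 := W.sub_mem hw (hle hc)
  rw [sub_sub_cancel, ← Submodule.Quotient.mk_eq_zero, ← Submodule.mkQ_apply,
    Finsupp.apply_linearCombination] at h1
  rwa [linearIndependent_iff.1 hli' _ h1, map_zero, sub_zero] at hc

theorem IsDifferential.span_solutions_of_injective {N : E →+ E} (hN : IsDifferential K N)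
    (hS : Submodule.span (XField K) (solutions K N) = ⊤) {N' : E' →+ E'} (j : E' →ₗ[XField K] E)
    (hj : Function.Injective j) (hjN : ∀ z, j (N' z) = N (j z)) :
    Submodule.span (XField K) (solutions K N') = ⊤ := by
  have h := hN.le_span_solutions hS (W := LinearMap.range j) (by
    rintro _ ⟨z, rfl⟩
    exact ⟨N' z, hjN z⟩)
  have hsub : solutions K N ∩ (LinearMap.range j : Set E) ⊆ j '' solutions K N' := by
    rintro _ ⟨h1, z, rfl⟩
    refine ⟨z, ?_, rfl⟩
    rcases h1 with h1 | h1
    · exact .inl (hj (by rw [hjN, h1, map_zero]))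
    · exact .inr (hj (by rw [hjN, h1, map_smul]))
  rw [eq_top_iff]
  rintro z -
  have h1 := Submodule.span_mono hsub (h ⟨z, rfl⟩)
  rw [Submodule.span_image] at h1
  obtain ⟨z', hz', h2⟩ := h1
  rwa [← hj h2]

theorem IsDifferential.exists_basis {N : E →+ E}
    (hS : Submodule.span (XField K) (solutions K N) = ⊤) :
    ∃ (q : Set E) (b : Module.Basis q (XField K) E), ∀ i, b i ∈ solutions K N := by
  obtain ⟨q, hq, hqs, hli⟩ := exists_linearIndependent (XField K) (solutions K N)
  refine ⟨q, Module.Basis.mk hli (by rw [Subtype.range_coe, hqs, hS]), fun i => ?_⟩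
  rw [Module.Basis.mk_apply]
  exact hq i.2

/-- The dual differential module. -/
def dualDifferential (N : E →+ E) (hN : IsDifferential K N) :
    Module.Dual (XField K) E →+ Module.Dual (XField K) E :=
  AddMonoidHom.mk' (fun φ =>
    { toFun := fun v => invDeriv K (φ v) - φ (N v)
      map_add' := fun v w => by simp only [map_add]; ring
      map_smul' := fun c v => by
        rw [hN, map_add, map_smul φ, map_smul φ, map_smul φ, smul_eq_mul, Derivation.leibniz]
        simp only [smul_eq_mul, RingHom.id_apply]; ring })
    (fun φ ψ => by
      ext v
      simp only [LinearMap.coe_mk, AddHom.coe_mk, LinearMap.add_apply, map_add]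
      ring)

theorem dualDifferential_apply {N : E →+ E} (hN : IsDifferential K N) (φ : Module.Dual (XField K) E)
    (v : E) : dualDifferential N hN φ v = invDeriv K (φ v) - φ (N v) := rfl

theorem isDifferential_dualDifferential {N : E →+ E} (hN : IsDifferential K N) :
    IsDifferential K (dualDifferential N hN) := by
  intro c φ
  ext v
  simp only [dualDifferential_apply, LinearMap.smul_apply, LinearMap.add_apply, smul_eq_mul,
    Derivation.leibniz]
  ring

variable [CharZero K]

/-- The action of the nontrivial element of the Galois group. -/
theorem IsDifferential.exists_sign {N : E →+ E} (hN : IsDifferential K N)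
    (hS : Submodule.span (XField K) (solutions K N) = ⊤) : ∃ τ : E →ₗ[XField K] E,
      (∀ v, N v = 0 → τ v = v) ∧ ∀ v, N v = halfLogDeriv K • v → τ v = -v := by
  classical
  obtain ⟨q, b, hb⟩ := IsDifferential.exists_basis hS
  choose m hm hbm using fun i : q => exists_eq_smul_of_mem_solutions (hb i)
  have hli : LinearIndependent (XField K) ((⊥ : Submodule (XField K) E).mkQ ∘ b) := by
    refine b.linearIndependent.map' _ ?_
    rw [Submodule.ker_mkQ]
  have hW : ∀ w ∈ (⊥ : Submodule (XField K) E), N w ∈ (⊥ : Submodule (XField K) E) := by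
    intro w hw
    rw [Submodule.mem_bot] at hw ⊢
    rw [hw, map_zero]
  have hcoef : ∀ {n v}, N v = n • v → ∀ i, invDeriv K (b.repr v i) = (n - m i) * b.repr v i :=
    fun {n v} hv i => hN.invDeriv_coeff hW hbm hli hv (by
      rw [b.linearCombination_repr, sub_self]; exact zero_mem _) i
  -- By `hcoef` a solution has zero coefficients on basis vectors of the other type, so the diagonal
  -- map with these signs acts correctly on all solutions.
  let σ : q → XField K := fun i => if m i = 0 then 1 else -1
  refine ⟨b.constr (XField K) fun i => σ i • b i, fun v hv => ?_, fun v hv => ?_⟩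
  · have h := hcoef (n := 0) (by rw [hv, zero_smul])
    rw [Module.Basis.constr_apply]
    conv_rhs => rw [← b.linearCombination_repr v, Finsupp.linearCombination_apply]
    refine Finset.sum_congr rfl fun i _ => ?_
    by_cases h0 : m i = 0
    · simp only [σ, if_pos h0, one_smul]
    · have h1 := h i
      rw [(hm i).resolve_left h0, zero_sub] at h1
      simp only [eq_zero_of_invDeriv_eq_neg h1, zero_smul]
  · have h := hcoef hv
    rw [Module.Basis.constr_apply]
    conv_rhs => rw [← b.linearCombination_repr v, Finsupp.linearCombination_apply]
    rw [Finsupp.sum, Finsupp.sum, ← Finset.sum_neg_distrib]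
    refine Finset.sum_congr rfl fun i _ => ?_
    by_cases h0 : m i = 0
    · have h1 := h i
      rw [h0, sub_zero] at h1
      simp only [eq_zero_of_invDeriv_eq h1, zero_smul, neg_zero]
    · simp only [σ, if_neg h0, neg_smul, one_smul, smul_neg]

/-- The dual basis satisfies the equations with opposite weights. The weight -dg/2g becomes dg/2g
after multiplication by g, so the nontrivial type is self-dual. -/
theorem span_solutions_dualDifferential [Module.Finite (XField K) E] {N : E →+ E}
    (hN : IsDifferential K N) (hS : Submodule.span (XField K) (solutions K N) = ⊤) :
    Submodule.span (XField K) (solutions K (dualDifferential N hN)) = ⊤ := by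
  classical
  obtain ⟨q, b, hb⟩ := IsDifferential.exists_basis hS
  have : Finite q := Module.Finite.finite_basis b
  choose m hm hbm using fun i : q => exists_eq_smul_of_mem_solutions (hb i)
  have h1 : ∀ i, dualDifferential N hN (b.dualBasis i) = (-m i) • b.dualBasis i := by
    intro i
    refine b.ext fun j => ?_
    rw [dualDifferential_apply, hbm, map_smul, LinearMap.smul_apply, b.dualBasis_apply_self]
    split_ifs with h
    · rw [h, Derivation.map_one_eq_zero]; simp
    · simp
  rw [eq_top_iff, ← b.dualBasis.span_eq, Submodule.span_le]
  rintro _ ⟨i, rfl⟩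
  rcases hm i with h0 | h0
  · exact Submodule.subset_span (.inl (by rw [h1, h0, neg_zero, zero_smul]))
  · have h2 : gF K • b.dualBasis i ∈ solutions K (dualDifferential N hN) := by
      refine .inr ?_
      rw [isDifferential_dualDifferential hN, h1, h0, invDeriv_gF, smul_smul, ← add_smul, smul_smul]
      congr 1
      ring
    have h3 := Submodule.smul_mem _ (gF K)⁻¹ (Submodule.subset_span (R := XField K) h2)
    rwa [smul_smul, inv_mul_cancel₀ gF_ne_zero, one_smul] at h3

end DifferentialModules

/-! ### Tensor products and duals after a base change -/

section TensorBaseChange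

open TensorProduct

variable {A : Type} (T : Type) {V W : Type} [CommRing A] [CommRing T] [Algebra A T] [AddCommGroup V] [Module A V]
  [AddCommGroup W] [Module A W]

/-- The product `(T ⊗ V) × (T ⊗ W) → T ⊗ (V ⊗ W)`. -/
def tmulBaseChange : T ⊗[A] V →ₗ[T] T ⊗[A] W →ₗ[T] T ⊗[A] (V ⊗[A] W) :=
  (TensorProduct.mk T (T ⊗[A] V) (T ⊗[A] W)).compr₂
    (AlgebraTensorModule.distribBaseChange A T V W).symm.toLinearMap

variable {T}

theorem tmulBaseChange_tmul (a b : T) (v : V) (w : W) :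
    tmulBaseChange T (a ⊗ₜ[A] v) (b ⊗ₜ[A] w) = (a * b) ⊗ₜ[A] (v ⊗ₜ[A] w) := by
  have h : b ⊗ₜ[A] w = b • (1 : T) ⊗ₜ[A] w := by rw [smul_tmul', smul_eq_mul, mul_one]
  change (AlgebraTensorModule.distribBaseChange A T V W).symm ((a ⊗ₜ[A] v) ⊗ₜ[T] (b ⊗ₜ[A] w)) = _
  rw [LinearEquiv.symm_apply_eq, AlgebraTensorModule.distribBaseChange_tmul, h, tmul_smul,
    smul_tmul', smul_tmul', smul_eq_mul, mul_comm]

theorem distribBaseChange_tmulBaseChange (z : T ⊗[A] V) (w : T ⊗[A] W) :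
    AlgebraTensorModule.distribBaseChange A T V W (tmulBaseChange T z w) = z ⊗ₜ[T] w :=
  LinearEquiv.apply_symm_apply _ _

variable (T) in
/-- The base change of a bilinear form. -/
def pairingBaseChange (p : V ⊗[A] W →ₗ[A] A) : T ⊗[A] V →ₗ[T] T ⊗[A] W →ₗ[T] T :=
  (tmulBaseChange T).compr₂ ((AlgebraTensorModule.rid A T T).toLinearMap ∘ₗ p.baseChange T)

theorem pairingBaseChange_apply (p : V ⊗[A] W →ₗ[A] A) (z : T ⊗[A] V) (w : T ⊗[A] W) :
    pairingBaseChange T p z w = AlgebraTensorModule.rid A T T (p.baseChange T (tmulBaseChange T z w)) :=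
  rfl

theorem pairingBaseChange_tmul (p : V ⊗[A] W →ₗ[A] A) (a b : T) (v : V) (w : W) :
    pairingBaseChange T p (a ⊗ₜ[A] v) (b ⊗ₜ[A] w) = algebraMap A T (p (v ⊗ₜ w)) * (a * b) := by
  rw [pairingBaseChange_apply, tmulBaseChange_tmul, LinearMap.baseChange_tmul,
    AlgebraTensorModule.rid_tmul, Algebra.smul_def]

end TensorBaseChange

namespace Connection

open TensorProduct

variable {R A V W : Type} [CommRing R] [CommRing A] [Algebra R A] [AddCommGroup V] [Module A V]
  [AddCommGroup W] [Module A W]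
variable {A' : Type} [CommRing A'] [Algebra A A']

theorem rTensor_tensorLeft (f : Ω[A⁄R] →ₗ[A] A') (z : Ω[A⁄R] ⊗[A] V) (w : W) :
    LinearMap.rTensor _ f (tensorLeft z w)
      = tmulBaseChange A' (LinearMap.rTensor V f z) (1 ⊗ₜ w) := by
  induction z using TensorProduct.induction_on with
  | zero => simp
  | add x y hx hy => simp only [map_add, LinearMap.add_apply, hx, hy]
  | tmul ω v =>
    rw [LinearMap.rTensor_tmul, tmulBaseChange_tmul, mul_one]; rfl

theorem rTensor_tensorRight (f : Ω[A⁄R] →ₗ[A] A') (v : V) (z : Ω[A⁄R] ⊗[A] W) :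
    LinearMap.rTensor _ f (tensorRight v z)
      = tmulBaseChange A' (1 ⊗ₜ v) (LinearMap.rTensor W f z) := by
  induction z using TensorProduct.induction_on with
  | zero => simp
  | add x y hx hy => simp only [map_add, hx, hy]
  | tmul ω v =>
    rw [LinearMap.rTensor_tmul, tmulBaseChange_tmul, one_mul]; rfl

variable {R' : Type} [CommRing R'] [Algebra R' A'] [Algebra R R']
  [Algebra R A'] [IsScalarTower R R' A'] [IsScalarTower R A A']

theorem nabla_tmulBaseChange (c : Connection R A V) (c' : Connection R A W)
    (d : Derivation R' A' A') (z : A' ⊗[A] V) (w : A' ⊗[A] W) :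
    (c.tensor c').nabla d (tmulBaseChange A' z w)
      = tmulBaseChange A' (c.nabla d z) w + tmulBaseChange A' z (c'.nabla d w) := by
  induction z using TensorProduct.induction_on with
  | zero => simp
  | add x y hx hy => simp only [map_add, LinearMap.add_apply, hx, hy]; abel
  | tmul a v =>
    induction w using TensorProduct.induction_on with
    | zero => simp
    | add x y hx hy => simp only [map_add, hx, hy]; abel
    | tmul b w =>
      have h1 : a ⊗ₜ[A] v = a • (1 : A') ⊗ₜ[A] v := by rw [smul_tmul', smul_eq_mul, mul_one]
      have h2 : b ⊗ₜ[A] w = b • (1 : A') ⊗ₜ[A] w := by rw [smul_tmul', smul_eq_mul, mul_one]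
      have h3 : (c.tensor c').toFun (v ⊗ₜ w)
        = tensorLeft (c.toFun v) w + tensorRight v (c'.toFun w) := rfl
      rw [tmulBaseChange_tmul, nabla_tmul, nabla_tmul, nabla_tmul, h3, map_add, rTensor_tensorLeft,
        rTensor_tensorRight, map_add, map_add, LinearMap.add_apply, tmulBaseChange_tmul,
        tmulBaseChange_tmul, h1, h2, map_smul, map_smul, map_smul, map_smul, LinearMap.smul_apply,
        LinearMap.smul_apply, Derivation.leibniz, add_tmul, smul_eq_mul, smul_eq_mul, mul_comm b,
        smul_add, smul_smul, smul_smul, mul_comm b]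
      abel

variable (R A) in
/-- The trivial connection. -/
def trivial : Connection R A A := (ConnModule.unit R A).conn

theorem trivial_apply (a : A) :
    (trivial R A).toFun a = (TensorProduct.rid A _).symm (KaehlerDifferential.D R A a) := rfl

theorem rid_nabla_trivial (d : Derivation R' A' A') (z : A' ⊗[A] A) :
    AlgebraTensorModule.rid A A' A' ((trivial R A).nabla d z)
      = d (AlgebraTensorModule.rid A A' A' z) := by
  induction z using TensorProduct.induction_on with
  | zero => simp
  | add x y hx hy => simp only [map_add, hx, hy]
  | tmul a b =>
    have h2 : diffMap (R := R) (A := A) d (KaehlerDifferential.D R A b) = d (algebraMap A A' b) := by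
      simp [diffMap]
    rw [nabla_tmul, trivial_apply, rid_symm_apply, LinearMap.rTensor_tmul, h2, map_add, map_smul,
      AlgebraTensorModule.rid_tmul, AlgebraTensorModule.rid_tmul, AlgebraTensorModule.rid_tmul,
      one_smul, Algebra.smul_def b a, Algebra.smul_def b (d a), Derivation.leibniz, smul_eq_mul,
      smul_eq_mul]
    exact add_comm _ _

end Connection

namespace ConnModule

open TensorProduct

variable {R A : Type} [CommRing R] [CommRing A] [Algebra R A]

theorem isHorizontal_inl (V W : ConnModule R A) :
    V.conn.IsHorizontal (V.prod W).conn (LinearMap.inl A V.carrier W.carrier) := by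
  intro v
  change LinearMap.lTensor _ _ (V.conn.toFun v) + LinearMap.lTensor _ _ (W.conn.toFun 0) = _
  rw [map_zero, map_zero, add_zero]; rfl

theorem isHorizontal_inr (V W : ConnModule R A) :
    W.conn.IsHorizontal (V.prod W).conn (LinearMap.inr A V.carrier W.carrier) := by
  intro v
  change LinearMap.lTensor _ _ (V.conn.toFun 0) + LinearMap.lTensor _ _ (W.conn.toFun v) = _
  rw [map_zero, map_zero, zero_add]; rfl

variable {V V' : ConnModule R A} {B : V'.carrier ≃ₗ[A] Module.Dual A V.carrier}

/-- Duality becomes a horizontal map to the unit object, to which the naturality of fibre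
automorphisms applies. -/
theorem IsDualPairing.isHorizontal (h : IsDualPairing V V' B) :
    (V'.conn.tensor V.conn).IsHorizontal (Connection.trivial R A)
      (TensorProduct.lift B.toLinearMap) := by
  intro z
  induction z using TensorProduct.induction_on with
  | zero => simp
  | add x y hx hy => simp only [map_add, hx, hy]
  | tmul l v =>
    have h3 : (V'.conn.tensor V.conn).toFun (l ⊗ₜ v)
        = Connection.tensorLeft (V'.conn.toFun l) v + Connection.tensorRight l (V.conn.toFun v) := rfl
    have hl : ∀ x : Ω[A⁄R] ⊗[A] V'.carrier, TensorProduct.rid A (Ω[A⁄R]) (LinearMap.lTensor (Ω[A⁄R])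
        (TensorProduct.lift B.toLinearMap) (Connection.tensorLeft x v)) =
        TensorProduct.rid A (Ω[A⁄R])
        (LinearMap.lTensor (Ω[A⁄R]) (Module.Dual.eval A V.carrier v ∘ₗ B.toLinearMap) x) := by
      intro x
      induction x using TensorProduct.induction_on with
      | zero => simp
      | add x y hx hy => simp only [map_add, LinearMap.add_apply, hx, hy]
      | tmul ω l =>
        rw [LinearMap.lTensor_tmul]; rfl
    have hr : ∀ x : Ω[A⁄R] ⊗[A] V.carrier, TensorProduct.rid A (Ω[A⁄R]) (LinearMap.lTensor (Ω[A⁄R])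
        (TensorProduct.lift B.toLinearMap) (Connection.tensorRight l x)) =
        TensorProduct.rid A (Ω[A⁄R]) (LinearMap.lTensor (Ω[A⁄R]) (B l) x) := by
      intro x
      induction x using TensorProduct.induction_on with
      | zero => simp
      | add x y hx hy => simp only [map_add, hx, hy]
      | tmul ω l =>
        rw [LinearMap.lTensor_tmul]; rfl
    rw [lift.tmul, LinearEquiv.coe_coe, Connection.trivial_apply, LinearEquiv.symm_apply_eq, h, h3,
      map_add, map_add, ← hl, ← hr]

variable {R' T : Type} [CommRing R'] [CommRing T] [Algebra R' T] [Algebra R R']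
  [Algebra R T] [Algebra A T] [IsScalarTower R R' T] [IsScalarTower R A T]

theorem IsDualPairing.derivation_pairing (h : IsDualPairing V V' B) (d : Derivation R' T T)
    (z : T ⊗[A] V'.carrier) (w : T ⊗[A] V.carrier) :
    d (pairingBaseChange T (TensorProduct.lift B.toLinearMap) z w)
      = pairingBaseChange T (TensorProduct.lift B.toLinearMap) (V'.conn.nabla d z) w
        + pairingBaseChange T (TensorProduct.lift B.toLinearMap) z (V.conn.nabla d w) := by
  rw [pairingBaseChange_apply, ← Connection.rid_nabla_trivial (R := R) d,
    h.isHorizontal.nabla_baseChange d, Connection.nabla_tmulBaseChange, map_add, map_add]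
  rfl

/-- Clearing denominators reduces the kernel to elements 1 ⊗ l, for which B(l) vanishes on all of M.
No finiteness of M is needed for this half of nondegeneracy. -/
theorem pairingBaseChange_injective {L : Type} [Field L] [Algebra A L] [IsDomain A]
    [IsFractionRing A L] {M M' : Type} [AddCommGroup M] [Module A M] [AddCommGroup M'] [Module A M']
    (B : M' ≃ₗ[A] Module.Dual A M) :
    Function.Injective (pairingBaseChange L (TensorProduct.lift B.toLinearMap)) := by
  rw [injective_iff_map_eq_zero]
  intro z hz
  obtain ⟨⟨l, s⟩, hs⟩ := IsLocalizedModule.surj (nonZeroDivisors A) (TensorProduct.mk A L M' 1) z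
  have hs0 : algebraMap A L s ≠ 0 := IsLocalization.to_map_ne_zero_of_mem_nonZeroDivisors _ le_rfl s.2
  have h1 : algebraMap A L s • z = (1 : L) ⊗ₜ[A] l := by
    rw [algebraMap_smul]; exact hs
  have h2 : l = 0 := by
    rw [← B.map_eq_zero_iff]
    ext v
    have h3 : pairingBaseChange L (TensorProduct.lift B.toLinearMap) (algebraMap A L s • z)
        ((1 : L) ⊗ₜ[A] v) = 0 := by
      rw [map_smul, hz, smul_zero, LinearMap.zero_apply]
    rw [h1, pairingBaseChange_tmul, mul_one, mul_one] at h3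
    exact (map_eq_zero_iff _ (IsFractionRing.injective A L)).1 h3
  rw [h2, tmul_zero] at h1
  exact (smul_eq_zero.1 h1).resolve_left hs0

end ConnModule

/-! ### The generic fibres of the objects of the tensor category -/

section Split

open TensorProduct ConnModule

variable {K : Type} [Field K]

theorem Connection.isDifferential_nabla {M : Type} [AddCommGroup M] [Module (XRing K) M]
    (c : Connection K (XRing K) M) : IsDifferential K (c.nabla (invDeriv K)) :=
  fun a z => c.nabla_smul _ a z

/-- The generic fibre is finite-dimensional and spanned by solutions. -/
def ConnModule.IsSplit (V : ConnModule K (XRing K)) : Prop :=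
  Module.Finite (XField K) (XField K ⊗[XRing K] V.carrier) ∧
    Submodule.span (XField K) (solutions K (V.conn.nabla (invDeriv K))) = ⊤

theorem Connection.IsHorizontal.baseChange_mem_solutions {M M' : Type} [AddCommGroup M] [Module (XRing K) M]
    [AddCommGroup M'] [Module (XRing K) M'] {c : Connection K (XRing K) M} {c' : Connection K (XRing K) M'}
    {h : M →ₗ[XRing K] M'} (hh : c.IsHorizontal c' h) {z : XField K ⊗[XRing K] M}
    (hz : z ∈ solutions K (c.nabla (invDeriv K))) :
    h.baseChange (XField K) z ∈ solutions K (c'.nabla (invDeriv K)) := by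
  obtain ⟨m, hm, hmz⟩ := exists_eq_smul_of_mem_solutions hz
  exact mem_solutions_of_eq_smul hm (by rw [hh.nabla_baseChange, hmz, map_smul])

theorem Connection.IsHorizontal.range_baseChange_le {M M' : Type} [AddCommGroup M] [Module (XRing K) M]
    [AddCommGroup M'] [Module (XRing K) M'] {c : Connection K (XRing K) M} {c' : Connection K (XRing K) M'}
    {h : M →ₗ[XRing K] M'} (hh : c.IsHorizontal c' h)
    (hS : Submodule.span (XField K) (solutions K (c.nabla (invDeriv K))) = ⊤) :
    LinearMap.range (h.baseChange (XField K))
      ≤ Submodule.span (XField K) (solutions K (c'.nabla (invDeriv K))) := by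
  rw [LinearMap.range_eq_map, ← hS, Submodule.map_span]
  refine Submodule.span_mono ?_
  rintro _ ⟨z, hz, rfl⟩
  exact hh.baseChange_mem_solutions hz

theorem yX_sq_eq_mul : yX K ^ 2 = xX K * (xX K ^ 2 - 1) := by rw [yX_sq]; ring

theorem span_tmulBaseChange_eq_top {A T V W : Type} [CommRing A] [CommRing T] [Algebra A T]
    [AddCommGroup V] [Module A V] [AddCommGroup W] [Module A W] {S : Set (T ⊗[A] V)}
    {S' : Set (T ⊗[A] W)} (hS : Submodule.span T S = ⊤) (hS' : Submodule.span T S' = ⊤) :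
    Submodule.span T (Set.image2 (fun z w => tmulBaseChange T z w) S S') = ⊤ := by
  rw [← Submodule.map₂_span_span, hS, hS', eq_top_iff]
  rintro x -
  induction x using TensorProduct.induction_on with
  | zero => exact zero_mem _
  | add x y hx hy => exact add_mem hx hy
  | tmul a x =>
    induction x using TensorProduct.induction_on with
    | zero => rw [tmul_zero]; exact zero_mem _
    | add x y hx hy => rw [tmul_add]; exact add_mem hx hy
    | tmul v w =>
      rw [← mul_one a, ← tmulBaseChange_tmul]
      exact Submodule.apply_mem_map₂ _ trivial trivial

theorem isSplit_unit : (unit K (XRing K)).IsSplit := by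
  change Module.Finite (XField K) (XField K ⊗[XRing K] XRing K) ∧
    Submodule.span (XField K) (solutions K ((Connection.trivial K (XRing K)).nabla (invDeriv K))) = ⊤
  refine ⟨inferInstance, ?_⟩
  have h1 : (1 : XField K) ⊗ₜ[XRing K] (1 : XRing K)
      ∈ solutions K ((Connection.trivial K (XRing K)).nabla (invDeriv K)) := by
    refine .inl ((AlgebraTensorModule.rid (XRing K) (XField K) (XField K)).injective ?_)
    rw [Connection.rid_nabla_trivial, AlgebraTensorModule.rid_tmul, one_smul, map_zero,
      Derivation.map_one_eq_zero]
  rw [eq_top_iff]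
  rintro z -
  have h2 : z = AlgebraTensorModule.rid (XRing K) (XField K) (XField K) z
      • (1 : XField K) ⊗ₜ[XRing K] (1 : XRing K) := by
    refine (AlgebraTensorModule.rid (XRing K) (XField K) (XField K)).injective ?_
    rw [map_smul, AlgebraTensorModule.rid_tmul, one_smul, smul_eq_mul, mul_one]
  rw [h2]
  exact Submodule.smul_mem _ _ (Submodule.subset_span h1)

theorem baseChange_inl_add_baseChange_inr {A T V W : Type} [CommRing A] [CommRing T] [Algebra A T]
    [AddCommGroup V] [Module A V] [AddCommGroup W] [Module A W] (z : T ⊗[A] (V × W)) :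
    z = (LinearMap.inl A V W).baseChange T ((LinearMap.fst A V W).baseChange T z)
      + (LinearMap.inr A V W).baseChange T ((LinearMap.snd A V W).baseChange T z) := by
  induction z using TensorProduct.induction_on with
  | zero => simp
  | add x y hx hy =>
    simp only [map_add]
    nth_rw 1 [hx, hy]
    abel
  | tmul a x =>
    simp only [LinearMap.baseChange_tmul, ← tmul_add]
    simp

theorem ConnModule.IsSplit.prod {V W : ConnModule K (XRing K)} (hV : V.IsSplit) (hW : W.IsSplit) :
    (V.prod W).IsSplit := by
  obtain ⟨hV1, hV2⟩ := hV
  obtain ⟨hW1, hW2⟩ := hW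
  have hl := (isHorizontal_inl V W).range_baseChange_le hV2
  have hr := (isHorizontal_inr V W).range_baseChange_le hW2
  have hsum : ∀ z : XField K ⊗[XRing K] (V.carrier × W.carrier), z ∈
      LinearMap.range ((LinearMap.inl (XRing K) V.carrier W.carrier).baseChange (XField K)) ⊔
      LinearMap.range ((LinearMap.inr (XRing K) V.carrier W.carrier).baseChange (XField K)) := by
    intro z
    rw [baseChange_inl_add_baseChange_inr z]
    exact Submodule.add_mem_sup ⟨_, rfl⟩ ⟨_, rfl⟩
  constructor
  · change Module.Finite (XField K) (XField K ⊗[XRing K] (V.carrier × W.carrier))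
    refine ⟨?_⟩
    rw [← eq_top_iff.2 fun z _ => hsum z, LinearMap.range_eq_map, LinearMap.range_eq_map]
    exact (hV1.fg_top.map _).sup (hW1.fg_top.map _)
  · exact eq_top_iff.2 fun z _ => sup_le hl hr (hsum z)

theorem ConnModule.IsSplit.quotient {V W : ConnModule K (XRing K)} (hV : V.IsSplit)
    {q : V.carrier →ₗ[XRing K] W.carrier} (hq : Function.Surjective q)
    (h : V.conn.IsHorizontal W.conn q) : W.IsSplit := by
  obtain ⟨hV1, hV2⟩ := hV
  have hs : Function.Surjective (q.baseChange (XField K)) := LinearMap.lTensor_surjective _ hq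
  refine ⟨Module.Finite.of_surjective _ hs, ?_⟩
  rw [eq_top_iff, ← LinearMap.range_eq_top.2 hs]
  exact h.range_baseChange_le hV2

theorem ConnModule.IsSplit.sub {V W : ConnModule K (XRing K)} (hV : V.IsSplit)
    {i : W.carrier →ₗ[XRing K] V.carrier} (hi : Function.Injective i)
    (h : W.conn.IsHorizontal V.conn i) : W.IsSplit := by
  obtain ⟨hV1, hV2⟩ := hV
  have : Module.Flat (XRing K) (XField K) := IsLocalization.flat _ (nonZeroDivisors (XRing K))
  have hinj : Function.Injective (i.baseChange (XField K)) :=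
    Module.Flat.lTensor_preserves_injective_linearMap _ hi
  exact ⟨Module.Finite.of_injective _ hinj, V.conn.isDifferential_nabla.span_solutions_of_injective hV2 _ hinj
    fun z => (h.nabla_baseChange _ z).symm⟩

variable [CharZero K]

theorem isUnit_algebraMap_xX {T : Type} [CommRing T] [Algebra (XRing K) T] [Algebra (XField K) T]
    [IsScalarTower (XRing K) (XField K) T] : IsUnit (algebraMap (XRing K) T (xX K) ^ 2 - 1) := by
  have h := (gF_ne_zero (K := K)).isUnit.map (algebraMap (XField K) T)
  rwa [gF, xF, map_sub, map_pow, map_one, ← IsScalarTower.algebraMap_apply] at h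

/-- Division by g turns weight dg/g into weight 0; thus the tensor square of the nontrivial type is
trivial. -/
theorem mem_span_solutions_of_eq_two_smul {E : Type*} [AddCommGroup E] [Module (XField K) E] {N : E →+ E}
    (hN : IsDifferential K N) {z : E} (hz : N z = (2 * halfLogDeriv K) • z) :
    z ∈ Submodule.span (XField K) (solutions K N) := by
  have h : (gF K)⁻¹ • z ∈ solutions K N := by
    refine .inl ?_
    rw [hN, hz, invDeriv_inv_gF, smul_smul, ← add_smul]
    convert zero_smul (XField K) z using 2
    ring
  have := Submodule.smul_mem _ (gF K) (Submodule.subset_span (R := XField K) h)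
  rwa [smul_smul, mul_inv_cancel₀ gF_ne_zero, one_smul] at this

theorem tmulBaseChange_mem_span_solutions {V W : Type} [AddCommGroup V] [Module (XRing K) V]
    [AddCommGroup W] [Module (XRing K) W] (c : Connection K (XRing K) V) (c' : Connection K (XRing K) W)
    {z : XField K ⊗[XRing K] V} {w : XField K ⊗[XRing K] W}
    (hz : z ∈ solutions K (c.nabla (invDeriv K))) (hw : w ∈ solutions K (c'.nabla (invDeriv K))) :
    tmulBaseChange (XField K) z w
      ∈ Submodule.span (XField K) (solutions K ((c.tensor c').nabla (invDeriv K))) := by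
  have h := c.nabla_tmulBaseChange c' (invDeriv K) z w
  rcases hz with hz | hz <;> rcases hw with hw | hw <;> rw [hz, hw] at h <;>
    simp only [map_zero, LinearMap.zero_apply, map_smul, LinearMap.smul_apply, zero_add, add_zero] at h
  · exact Submodule.subset_span (.inl h)
  · exact Submodule.subset_span (.inr h)
  · exact Submodule.subset_span (.inr h)
  · refine mem_span_solutions_of_eq_two_smul (c.tensor c').isDifferential_nabla ?_
    rw [h, ← add_smul, two_mul]

theorem ConnModule.IsSplit.tensor {V W : ConnModule K (XRing K)} (hV : V.IsSplit) (hW : W.IsSplit) :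
    (V.tensor W).IsSplit := by
  change Module.Finite (XField K) (XField K ⊗[XRing K] (V.carrier ⊗[XRing K] W.carrier)) ∧
    Submodule.span (XField K) (solutions K ((V.conn.tensor W.conn).nabla (invDeriv K))) = ⊤
  obtain ⟨hV1, hV2⟩ := hV
  obtain ⟨hW1, hW2⟩ := hW
  refine ⟨Module.Finite.equiv (AlgebraTensorModule.distribBaseChange (XRing K) (XField K) V.carrier
    W.carrier).symm, ?_⟩
  rw [eq_top_iff, ← span_tmulBaseChange_eq_top hV2 hW2, Submodule.span_le]
  rintro _ ⟨z, hz, w, hw, rfl⟩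
  exact tmulBaseChange_mem_span_solutions _ _ hz hw

theorem ConnModule.IsSplit.dual {V V' : ConnModule K (XRing K)} (hV : V.IsSplit)
    {B : V'.carrier ≃ₗ[XRing K] Module.Dual (XRing K) V.carrier} (h : IsDualPairing V V' B) :
    V'.IsSplit := by
  obtain ⟨hV1, hV2⟩ := hV
  have hinj := pairingBaseChange_injective (L := XField K) B
  refine ⟨Module.Finite.of_injective _ hinj,
    (isDifferential_dualDifferential V.conn.isDifferential_nabla).span_solutions_of_injective
      (span_solutions_dualDifferential V.conn.isDifferential_nabla hV2) _ hinj fun z => ?_⟩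
  refine LinearMap.ext fun w => ?_
  rw [dualDifferential_apply, h.derivation_pairing, add_sub_cancel_right]

/-- Each generating operation preserves the property; its finiteness clause is what makes duals
work. -/
theorem ConnModule.IsSplit.of_inTensorCategory {V₀ V : ConnModule K (XRing K)} (h₀ : V₀.IsSplit)
    (h : InTensorCategory V₀ V) : V.IsSplit := by
  induction h with
  | base => exact h₀
  | unit => exact isSplit_unit
  | tensor _ _ hV hW => exact hV.tensor hW
  | prod _ _ hV hW => exact hV.prod hW
  | dual _ _ h hV => exact hV.dual h
  | sub _ _ hi h hV => exact hV.sub hi h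
  | quotient _ _ hq h hV => exact hV.quotient hq h

variable {B : Type} [CommRing B] [Algebra (XRing K) B]

theorem nabla_tmul_s {c : Connection K (XRing K) B} (hc : c.IsMultiplicative)
    (e : Cover (XRing K) (xX K) (yX K) ≃ₐ[XRing K] B) :
    c.nabla (invDeriv K) (1 ⊗ₜ e Cover.s) = halfLogDeriv K • ((1 : XField K) ⊗ₜ[XRing K] e Cover.s) := by
  have h := hc.two_smul_nabla_of_sq (invDeriv K) (Cover.tmul_s_mul_tmul_s (A' := XField K) e)
  have hg : algebraMap (XRing K) (XField K) (xX K) ^ 2 - 1 = gF K := rfl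
  rw [hg, invDeriv_gF, mul_right_comm, mul_smul (2 * gF K)] at h
  have : CharZero (XField K) := charZero_of_injective_algebraMap (algebraMap K (XField K)).injective
  have h2 : (2 * gF K) ≠ 0 := mul_ne_zero two_ne_zero gF_ne_zero
  exact smul_right_injective _ h2 h

theorem isSplit_of_isMultiplicative {c : Connection K (XRing K) B} (hc : c.IsMultiplicative)
    (e : Cover (XRing K) (xX K) (yX K) ≃ₐ[XRing K] B) : ConnModule.IsSplit ⟨B, c⟩ := by
  let b := Cover.tensorBasis (A' := XField K) yX_sq_eq_mul isUnit_algebraMap_xX e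
  refine ⟨Module.Finite.of_basis b, ?_⟩
  rw [eq_top_iff, ← b.span_eq, Submodule.span_le]
  rintro _ ⟨i, rfl⟩
  refine Submodule.subset_span ?_
  fin_cases i
  · exact .inl ((congrArg _ (Cover.tensorBasis_zero _ _ e)).trans (hc.nabla_one _))
  · refine .inr ?_
    change c.nabla _ (b 1) = _ • b 1
    rw [Cover.tensorBasis_one]
    exact nabla_tmul_s hc e

end Split

/-! ### Base change along a tower of algebras -/

section Tower

open TensorProduct

variable {A L : Type} (T : Type) {V W : Type} [CommRing A] [CommRing L] [Algebra A L] [CommRing T]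
  [Algebra A T] [Algebra L T] [IsScalarTower A L T] [AddCommGroup V] [Module A V] [AddCommGroup W]
  [Module A W]

/-- The map `L ⊗ V → T ⊗ V`. -/
def towerMap : L ⊗[A] V →ₗ[A] T ⊗[A] V :=
  LinearMap.rTensor V (IsScalarTower.toAlgHom A L T).toLinearMap

variable {T}

theorem towerMap_tmul (a : L) (v : V) : towerMap T (a ⊗ₜ[A] v) = algebraMap L T a ⊗ₜ[A] v := rfl

theorem towerMap_one_tmul (v : V) : towerMap T ((1 : L) ⊗ₜ[A] v) = (1 : T) ⊗ₜ[A] v := by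
  rw [towerMap_tmul, map_one]

theorem towerMap_smul (a : L) (z : L ⊗[A] V) :
    towerMap T (a • z) = algebraMap L T a • towerMap T z := by
  induction z using TensorProduct.induction_on with
  | zero => simp
  | add x y hx hy => simp only [map_add, smul_add, hx, hy]
  | tmul b v => rw [smul_tmul', towerMap_tmul, towerMap_tmul, smul_tmul', smul_eq_mul, map_mul,
      smul_eq_mul]

theorem towerMap_self (z : L ⊗[A] V) : towerMap L z = z := by
  induction z using TensorProduct.induction_on with
  | zero => simp
  | add x y hx hy => simp only [map_add, hx, hy]
  | tmul b v => rfl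

theorem baseChange_towerMap (h : V →ₗ[A] W) (z : L ⊗[A] V) :
    h.baseChange T (towerMap T z) = towerMap T (h.baseChange L z) := by
  induction z using TensorProduct.induction_on with
  | zero => simp
  | add x y hx hy => simp only [map_add, hx, hy]
  | tmul b v => rfl

theorem tmulBaseChange_towerMap (z : L ⊗[A] V) (w : L ⊗[A] W) :
    tmulBaseChange T (towerMap T z) (towerMap T w) = towerMap T (tmulBaseChange L z w) := by
  induction z using TensorProduct.induction_on with
  | zero => simp
  | add x y hx hy => simp only [map_add, LinearMap.add_apply, hx, hy]
  | tmul a v =>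
    induction w using TensorProduct.induction_on with
    | zero => simp
    | add x y hx hy => simp only [map_add, hx, hy]
    | tmul b w =>
      rw [towerMap_tmul, towerMap_tmul, tmulBaseChange_tmul, tmulBaseChange_tmul, towerMap_tmul, map_mul]

theorem pairingBaseChange_towerMap (p : V ⊗[A] W →ₗ[A] A) (z : L ⊗[A] V) (w : L ⊗[A] W) :
    pairingBaseChange T p (towerMap T z) (towerMap T w) = algebraMap L T (pairingBaseChange L p z w) := by
  induction z using TensorProduct.induction_on with
  | zero => simp
  | add x y hx hy => simp only [map_add, LinearMap.add_apply, hx, hy]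
  | tmul a v =>
    induction w using TensorProduct.induction_on with
    | zero => simp
    | add x y hx hy => simp only [map_add, hx, hy]
    | tmul b w =>
      rw [towerMap_tmul, towerMap_tmul, pairingBaseChange_tmul, pairingBaseChange_tmul, map_mul, map_mul,
        ← IsScalarTower.algebraMap_apply]

theorem span_towerMap_image_eq_top {S : Set (L ⊗[A] V)} (hS : Submodule.span L S = ⊤) :
    Submodule.span T (towerMap T '' S) = ⊤ := by
  have h : ∀ z : L ⊗[A] V, towerMap T z ∈ Submodule.span T (towerMap T '' S) := by
    intro z
    have hz : z ∈ Submodule.span L S := by rw [hS]; trivial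
    induction hz using Submodule.span_induction with
    | mem z hz => exact Submodule.subset_span ⟨z, hz, rfl⟩
    | zero => rw [map_zero]; exact zero_mem _
    | add x y _ _ hx hy => rw [map_add]; exact add_mem hx hy
    | smul a x _ hx => rw [towerMap_smul]; exact Submodule.smul_mem _ _ hx
  rw [eq_top_iff]
  rintro z -
  induction z using TensorProduct.induction_on with
  | zero => exact zero_mem _
  | add x y hx hy => exact add_mem hx hy
  | tmul a v =>
    have h1 : a ⊗ₜ[A] v = a • towerMap T ((1 : L) ⊗ₜ[A] v) := by
      rw [towerMap_one_tmul, smul_tmul', smul_eq_mul, mul_one]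
    rw [h1]
    exact Submodule.smul_mem _ _ (h _)

variable (T) in
/-- The extension of scalars of a linear map from `L` to `T`. -/
def extendScalarsTower (φ : L ⊗[A] V →ₗ[L] L ⊗[A] W) : T ⊗[A] V →ₗ[T] T ⊗[A] W :=
  LinearMap.liftBaseChange T (towerMap T ∘ₗ φ.restrictScalars A ∘ₗ TensorProduct.mk A L V 1)

theorem extendScalarsTower_towerMap (φ : L ⊗[A] V →ₗ[L] L ⊗[A] W) (z : L ⊗[A] V) :
    extendScalarsTower T φ (towerMap T z) = towerMap T (φ z) := by
  induction z using TensorProduct.induction_on with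
  | zero => simp
  | add x y hx hy => simp only [map_add, hx, hy]
  | tmul a v =>
    have h1 : a ⊗ₜ[A] v = a • (1 : L) ⊗ₜ[A] v := by rw [smul_tmul', smul_eq_mul, mul_one]
    rw [h1, towerMap_smul, map_smul, map_smul, towerMap_smul, towerMap_one_tmul]
    congr 1
    rw [extendScalarsTower, LinearMap.liftBaseChange_tmul, one_smul]
    rfl

theorem distribBaseChange_apply_eq {f : T ⊗[A] (V ⊗[A] W) →ₗ[T] T ⊗[A] (V ⊗[A] W)}
    {g : T ⊗[A] V →ₗ[T] T ⊗[A] V} {h : T ⊗[A] W →ₗ[T] T ⊗[A] W}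
    (H : ∀ z w, f (tmulBaseChange T z w) = tmulBaseChange T (g z) (h w)) (x : T ⊗[A] (V ⊗[A] W)) :
    AlgebraTensorModule.distribBaseChange A T V W (f x)
      = TensorProduct.map g h (AlgebraTensorModule.distribBaseChange A T V W x) := by
  obtain ⟨y, rfl⟩ := (AlgebraTensorModule.distribBaseChange A T V W).symm.surjective x
  rw [LinearEquiv.apply_symm_apply]
  induction y using TensorProduct.induction_on with
  | zero => simp
  | add x y hx hy => simp only [map_add, hx, hy]
  | tmul z w => rw [map_tmul, ← distribBaseChange_tmulBaseChange (g z), ← H]; rfl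

end Tower

/-! ### The automorphisms of the fibre functor -/

section GaloisAction

open TensorProduct ConnModule

variable {K : Type} [Field K] [CharZero K]

/-- The nontrivial element of the Galois group. -/
def ConnModule.IsSplit.sign {V : ConnModule K (XRing K)} (hV : V.IsSplit) :
    XField K ⊗[XRing K] V.carrier →ₗ[XField K] XField K ⊗[XRing K] V.carrier :=
  (V.conn.isDifferential_nabla.exists_sign hV.2).choose

theorem ConnModule.IsSplit.sign_of_eq_zero {V : ConnModule K (XRing K)} (hV : V.IsSplit)
    {z : XField K ⊗[XRing K] V.carrier} (hz : V.conn.nabla (invDeriv K) z = 0) : hV.sign z = z :=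
  (V.conn.isDifferential_nabla.exists_sign hV.2).choose_spec.1 z hz

theorem ConnModule.IsSplit.sign_of_eq_smul {V : ConnModule K (XRing K)} (hV : V.IsSplit)
    {z : XField K ⊗[XRing K] V.carrier} (hz : V.conn.nabla (invDeriv K) z = halfLogDeriv K • z) :
    hV.sign z = -z :=
  (V.conn.isDifferential_nabla.exists_sign hV.2).choose_spec.2 z hz

variable {T : Type} [CommRing T] [Algebra (XRing K) T] [Algebra (XField K) T]
  [IsScalarTower (XRing K) (XField K) T]

/-- The combination `a + b σ` of the elements `1` and `σ` of the Galois group. -/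
def ConnModule.IsSplit.act {V : ConnModule K (XRing K)} (hV : V.IsSplit) (a b : T) :
    T ⊗[XRing K] V.carrier →ₗ[T] T ⊗[XRing K] V.carrier :=
  a • LinearMap.id + b • extendScalarsTower T hV.sign

theorem ConnModule.IsSplit.act_towerMap {V : ConnModule K (XRing K)} (hV : V.IsSplit) (a b : T)
    (z : XField K ⊗[XRing K] V.carrier) :
    hV.act a b (towerMap T z) = a • towerMap T z + b • towerMap T (hV.sign z) := by
  rw [IsSplit.act, LinearMap.add_apply, LinearMap.smul_apply, LinearMap.smul_apply, LinearMap.id_apply,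
    extendScalarsTower_towerMap]

variable {V W : ConnModule K (XRing K)} (hV : V.IsSplit) (hW : W.IsSplit) {a b : T}

theorem ConnModule.IsSplit.act_of_eq_zero (hab : a + b = 1) {z : XField K ⊗[XRing K] V.carrier}
    (hz : V.conn.nabla (invDeriv K) z = 0) : hV.act a b (towerMap T z) = towerMap T z := by
  rw [hV.act_towerMap, hV.sign_of_eq_zero hz, ← add_smul, hab, one_smul]

theorem ConnModule.IsSplit.act_of_eq_smul {z : XField K ⊗[XRing K] V.carrier}
    (hz : V.conn.nabla (invDeriv K) z = halfLogDeriv K • z) :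
    hV.act a b (towerMap T z) = (a - b) • towerMap T z := by
  rw [hV.act_towerMap, hV.sign_of_eq_smul hz, map_neg, smul_neg, ← sub_eq_add_neg]
  exact (sub_smul a b _).symm

theorem ConnModule.IsSplit.act_of_eq_two_smul (hab : a + b = 1) {z : XField K ⊗[XRing K] V.carrier}
    (hz : V.conn.nabla (invDeriv K) z = (2 * halfLogDeriv K) • z) :
    hV.act a b (towerMap T z) = towerMap T z := by
  have h : V.conn.nabla (invDeriv K) ((gF K)⁻¹ • z) = 0 := by
    rw [Connection.nabla_smul, hz, invDeriv_inv_gF, smul_smul, ← add_smul]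
    convert zero_smul (XField K) z using 2
    ring
  have h2 : z = gF K • (gF K)⁻¹ • z := by rw [smul_smul, mul_inv_cancel₀ gF_ne_zero, one_smul]
  rw [h2, towerMap_smul, map_smul, hV.act_of_eq_zero hab h]

/-- Linear maps that agree on solutions are equal. -/
theorem ConnModule.IsSplit.linearMap_ext {K : Type} [Field K] {T : Type} [CommRing T]
    [Algebra (XRing K) T] [Algebra (XField K) T] [IsScalarTower (XRing K) (XField K) T]
    {V : ConnModule K (XRing K)} (hV : V.IsSplit) {E : Type*} [AddCommMonoid E] [Module T E]
    {f f' : T ⊗[XRing K] V.carrier →ₗ[T] E}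
    (h0 : ∀ z, V.conn.nabla (invDeriv K) z = 0 → f (towerMap T z) = f' (towerMap T z))
    (h1 : ∀ z, V.conn.nabla (invDeriv K) z = halfLogDeriv K • z → f (towerMap T z) = f' (towerMap T z)) :
    f = f' := by
  refine LinearMap.ext_on (span_towerMap_image_eq_top (T := T) hV.2) ?_
  rintro _ ⟨z, hz | hz, rfl⟩
  · exact h0 z hz
  · exact h1 z hz

theorem sub_mul_sub_eq_one (hab : a + b = 1) (hab' : a * b = 0) : (a - b) * (a - b) = 1 := by
  linear_combination (a + b + 1) * hab - 4 * hab'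

theorem ConnModule.IsSplit.act_act (hab : a + b = 1) (hab' : a * b = 0) :
    hV.act a b ∘ₗ hV.act a b = LinearMap.id := by
  refine hV.linearMap_ext (fun z hz => ?_) fun z hz => ?_
  · rw [LinearMap.comp_apply, hV.act_of_eq_zero hab hz, hV.act_of_eq_zero hab hz, LinearMap.id_apply]
  · rw [LinearMap.comp_apply, hV.act_of_eq_smul hz, map_smul, hV.act_of_eq_smul hz, smul_smul,
      sub_mul_sub_eq_one hab hab', one_smul, LinearMap.id_apply]

theorem ConnModule.IsSplit.act_naturality (hab : a + b = 1) {h : V.carrier →ₗ[XRing K] W.carrier}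
    (hh : V.conn.IsHorizontal W.conn h) :
    hW.act a b ∘ₗ h.baseChange T = h.baseChange T ∘ₗ hV.act a b := by
  refine hV.linearMap_ext (fun z hz => ?_) fun z hz => ?_
  · rw [LinearMap.comp_apply, LinearMap.comp_apply, hV.act_of_eq_zero hab hz, baseChange_towerMap,
      hW.act_of_eq_zero hab (by rw [hh.nabla_baseChange, hz, map_zero])]
  · rw [LinearMap.comp_apply, LinearMap.comp_apply, hV.act_of_eq_smul hz, map_smul, baseChange_towerMap,
      hW.act_of_eq_smul (by rw [hh.nabla_baseChange, hz, map_smul])]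

/-- Checked on pairs of solutions: the eigenvalues 1 and a - b multiply as the weights add, with (a
- b)² = 1 matching the trivialized weight dg/g. -/
theorem ConnModule.IsSplit.act_tmulBaseChange (hab : a + b = 1) (hab' : a * b = 0)
    (hVW : (V.tensor W).IsSplit) (z : T ⊗[XRing K] V.carrier) (w : T ⊗[XRing K] W.carrier) :
    hVW.act a b (tmulBaseChange T z w) = tmulBaseChange T (hV.act a b z) (hW.act a b w) := by
  let m : T ⊗[XRing K] V.carrier →ₗ[T] T ⊗[XRing K] W.carrier →ₗ[T]
    T ⊗[XRing K] (V.carrier ⊗[XRing K] W.carrier) := tmulBaseChange T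
  let f : T ⊗[XRing K] (V.carrier ⊗[XRing K] W.carrier) →ₗ[T]
    T ⊗[XRing K] (V.carrier ⊗[XRing K] W.carrier) := hVW.act a b
  have h : m.compr₂ f = m.compl₁₂ (hV.act a b) (hW.act a b) := by
    refine hV.linearMap_ext (fun z hz => ?_) fun z hz => ?_ <;>
      refine hW.linearMap_ext (fun w hw => ?_) fun w hw => ?_ <;>
      have h := V.conn.nabla_tmulBaseChange W.conn (invDeriv K) z w <;> rw [hz, hw] at h <;>
      simp only [map_zero, LinearMap.zero_apply, map_smul, LinearMap.smul_apply, zero_add, add_zero] at h <;>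
      rw [LinearMap.compr₂_apply, LinearMap.compl₁₂_apply] <;> simp only [m, tmulBaseChange_towerMap]
    · rw [hV.act_of_eq_zero hab hz, hW.act_of_eq_zero hab hw, tmulBaseChange_towerMap]
      exact hVW.act_of_eq_zero hab h
    · rw [hV.act_of_eq_zero hab hz, hW.act_of_eq_smul hw, map_smul, tmulBaseChange_towerMap]
      exact hVW.act_of_eq_smul h
    · rw [hV.act_of_eq_smul hz, hW.act_of_eq_zero hab hw, map_smul, LinearMap.smul_apply,
        tmulBaseChange_towerMap]
      exact hVW.act_of_eq_smul h
    · rw [hV.act_of_eq_smul hz, hW.act_of_eq_smul hw, map_smul, map_smul, LinearMap.smul_apply,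
        tmulBaseChange_towerMap, smul_smul, sub_mul_sub_eq_one hab hab', one_smul]
      rw [← add_smul, ← two_mul] at h
      exact hVW.act_of_eq_two_smul hab h
  exact LinearMap.congr_fun₂ h z w

theorem ConnModule.IsSplit.act_unit (hab : a + b = 1) (h : (unit K (XRing K)).IsSplit)
    (x : T ⊗[XRing K] (unit K (XRing K)).carrier) : h.act a b x = x := by
  have h1 : (Connection.trivial K (XRing K)).nabla (invDeriv K) ((1 : XField K) ⊗ₜ[XRing K] (1 : XRing K)) = 0 := by
    refine (AlgebraTensorModule.rid (XRing K) (XField K) (XField K)).injective ?_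
    rw [Connection.rid_nabla_trivial, AlgebraTensorModule.rid_tmul, one_smul, map_zero,
      Derivation.map_one_eq_zero]
  have h2 : x = AlgebraTensorModule.rid (XRing K) T T x
      • towerMap T ((1 : XField K) ⊗ₜ[XRing K] (1 : XRing K)) := by
    refine (AlgebraTensorModule.rid (XRing K) T T).injective ?_
    rw [towerMap_one_tmul, map_smul, AlgebraTensorModule.rid_tmul, one_smul, smul_eq_mul, mul_one]
  rw [h2]
  exact (map_smul (h.act a b) _ _).trans (congrArg _ (h.act_of_eq_zero hab h1))

variable {V₀ : ConnModule K (XRing K)}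

/-- The automorphism `a + b σ` of the fibre functor, for complementary orthogonal idempotents `a`
and `b`. -/
def ConnModule.IsSplit.fibreAut (h₀ : V₀.IsSplit) (a b : T) (hab : a + b = 1) (hab' : a * b = 0) :
    FibreAut V₀ T where
  app _ h := LinearEquiv.ofLinearMap ((h₀.of_inTensorCategory h).act a b)
    ((h₀.of_inTensorCategory h).act a b) (IsSplit.act_act _ hab hab') (IsSplit.act_act _ hab hab')
  naturality _ _ _ _ _ hh x := LinearMap.congr_fun (IsSplit.act_naturality _ _ hab hh) x
  map_unit _ x := IsSplit.act_unit hab _ x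
  map_tensor _ _ hV hW hVW x := distribBaseChange_apply_eq
    (IsSplit.act_tmulBaseChange (h₀.of_inTensorCategory hV) (h₀.of_inTensorCategory hW) hab hab'
      (h₀.of_inTensorCategory hVW)) x

end GaloisAction

/-! ### An automorphism of the fibre functor is determined by its value at the generator -/

namespace ConnModule

open TensorProduct

section Pairing

variable {A L T : Type} [CommRing A] [IsDomain A] [Field L] [Algebra A L] [IsFractionRing A L]
  [CommRing T] [Algebra A T] [Algebra L T] [IsScalarTower A L T] {M M' : Type} [AddCommGroup M]
  [Module A M] [AddCommGroup M'] [Module A M']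

/-- Over the field L the pairing embeds L ⊗ M' in a finite power of L, with a left inverse ψ. The
resulting formula z = Σ ⟨z, bᵢ⟩ψ(eᵢ) extends linearly to T. -/
theorem eq_zero_of_pairingBaseChange_eq_zero [Module.Finite L (L ⊗[A] M)]
    (B : M' ≃ₗ[A] Module.Dual A M) {z : T ⊗[A] M'}
    (hz : ∀ w, pairingBaseChange T (TensorProduct.lift B.toLinearMap) z w = 0) : z = 0 := by
  let p := TensorProduct.lift B.toLinearMap
  let b := Module.finBasis L (L ⊗[A] M)
  let φ : L ⊗[A] M' →ₗ[L] (Fin (Module.finrank L (L ⊗[A] M)) → L) :=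
    LinearMap.pi fun i => (pairingBaseChange L p).flip (b i)
  have hφ : LinearMap.ker φ = ⊥ := by
    refine LinearMap.ker_eq_bot'.2 fun z hz => ?_
    refine (map_eq_zero_iff _ (pairingBaseChange_injective B)).1 (b.ext fun i => ?_)
    exact congrFun hz i
  obtain ⟨ψ, hψ⟩ := LinearMap.exists_leftInverse_of_injective φ hφ
  let f : T ⊗[A] M' →ₗ[T] T ⊗[A] M' := ∑ i, ((pairingBaseChange T p).flip (towerMap T (b i))).smulRight
    (towerMap T (ψ (Pi.single i 1)))
  have hf : f = LinearMap.id := by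
    refine LinearMap.ext_on (span_towerMap_image_eq_top (T := T) (Submodule.span_univ (R := L))) ?_
    rintro _ ⟨z, -, rfl⟩
    have h1 : ψ (φ z) = z := LinearMap.congr_fun hψ z
    rw [LinearMap.id_apply]
    conv_rhs => rw [← h1, pi_eq_sum_univ' (φ z), map_sum, map_sum]
    rw [LinearMap.sum_apply]
    refine Finset.sum_congr rfl fun i _ => ?_
    rw [map_smul, towerMap_smul, LinearMap.smulRight_apply, LinearMap.flip_apply,
      pairingBaseChange_towerMap]
    rfl
  rw [← LinearMap.id_apply (R := T) z, ← hf, LinearMap.sum_apply]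
  refine Finset.sum_eq_zero fun i _ => ?_
  rw [LinearMap.smulRight_apply, LinearMap.flip_apply, hz, zero_smul]

end Pairing

section FibreAut

variable {R A T : Type} [CommRing R] [CommRing A] [Algebra R A] [CommRing T] [Algebra A T]
  {V₀ V V' W : ConnModule R A} (g : FibreAut V₀ T)

theorem FibreAut.app_tmulBaseChange (hV : InTensorCategory V₀ V) (hW : InTensorCategory V₀ W)
    (hVW : InTensorCategory V₀ (V.tensor W)) (z : T ⊗[A] V.carrier) (w : T ⊗[A] W.carrier) :
    g.app (V.tensor W) hVW (tmulBaseChange T z w)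
      = tmulBaseChange T (g.app V hV z) (g.app W hW w) := by
  refine (AlgebraTensorModule.distribBaseChange A T V.carrier W.carrier).injective ?_
  refine (g.map_tensor V W hV hW hVW _).trans ?_
  rw [distribBaseChange_tmulBaseChange, distribBaseChange_tmulBaseChange]; rfl

/-- The pairing is a horizontal map to the unit, on which automorphisms act trivially. -/
theorem FibreAut.pairing_app {B : V'.carrier ≃ₗ[A] Module.Dual A V.carrier} (h : IsDualPairing V V' B)
    (hV : InTensorCategory V₀ V) (hV' : InTensorCategory V₀ V') (z : T ⊗[A] V'.carrier)
    (w : T ⊗[A] V.carrier) :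
    pairingBaseChange T (TensorProduct.lift B.toLinearMap) (g.app V' hV' z) (g.app V hV w)
      = pairingBaseChange T (TensorProduct.lift B.toLinearMap) z w := by
  rw [pairingBaseChange_apply, ← g.app_tmulBaseChange hV' hV (hV'.tensor hV)]
  refine congrArg (AlgebraTensorModule.rid A T T) ?_
  exact (g.naturality (V'.tensor V) (unit R A) (hV'.tensor hV) .unit _ h.isHorizontal _).symm.trans
    (g.map_unit _ _)

/-- Two automorphisms of the fibre functor that agree on a generator agree. -/
theorem FibreAut.app_eq_of_app_base_eq {L : Type} [Field L] [IsDomain A] [Algebra A L] [IsFractionRing A L]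
    [Algebra L T] [IsScalarTower A L T]
    (hfin : ∀ V, InTensorCategory V₀ V → Module.Finite L (L ⊗[A] V.carrier)) {g g' : FibreAut V₀ T}
    (h₀ : ∀ x, g.app V₀ .base x = g'.app V₀ .base x) (hV : InTensorCategory V₀ V) (x : T ⊗[A] V.carrier) :
    g.app V hV x = g'.app V hV x := by
  induction hV with
  | base => exact h₀ x
  | unit => rw [g.map_unit, g'.map_unit]
  | @tensor V W hV hW ihV ihW =>
    refine (AlgebraTensorModule.distribBaseChange A T V.carrier W.carrier).injective ?_
    refine (g.map_tensor V W hV hW _ _).trans (Eq.trans ?_ (g'.map_tensor V W hV hW _ _).symm)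
    rw [LinearEquiv.ext ihV, LinearEquiv.ext ihW]
  | @prod V W hV hW ihV ihW =>
    have hl := fun (g : FibreAut V₀ T) => g.naturality V _ hV (hV.prod hW) _ (isHorizontal_inl V W)
    have hr := fun (g : FibreAut V₀ T) => g.naturality W _ hW (hV.prod hW) _ (isHorizontal_inr V W)
    have hx := baseChange_inl_add_baseChange_inr (V := V.carrier) (W := W.carrier) x
    rw [hx]
    refine (map_add (g.app _ (hV.prod hW)) _ _).trans (Eq.trans ?_ (map_add (g'.app _ (hV.prod hW)) _ _).symm)
    exact congrArg₂ (· + ·) ((hl g _).trans ((congrArg _ (ihV _)).trans (hl g' _).symm))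
      ((hr g _).trans ((congrArg _ (ihW _)).trans (hr g' _).symm))
  | @dual V V' B hV h ih =>
    rw [← sub_eq_zero]
    have := hfin V hV
    refine eq_zero_of_pairingBaseChange_eq_zero (L := L) B fun w => ?_
    -- The test vector is written as an image under g, which is also the image under g' by
    -- induction; both automorphisms preserve the pairing.
    obtain ⟨w, rfl⟩ := (g.app V hV).surjective w
    rw [map_sub, LinearMap.sub_apply, g.pairing_app h, ih, g'.pairing_app h, sub_self]
  | @sub V W i hV hi h ih =>
    have : Module.Flat A L := IsLocalization.flat _ (nonZeroDivisors A)
    -- T is flat over A through the field L, so the inclusion of the subobject stays injective.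
    have : Module.Flat A T := Module.Flat.trans A L T
    have hinj : Function.Injective (i.baseChange T) :=
      Module.Flat.lTensor_preserves_injective_linearMap _ hi
    refine hinj ?_
    rw [← g.naturality W V (hV.sub i hi h) hV i h, ← g'.naturality W V (hV.sub i hi h) hV i h, ih]
  | @quotient V W q hV hq h ih =>
    obtain ⟨x, rfl⟩ : ∃ y, q.baseChange T y = x := LinearMap.lTensor_surjective _ hq x
    rw [g.naturality V W hV (hV.quotient q hq h) q h, g'.naturality V W hV (hV.quotient q hq h) q h, ih]

end FibreAut

end ConnModule

/-! ### The differential Galois group of the covering -/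

namespace Connection

open TensorProduct

variable {R A C : Type} [CommRing R] [CommRing A] [Algebra R A] [CommRing C] [Algebra A C]
  {c : Connection R A C}

theorem IsMultiplicative.isHorizontal_mul (hc : c.IsMultiplicative) :
    (c.tensor c).IsHorizontal c (LinearMap.mul' A C) := by
  intro z
  induction z using TensorProduct.induction_on with
  | zero => simp
  | add x y hx hy => simp only [map_add, hx, hy]
  | tmul b b' =>
    have hl : ∀ x : Ω[A⁄R] ⊗[A] C, LinearMap.lTensor (Ω[A⁄R]) (LinearMap.mul' A C) (tensorLeft x b')
        = LinearMap.lTensor (Ω[A⁄R]) (LinearMap.mulLeft A b') x := by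
      intro x
      induction x using TensorProduct.induction_on with
      | zero => simp
      | add x y hx hy => simp only [map_add, LinearMap.add_apply, hx, hy]
      | tmul ω l =>
        rw [LinearMap.lTensor_tmul, LinearMap.mulLeft_apply, mul_comm]; rfl
    have hr : ∀ x : Ω[A⁄R] ⊗[A] C, LinearMap.lTensor (Ω[A⁄R]) (LinearMap.mul' A C) (tensorRight b x)
        = LinearMap.lTensor (Ω[A⁄R]) (LinearMap.mulLeft A b) x := by
      intro x
      induction x using TensorProduct.induction_on with
      | zero => simp
      | add x y hx hy => simp only [map_add, hx, hy]
      | tmul ω l => rfl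
    have h : (c.tensor c).toFun (b ⊗ₜ b') = tensorLeft (c.toFun b) b' + tensorRight b (c.toFun b') := rfl
    rw [LinearMap.mul'_apply, hc, h, map_add, hl, hr, add_comm]

theorem IsMultiplicative.isHorizontal_algebraMap (hc : c.IsMultiplicative) :
    (trivial R A).IsHorizontal c (Algebra.linearMap A C) := by
  intro a
  rw [Algebra.linearMap_apply, hc.map_algebraMap, trivial_apply, rid_symm_apply, LinearMap.lTensor_tmul,
    Algebra.linearMap_apply, _root_.map_one]

end Connection

namespace ConnModule.FibreAut

open TensorProduct

variable {R A T C : Type} [CommRing R] [CommRing A] [Algebra R A] [CommRing T] [Algebra A T] [CommRing C]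
  [Algebra A C] {c : Connection R A C}

theorem app_mul (hc : c.IsMultiplicative) (g : FibreAut ⟨C, c⟩ T) (z w : T ⊗[A] C) :
    g.app ⟨C, c⟩ .base (z * w) = g.app ⟨C, c⟩ .base z * g.app ⟨C, c⟩ .base w := by
  have hm : ∀ z w : T ⊗[A] C, (LinearMap.mul' A C).baseChange T (tmulBaseChange T z w) = z * w := by
    intro z w
    induction z using TensorProduct.induction_on with
    | zero => simp
    | add x y hx hy => simp only [map_add, LinearMap.add_apply, hx, hy, add_mul]
    | tmul a v =>
      induction w using TensorProduct.induction_on with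
      | zero => simp
      | add x y hx hy => simp only [map_add, hx, hy, mul_add]
      | tmul b w => rw [tmulBaseChange_tmul, LinearMap.baseChange_tmul, LinearMap.mul'_apply,
          Algebra.TensorProduct.tmul_mul_tmul]
  have h := g.naturality (tensor ⟨C, c⟩ ⟨C, c⟩) ⟨C, c⟩ (.tensor .base .base) .base _ hc.isHorizontal_mul
    (tmulBaseChange T z w)
  rw [g.app_tmulBaseChange .base .base] at h
  exact (congrArg _ (hm z w)).symm.trans (h.trans (hm _ _))

theorem app_one (hc : c.IsMultiplicative) (g : FibreAut ⟨C, c⟩ T) : g.app ⟨C, c⟩ .base ((1 : T) ⊗ₜ[A] (1 : C)) = (1 : T) ⊗ₜ[A] (1 : C) := by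
  have h := g.naturality (unit R A) ⟨C, c⟩ .unit .base _ hc.isHorizontal_algebraMap
    ((1 : T) ⊗ₜ[A] (1 : A))
  rw [g.map_unit] at h
  have h1 : (Algebra.linearMap A C).baseChange T ((1 : T) ⊗ₜ[A] (1 : A)) = 1 ⊗ₜ 1 := by
    rw [LinearMap.baseChange_tmul, Algebra.linearMap_apply, map_one]
  exact (congrArg _ h1).symm.trans (h.trans h1)

end ConnModule.FibreAut

namespace Cover

variable {A B : Type} [CommRing A] [CommRing B] [Algebra A B] {x y : A}

/-- The nontrivial automorphism of the covering. -/
def neg (A : Type) [CommRing A] (x y : A) : Cover A x y ≃ₐ[A] Cover A x y :=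
  AlgEquiv.ofAlgHom
    (lift (-t) (-s) (by rw [neg_sq, t_sq]) (by rw [neg_mul_neg, t_mul_s]) (by rw [neg_sq, s_sq]))
    (lift (-t) (-s) (by rw [neg_sq, t_sq]) (by rw [neg_mul_neg, t_mul_s]) (by rw [neg_sq, s_sq]))
    (algHom_ext (by simp [lift_t]) (by simp [lift_s]))
    (algHom_ext (by simp [lift_t]) (by simp [lift_s]))

theorem neg_s : neg A x y s = -s :=
  lift_s (x := x) (y := y) (h1 := by rw [neg_sq, t_sq]) (h2 := by rw [neg_mul_neg, t_mul_s])
    (h3 := by rw [neg_sq, s_sq])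

end Cover

section GaloisGroup

open TensorProduct ConnModule

variable {K B : Type} [Field K] [CharZero K] [CommRing B] [Algebra (XRing K) B]
  {c : Connection K (XRing K) B} (e : Cover (XRing K) (xX K) (yX K) ≃ₐ[XRing K] B)
  {T : Type} [CommRing T] [Algebra (XRing K) T] [Algebra (XField K) T]
  [IsScalarTower (XRing K) (XField K) T]

theorem isUnit_two_of_algebra_XField (K T : Type) [Field K] [CharZero K] [CommRing T]
    [Algebra (XField K) T] : IsUnit (2 : T) := by
  have : CharZero (XField K) := charZero_of_injective_algebraMap (algebraMap K (XField K)).injective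
  have h := (two_ne_zero (α := XField K)).isUnit.map (algebraMap (XField K) T)
  rwa [map_ofNat] at h

theorem exists_smul_tmul_one_add_smul_tmul_s (z : T ⊗[XRing K] B) :
    ∃ a b : T, z = a • 1 ⊗ₜ 1 + b • 1 ⊗ₜ e Cover.s := by
  have h := (Cover.tensorBasis (A' := T) yX_sq_eq_mul isUnit_algebraMap_xX e).sum_repr z
  rw [Fin.sum_univ_two, Cover.tensorBasis_zero, Cover.tensorBasis_one] at h
  exact ⟨_, _, h.symm⟩

theorem smul_tmul_one_add_smul_tmul_s_inj {a b a' b' : T}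
    (h : a • (1 : T) ⊗ₜ[XRing K] (1 : B) + b • 1 ⊗ₜ e Cover.s = a' • 1 ⊗ₜ 1 + b' • 1 ⊗ₜ e Cover.s) :
    a = a' ∧ b = b' := by
  let β := Cover.tensorBasis (A' := T) yX_sq_eq_mul isUnit_algebraMap_xX e
  rw [← Cover.tensorBasis_zero yX_sq_eq_mul isUnit_algebraMap_xX e,
    ← Cover.tensorBasis_one yX_sq_eq_mul isUnit_algebraMap_xX e] at h
  have h2 := congrArg β.repr h
  have h0 := DFunLike.congr_fun h2 0
  have h1 := DFunLike.congr_fun h2 1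
  simp only [map_add, map_smul, Finsupp.add_apply, Finsupp.smul_apply, β, Module.Basis.repr_self] at h0 h1
  simp at h0 h1
  exact ⟨h0, h1⟩

/-- The automorphism is multiplicative and, by naturality, commutes with the horizontal deck
involution s ↦ -s. Hence the image of s lies in the (-1)-part Ts, as 2 is invertible, and s² = x² -
1 being a unit forces u² = 1. -/
theorem ConnModule.FibreAut.exists_app_tmul_s [Algebra.FormallyUnramified (XRing K) B]
    (hc : c.IsMultiplicative) (g : FibreAut ⟨B, c⟩ T) :
    ∃ u : T, u * u = 1 ∧ g.app ⟨B, c⟩ .base (1 ⊗ₜ[XRing K] e Cover.s) = u • 1 ⊗ₜ e Cover.s := by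
  let σ : B ≃ₐ[XRing K] B := (e.symm.trans (Cover.neg _ _ _)).trans e
  let F : T ⊗[XRing K] B →ₗ[T] T ⊗[XRing K] B := (g.app ⟨B, c⟩ .base).toLinearMap
  have hσ : σ (e Cover.s) = - e Cover.s := by
    simp [σ, Cover.neg_s]
  have hF1 : F 1 = 1 := app_one hc g
  have hFm : ∀ z w, F (z * w) = F z * F w := app_mul hc g
  have hFσ : ∀ z, F (σ.toLinearMap.baseChange T z) = σ.toLinearMap.baseChange T (F z) :=
    g.naturality ⟨B, c⟩ ⟨B, c⟩ .base .base _ (hc.isHorizontal hc σ)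
  obtain ⟨a, b, hab⟩ := exists_smul_tmul_one_add_smul_tmul_s e (F (1 ⊗ₜ[XRing K] e Cover.s))
  have h1 := hFσ (1 ⊗ₜ e Cover.s)
  have h2 : σ.toLinearMap.baseChange T (1 ⊗ₜ[XRing K] e Cover.s) = - 1 ⊗ₜ e Cover.s := by
    rw [LinearMap.baseChange_tmul, AlgEquiv.toLinearMap_apply, hσ, tmul_neg]
  have h3 : σ.toLinearMap.baseChange T (1 ⊗ₜ[XRing K] (1 : B)) = 1 ⊗ₜ 1 := by
    rw [LinearMap.baseChange_tmul, AlgEquiv.toLinearMap_apply, map_one]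
  have h4 : (-a) • (1 : T) ⊗ₜ[XRing K] (1 : B) + (-b) • 1 ⊗ₜ e Cover.s
      = a • 1 ⊗ₜ 1 + (-b) • 1 ⊗ₜ e Cover.s := by
    rw [h2, map_neg, hab, map_add, map_smul, map_smul, h2, h3, smul_neg, neg_add] at h1
    rwa [neg_smul, neg_smul]
  have ha : a = 0 := by
    have h5 := (smul_tmul_one_add_smul_tmul_s_inj e h4).1
    refine (isUnit_two_of_algebra_XField K T).mul_right_eq_zero.1 ?_
    linear_combination -h5
  rw [ha, zero_smul, zero_add] at hab
  refine ⟨b, ?_, hab⟩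
  have h5 := hFm (1 ⊗ₜ e Cover.s) (1 ⊗ₜ e Cover.s)
  rw [hab, smul_mul_smul_comm, Cover.tmul_s_mul_tmul_s, Algebra.algebraMap_eq_smul_one, map_smul, hF1,
    smul_smul, Algebra.TensorProduct.one_def] at h5
  have h6 := (smul_tmul_one_add_smul_tmul_s_inj e
    (congrArg (· + (0 : T) • (1 : T) ⊗ₜ[XRing K] e Cover.s) h5)).1
  exact (isUnit_algebraMap_xX (K := K)).mul_right_cancel (by rw [one_mul, ← h6])

theorem sum_multiplicative_zmod_two {M : Type*} [AddCommMonoid M] (f : Multiplicative (ZMod 2) → M) :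
    ∑ γ, f γ = f 1 + f (Multiplicative.ofAdd 1) :=
  Fin.sum_univ_two f

theorem completeOrthogonalIdempotents_zmod_two {S : Type*} [CommRing S] {f : Multiplicative (ZMod 2) → S} :
    CompleteOrthogonalIdempotents f ↔ f 1 + f (Multiplicative.ofAdd 1) = 1 ∧
      f 1 * f (Multiplicative.ofAdd 1) = 0 := by
  constructor
  · intro h
    refine ⟨by rw [← sum_multiplicative_zmod_two, h.complete], h.ortho (by decide)⟩
  · rintro ⟨h1, h2⟩
    have h : ∀ γ : Multiplicative (ZMod 2), γ = 1 ∨ γ = Multiplicative.ofAdd 1 := by decide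
    refine ⟨⟨fun γ => ?_, fun γ δ hγδ => ?_⟩, by rw [sum_multiplicative_zmod_two, h1]⟩
    · rcases h γ with rfl | rfl
      · change f 1 * f 1 = f 1
        linear_combination f 1 * h1 - h2
      · change f _ * f _ = f _
        linear_combination f (Multiplicative.ofAdd 1) * h1 - h2
    · rcases h γ with rfl | rfl <;> rcases h δ with rfl | rfl
      · exact absurd rfl hγδ
      · exact h2
      · exact (mul_comm _ _).trans h2
      · exact absurd rfl hγδ

/-- The T-points are the square roots u of 1 in T. Since 2 is invertible they correspond to pairs of
complementary orthogonal idempotents (1 ± u)/2, that is, to points of the constant group. -/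
theorem hasConstantGaloisGroup_of_isMultiplicative [Algebra.FormallyUnramified (XRing K) B]
    (hc : c.IsMultiplicative) (e : Cover (XRing K) (xX K) (yX K) ≃ₐ[XRing K] B) :
    ConnModule.HasConstantGaloisGroup ⟨B, c⟩ (XField K) (Multiplicative (ZMod 2)) := by
  have h₀ := isSplit_of_isMultiplicative hc e
  -- The idempotent pairs (1, 0) for the identity and (0, 1) for the involution.
  let ε : Multiplicative (ZMod 2) → XField K := fun γ => if γ = 1 then 1 else 0
  have hε : ∀ γ, ε γ + (1 - ε γ) = 1 := fun γ => add_sub_cancel _ _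
  have hε' : ∀ γ, ε γ * (1 - ε γ) = 0 := fun γ => by simp only [ε]; split_ifs <;> ring
  let ρ : Multiplicative (ZMod 2) → FibreAut ⟨B, c⟩ (XField K) := fun γ =>
    h₀.fibreAut (ε γ) (1 - ε γ) (hε γ) (hε' γ)
  have hρ : ∀ γ V (hV : InTensorCategory ⟨B, c⟩ V) x, (ρ γ).app V hV x
      = (h₀.of_inTensorCategory hV).act (ε γ) (1 - ε γ) x := fun γ V hV x => rfl
  refine ⟨ρ, fun γ δ V hV x => ?_, fun T _ _ _ _ => ?_⟩
  · rw [hρ, hρ, hρ, ← LinearMap.comp_apply]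
    refine LinearMap.congr_fun ((h₀.of_inTensorCategory hV).linearMap_ext (fun z hz => ?_) fun z hz => ?_) x
    · rw [LinearMap.comp_apply, IsSplit.act_of_eq_zero _ (hε _) hz, IsSplit.act_of_eq_zero _ (hε _) hz,
        IsSplit.act_of_eq_zero _ (hε _) hz]
    · rw [LinearMap.comp_apply, IsSplit.act_of_eq_smul _ hz, IsSplit.act_of_eq_smul _ hz, map_smul,
        IsSplit.act_of_eq_smul _ hz, smul_smul]
      congr 1
      have h : ∀ γ : Multiplicative (ZMod 2), γ = 1 ∨ γ = Multiplicative.ofAdd 1 := by decide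
      have h1 : ε 1 = 1 := if_pos rfl
      have h2 : ε (Multiplicative.ofAdd 1) = 0 := if_neg (by decide)
      have h3 : (Multiplicative.ofAdd 1 * Multiplicative.ofAdd 1 : Multiplicative (ZMod 2)) = 1 := by decide
      rcases h γ with rfl | rfl <;> rcases h δ with rfl | rfl <;> simp only [one_mul, mul_one, h1, h2, h3] <;>
        ring
  · intro Represents
    have hrep : ∀ (f : Multiplicative (ZMod 2) → T) (g : FibreAut ⟨B, c⟩ T), Represents f g ↔
        ∀ V (hV : InTensorCategory ⟨B, c⟩ V) (v : V.carrier), g.app V hV ((1 : T) ⊗ₜ[XRing K] v)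
          = (h₀.of_inTensorCategory hV).act (f 1) (f (Multiplicative.ofAdd 1))
            ((1 : T) ⊗ₜ[XRing K] v) := by
      intro f g
      refine forall_congr' fun V => forall_congr' fun hV => forall_congr' fun v => ?_
      have h1 : (ρ 1).app V hV ((1 : XField K) ⊗ₜ[XRing K] v) = 1 ⊗ₜ v := by
        rw [hρ, ← towerMap_one_tmul (L := XField K), IsSplit.act_towerMap]
        simp only [ε, if_pos, sub_self, one_smul, zero_smul, add_zero]
      have h2 : (ρ (Multiplicative.ofAdd 1)).app V hV ((1 : XField K) ⊗ₜ[XRing K] v)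
          = (h₀.of_inTensorCategory hV).sign (1 ⊗ₜ v) := by
        have h3 : ε (Multiplicative.ofAdd 1) = 0 := if_neg (by decide)
        rw [hρ, ← towerMap_one_tmul (L := XField K), IsSplit.act_towerMap, h3, sub_zero, zero_smul,
          zero_add, one_smul, towerMap_self, towerMap_self]
      rw [sum_multiplicative_zmod_two, h1, h2, ← towerMap_one_tmul (L := XField K) (T := T) v,
        IsSplit.act_towerMap]
      rfl
    refine ⟨fun f hf => ?_, fun g => ?_⟩
    · obtain ⟨h1, h2⟩ := completeOrthogonalIdempotents_zmod_two.1 hf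
      exact ⟨h₀.fibreAut _ _ h1 h2, (hrep _ _).2 fun V hV v => rfl⟩
    · obtain ⟨u, hu, hgu⟩ := FibreAut.exists_app_tmul_s e hc g
      obtain ⟨h, hh⟩ := (isUnit_two_of_algebra_XField K T).exists_left_inv
      have hs : ∀ a b : T, h₀.act a b ((1 : T) ⊗ₜ[XRing K] e Cover.s) = (a - b) • 1 ⊗ₜ e Cover.s := by
        intro a b
        have := h₀.act_of_eq_smul (a := a) (b := b) (nabla_tmul_s hc e)
        rwa [towerMap_one_tmul] at this
      -- Here h = 1/2.
      let f : Multiplicative (ZMod 2) → T := fun γ => if γ = 1 then h * (1 + u) else h * (1 - u)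
      have hf1 : f 1 = h * (1 + u) := if_pos rfl
      have hf2 : f (Multiplicative.ofAdd 1) = h * (1 - u) := if_neg (by decide)
      have h1 : f 1 + f (Multiplicative.ofAdd 1) = 1 := by
        rw [hf1, hf2]; linear_combination hh
      have h2 : f 1 * f (Multiplicative.ofAdd 1) = 0 := by
        rw [hf1, hf2]; linear_combination -h ^ 2 * hu
      let g' := h₀.fibreAut _ _ h1 h2
      have hgg' : ∀ x, g.app ⟨B, c⟩ .base x = g'.app ⟨B, c⟩ .base x := by
        let F : T ⊗[XRing K] B →ₗ[T] T ⊗[XRing K] B := (g.app ⟨B, c⟩ .base).toLinearMap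
        let F' : T ⊗[XRing K] B →ₗ[T] T ⊗[XRing K] B := (g'.app ⟨B, c⟩ .base).toLinearMap
        have e1 : F (1 ⊗ₜ 1) = F' (1 ⊗ₜ 1) :=
          (FibreAut.app_one hc g).trans (FibreAut.app_one hc g').symm
        have e2 : F (1 ⊗ₜ e Cover.s) = F' (1 ⊗ₜ e Cover.s) := by
          refine hgu.trans (Eq.trans ?_ (hs _ _).symm)
          congr 1
          rw [hf1, hf2]; linear_combination -u * hh
        intro (x : T ⊗[XRing K] B)
        change F x = F' x
        obtain ⟨a, b, rfl⟩ := exists_smul_tmul_one_add_smul_tmul_s e x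
        rw [map_add, map_add, map_smul, map_smul, map_smul, map_smul, e1, e2]
      refine ⟨f, ⟨completeOrthogonalIdempotents_zmod_two.2 ⟨h1, h2⟩, (hrep _ _).2 fun V hV v => ?_⟩, ?_⟩
      · exact FibreAut.app_eq_of_app_base_eq (L := XField K)
          (fun V hV => (h₀.of_inTensorCategory hV).1) hgg' hV _
      -- Uniqueness: completeness fixes the sum of the two values of f', and the action on s fixes
      -- their difference, which is u.
      · rintro f' ⟨hf', hr⟩
        have h3 := (completeOrthogonalIdempotents_zmod_two.1 hf').1
        have h4 := ((hrep _ _).1 hr ⟨B, c⟩ .base (e Cover.s)).symm.trans hgu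
        have h5 := (hs _ _).symm.trans h4
        have h6 := (smul_tmul_one_add_smul_tmul_s_inj e
          (congrArg ((0 : T) • (1 : T) ⊗ₜ[XRing K] (1 : B) + ·) h5)).2
        have h7 : ∀ γ : Multiplicative (ZMod 2), γ = 1 ∨ γ = Multiplicative.ofAdd 1 := by decide
        funext γ
        rcases h7 γ with rfl | rfl
        · rw [hf1]; linear_combination h * h3 + h * h6 - f' 1 * hh
        · rw [hf2]; linear_combination h * h3 - h * h6 - f' (Multiplicative.ofAdd 1) * hh

theorem hasConstantGaloisGroup [Algebra K B] [IsScalarTower K (XRing K) B] [Algebra.Etale (XRing K) B]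
    (e : Cover (XRing K) (xX K) (yX K) ≃ₐ[XRing K] B) :
    ConnModule.HasConstantGaloisGroup ⟨B, Connection.pushforwardTrivial K (XRing K) B⟩
      (XField K) (Multiplicative (ZMod 2)) :=
  hasConstantGaloisGroup_of_isMultiplicative Connection.pushforwardTrivial_isMultiplicative e

end GaloisGroup

theorem isUnit_two_adjoin_inv_two {K : Type} [Field K] [CharZero K] :
    IsUnit (2 : Algebra.adjoin (𝓞 K) {(2 : K)⁻¹}) := by
  refine .of_mul_eq_one ⟨(2 : K)⁻¹, Algebra.subset_adjoin rfl⟩ (Subtype.ext ?_)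
  change (2 : K) * 2⁻¹ = 1
  simp

end

theorem mainTheorem11 {K : Type} [Field K] [NumberField K]
    (hK : Module.finrank ℚ K = 2) (hi : ∃ i : K, i ^ 2 = -1)
    (f : SelfIsogeny K) (hf : f.degree = 2) :
    ∃ _ : Algebra.Etale (XRing K) f.PreimageRing,
      Module.Finite (XRing K) f.PreimageRing ∧
      Module.Projective (XRing K) f.PreimageRing ∧
      PCurvaturesVanishForAll
        (Connection.pushforwardTrivial K (XRing K) f.PreimageRing) ∧
      HasVanishingModelOnX (Connection.pushforwardTrivial K (XRing K) f.PreimageRing)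
        (Algebra.adjoin (𝓞 K) {(2 : K)⁻¹}) {p | p ≠ 2} ∧
      HasVanishingModelOnU (Connection.pushforwardTrivial K (XRing K) f.PreimageRing)
        (𝓞 K) Set.univ ∧
      ConnModule.HasConstantGaloisGroup
        ⟨f.PreimageRing, Connection.pushforwardTrivial K (XRing K) f.PreimageRing⟩
        (XField K) (Multiplicative (ZMod 2)) := by
  obtain ⟨t, ht⟩ := f.exists_sq_eq hi hf
  obtain ⟨e⟩ := SelfIsogeny.nonempty_cover_equiv hf (t := t) ht
  have h2 : IsUnit (2 : XRing K) := by
    rw [← map_ofNat (algebraMap K (XRing K))]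
    exact (IsUnit.mk0 _ two_ne_zero).map _
  have : Algebra.Etale (XRing K) (Cover (XRing K) (xX K) (yX K)) := Cover.etale h2 (yX_sq_eq K)
  have hetale : Algebra.Etale (XRing K) f.PreimageRing := .of_equiv e
  have hfin : Module.Finite (XRing K) f.PreimageRing := .equiv e.toLinearEquiv
  -- With N = 2 there are no exceptional primes; at p = 2 the reduction of the model is over the
  -- zero ring.
  refine ⟨hetale, hfin, Cover.projective_of_etale, ⟨⟨2, two_ne_zero, ∅, ?_⟩,
    formalSectionsMeromorphic e⟩, hasVanishingModelOnX_of_isUnit e _ isUnit_two_adjoin_inv_two _,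
    hasVanishingModelOnU e _ _, hasConstantGaloisGroup e⟩
  exact hasVanishingModelOnX_of_isUnit e _ isUnit_two_adjoin_inv_two _
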